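/- Let $G$ be a connected, locally finite graph (multiple edges allowed, no loops) in which a natural direction has been fixed for every edge, i.e. a parametrization $\theta_e\colon[0,1]\to e$. Let $|G|$ be its Freudenthal compactification: the 1-complex $G$ together with its ends (equivalence classes of rays, two rays being equivalent if no finite set of vertices separates them), with the topology generated by the open sets of $G$ and the sets $\hat C(S,\omega)$ for every finite $S\subseteq V(G)$ and every end $\omega$; here $\hat C(S,\omega)$ consists of the component $C$ of $G-S$ in which $\omega$ lives, the ends living in $C$, and the open edges between $S$ and $C$. Let $\check H_1(|G|)$ be the inverse limit of the groups $H_1(N_{\mathcal U};\mathbb Z)$, where $\mathcal U$ ranges over all open covers of $|G|$ ordered by refinement and $N_{\mathcal U}$ is the nerve of $\mathcal U$. Let $\vec{\mathcal C}(G)$ be the group of all functions on the oriented edges of $G$ that are thin sums $\sum_i\varphi_{\alpha_i}$ of oriented circuits. Here a circle $\alpha$ is an injective continuous map $\mathbb R/\mathbb Z\to|G|$; $\varphi_\alpha(\vec e)$ is $1$ if $\alpha$ traverses $\vec e$, $-1$ if $\alpha$ traverses the reverse of $\vec e$, and $0$ otherwise (traversals may pass through the base point of the circle); and a family is thin if every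 oriented edge has a non-zero value under only finitely many of its members. Then $\check H_1(|G|)$ and $\vec{\mathcal C}(G)$ are canonically isomorphic. Explicitly, there is a unique group isomorphism $\Phi\colon\check H_1(|G|)\to\vec{\mathcal C}(G)$ such that, for every class $c$ and every edge $e$, the value of $\Phi(c)$ on the natural orientation of $e$ is the net number of times that $c$ runs through $e$ in its natural direction. This number is defined as follows. In the nerve of the open cover of $|G|$ by the three sets $|G|\setminus\theta_e([\frac13,\frac23])$, $A=\theta_e((0,\frac23))$ and $B=\theta_e((\frac13,1))$ (a triangle without interior), it is the coefficient of the oriented 1-simplex from $A$ to $B$ in any simplicial 1-cycle representing $c$. Moreover, for every normal spanning tree $T$ of $G$, evaluating on the naturally oriented chords of $T$ (the edges of $G$ not in $T$) is a bijective homomorphism $\vec{\mathcal C}(G)\to\prod_{e\in E(G)\setminus E(T)}\mathbb Z$. Hence both groups are direct products of copies of $\mathbb Z$, one for each chord of $T$. -/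

import Mathlib

/-! # Čech homology in degree one -/

namespace Cech

universe u

/-- An open cover of a space `X`, given as a set of open sets with union `X`. -/
structure OpenCover (X : Type u) [TopologicalSpace X] where
  sets : Set (Set X)
  isOpen_of_mem : ∀ A ∈ sets, IsOpen A
  sUnion_eq : ⋃₀ sets = Set.univ

variable {X : Type u} [TopologicalSpace X]

/-- The ordered `n`-simplices of the nerve of a cover `U`: the `(n+1)`-tuples of members of `U`,
repetitions allowed, that have a point in common.

The homology of the nerve is computed from the complex of ordered simplicial chains, which has the
same homology as the complex of oriented chains. (An empty member of `U` would only contribute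
an isolated vertex to the nerve, which is irrelevant in degree one.) -/
def Simplex (U : OpenCover X) (n : ℕ) : Type u :=
  {s : Fin (n + 1) → U.sets // (⋂ i, (s i : Set X)).Nonempty}

/-- The `i`-th face of an ordered simplex: leave out the `i`-th entry. -/
def Simplex.face {U : OpenCover X} {n : ℕ} (s : Simplex U (n + 1)) (i : Fin (n + 2)) :
    Simplex U n :=
  ⟨fun j => s.1 (i.succAbove j),
    s.2.mono (Set.subset_iInter fun j => Set.iInter_subset _ (i.succAbove j))⟩

/-- Ordered simplicial `n`-chains of the nerve, with integer coefficients. -/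
abbrev Chain (U : OpenCover X) (n : ℕ) : Type u := Simplex U n →₀ ℤ

/-- The simplicial boundary map `∂ : C_{n+1} → C_n`. -/
noncomputable def boundary (U : OpenCover X) (n : ℕ) : Chain U (n + 1) →ₗ[ℤ] Chain U n :=
  Finsupp.linearCombination ℤ fun s : Simplex U (n + 1) =>
    ∑ i : Fin (n + 2), (-1 : ℤ) ^ (i : ℕ) • Finsupp.single (s.face i) (1 : ℤ)

/-- The 1-cycles of the nerve of `U`. -/
noncomputable abbrev cycles (U : OpenCover X) : Submodule ℤ (Chain U 1) :=
  LinearMap.ker (boundary U 0)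

/-- The 1-boundaries of the nerve of `U`, as a subgroup of the group of 1-cycles. -/
noncomputable abbrev boundaries (U : OpenCover X) : Submodule ℤ (cycles U) :=
  (LinearMap.range (boundary U 1)).comap (cycles U).subtype

/-- The first simplicial homology group of the nerve of `U`. -/
noncomputable abbrev NerveH1 (U : OpenCover X) : Type u := cycles U ⧸ boundaries U

/-- A refinement projection: `V` refines `U`, and `proj` chooses for every member of `V` a member
of `U` containing it. -/
structure Refinement (V U : OpenCover X) where
  proj : V.sets → U.sets
  subset_proj : ∀ A : V.sets, (A : Set X) ⊆ proj A

variable {U V : OpenCover X}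

/-- The simplicial map between nerves induced by a refinement projection. -/
def Refinement.mapSimplex (r : Refinement V U) (n : ℕ) (s : Simplex V n) : Simplex U n :=
  ⟨fun i => r.proj (s.1 i), s.2.mono (Set.iInter_mono fun i => r.subset_proj (s.1 i))⟩

/-- The chain map induced by a refinement projection. -/
noncomputable def Refinement.mapChain (r : Refinement V U) (n : ℕ) :
    Chain V n →ₗ[ℤ] Chain U n :=
  Finsupp.lmapDomain ℤ ℤ (r.mapSimplex n)

theorem Refinement.boundary_mapChain (r : Refinement V U) (n : ℕ) (z : Chain V (n + 1)) :
    boundary U n (r.mapChain (n + 1) z) = r.mapChain n (boundary V n z) := by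
  have h : (boundary U n).comp (r.mapChain (n + 1)) = (r.mapChain n).comp (boundary V n) := by
    refine Finsupp.lhom_ext fun s a => ?_
    simp only [LinearMap.comp_apply, mapChain, Finsupp.lmapDomain_apply,
      Finsupp.mapDomain_single, boundary, Finsupp.linearCombination_single, map_smul]
    rw [← Finsupp.lmapDomain_apply ℤ ℤ, map_sum]
    simp only [map_smul, Finsupp.lmapDomain_apply, Finsupp.mapDomain_single]
    rfl
  exact LinearMap.congr_fun h z

/-- A refinement projection maps 1-cycles to 1-cycles. -/
noncomputable def Refinement.mapCycles (r : Refinement V U) : cycles V →ₗ[ℤ] cycles U :=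
  (r.mapChain 1).restrict fun z hz => by
    rw [LinearMap.mem_ker] at hz ⊢
    rw [r.boundary_mapChain, hz, map_zero]

theorem Refinement.boundaries_le (r : Refinement V U) :
    boundaries V ≤ (boundaries U).comap r.mapCycles := by
  rintro z ⟨w, hw⟩
  exact ⟨r.mapChain 2 w, by rw [r.boundary_mapChain, hw]; rfl⟩

/-- The homomorphism `H₁(nerve V) → H₁(nerve U)` induced by a refinement projection. -/
noncomputable def Refinement.mapH1 (r : Refinement V U) : NerveH1 V →ₗ[ℤ] NerveH1 U :=
  Submodule.mapQ (boundaries V) (boundaries U) r.mapCycles r.boundaries_le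

/-- The first Čech homology group of `X`: the inverse limit, over all open covers ordered by
refinement, of the first homology groups of their nerves. Its elements are the families of classes
that are compatible under all refinement projections. (Any two refinement projections between the
same two covers induce the same homomorphism on homology.) -/
noncomputable def H1 (X : Type u) [TopologicalSpace X] :
    AddSubgroup (∀ U : OpenCover X, NerveH1 U) where
  carrier := {c | ∀ (U V : OpenCover X) (r : Refinement V U), r.mapH1 (c V) = c U}
  zero_mem' := fun U V r => by simp
  add_mem' := fun {a b} ha hb U V r => by simp [ha U V r, hb U V r]
  neg_mem' := fun {a} ha U V r => by simp [ha U V r]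

end Cech

/-! # Ends and the Freudenthal compactification of a graph -/

namespace EndGraph

open scoped Graph

universe u v

variable {α : Type u} {β : Type v}

/-- A graph is locally finite if every vertex is incident with only finitely many edges. -/
def LocallyFinite (G : Graph α β) : Prop :=
  ∀ x ∈ V(G), (G.incidenceSet x).Finite

/-- A choice of a natural direction for every edge of `G`. -/
structure Direction (G : Graph α β) where
  src : E(G) → V(G)
  tgt : E(G) → V(G)
  isLink : ∀ e : E(G), G.IsLink e (src e) (tgt e)

/-- A ray: a one-way infinite path, given by its sequence of vertices. (For parallel edges, the
choice of the edges between consecutive vertices does not affect the end of the ray.) -/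
structure Ray (G : Graph α β) where
  vert : ℕ → V(G)
  injective : Function.Injective vert
  adj : ∀ n, G.Adj (vert n) (vert (n + 1))

/-- The component `C` of `G - S` contains a tail of the ray `R`. -/
def Ray.TailIn {G : Graph α β} (R : Ray G) {S : Finset V(G)}
    (C : G.toSimpleGraph.ComponentCompl (S : Set V(G))) : Prop :=
  ∃ N, ∀ n, N ≤ n → R.vert n ∈ C

theorem Ray.exists_tailIn {G : Graph α β} (R : Ray G) (S : Finset V(G)) :
    ∃ C : G.toSimpleGraph.ComponentCompl (S : Set V(G)), R.TailIn C := by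
  have hfin : {n | R.vert n ∈ S}.Finite := S.finite_toSet.preimage R.injective.injOn
  obtain ⟨N, hN⟩ := hfin.bddAbove
  have hout : ∀ n, N + 1 ≤ n → R.vert n ∉ (S : Set V(G)) := fun n hn h => by
    have : n ≤ N := hN h
    omega
  refine ⟨G.toSimpleGraph.componentComplMk (hout (N + 1) le_rfl), N + 1, fun n hn => ?_⟩
  induction n, hn using Nat.le_induction with
  | base => exact SimpleGraph.componentComplMk_mem _ _
  | succ n hn ih =>
    refine SimpleGraph.ComponentCompl.mem_of_adj _ _ ih (hout _ (by omega)) ⟨?_, R.adj n⟩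
    exact fun h => absurd (R.injective h) (by omega)

theorem Ray.TailIn.unique {G : Graph α β} {R : Ray G} {S : Finset V(G)}
    {C D : G.toSimpleGraph.ComponentCompl (S : Set V(G))} (hC : R.TailIn C) (hD : R.TailIn D) :
    C = D := by
  obtain ⟨N, hN⟩ := hC
  obtain ⟨M, hM⟩ := hD
  obtain ⟨_, h₁⟩ := hN (max N M) (le_max_left _ _)
  obtain ⟨_, h₂⟩ := hM (max N M) (le_max_right _ _)
  exact h₁.symm.trans h₂

/-- Two rays are equivalent if no finite set of vertices separates them: for every finite `S` they
have tails in the same component of `G - S`. -/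
instance raySetoid (G : Graph α β) : Setoid (Ray G) where
  r R R' := ∀ S : Finset V(G), ∃ C : G.toSimpleGraph.ComponentCompl (S : Set V(G)),
    R.TailIn C ∧ R'.TailIn C
  iseqv :=
    { refl := fun R S => (R.exists_tailIn S).imp fun _ h => ⟨h, h⟩
      symm := fun h S => (h S).imp fun _ h => h.symm
      trans := fun h h' S => by
        obtain ⟨C, h₁, h₂⟩ := h S
        obtain ⟨D, h₃, h₄⟩ := h' S
        exact ⟨C, h₁, h₂.unique h₃ ▸ h₄⟩ }

/-- The ends of `G`: the equivalence classes of rays. -/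
def Ends (G : Graph α β) : Type u := Quotient (raySetoid G)

/-- The end `ω` lives in the component `C` of `G - S`: every ray of `ω` has a tail in `C`. -/
def Ends.LivesIn {G : Graph α β} (ω : Ends G) {S : Finset V(G)}
    (C : G.toSimpleGraph.ComponentCompl (S : Set V(G))) : Prop :=
  ∀ R : Ray G, Quotient.mk (raySetoid G) R = ω → R.TailIn C

/-- The point set of the Freudenthal compactification `|G|`: the vertices, the inner points of the
edges (parametrized by the open unit interval along the natural direction), and the ends. -/
inductive Freudenthal {G : Graph α β} (o : Direction G) : Type (max u v)
  | vertex : V(G) → Freudenthal o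
  | inner : E(G) → Set.Ioo (0 : ℝ) 1 → Freudenthal o
  | ofEnd : Ends G → Freudenthal o

section

variable {G : Graph α β} (o : Direction G)

/-- The parametrization `θ_e : [0,1] → e` of the (closed) edge `e` along its natural direction. -/
noncomputable def edgeMap (e : E(G)) (t : unitInterval) : Freudenthal o :=
  if h₀ : t = 0 then .vertex (o.src e)
  else if h₁ : t = 1 then .vertex (o.tgt e)
  else .inner e ⟨t, unitInterval.pos_iff_ne_zero.2 h₀, unitInterval.lt_one_iff_ne_one.2 h₁⟩

/-- The open edge `e`: the set of its inner points. -/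
def openEdge (e : E(G)) : Set (Freudenthal o) := Set.range (Freudenthal.inner e)

/-- For a component `C` of `G - S`, the set `Ĉ`: the vertices of `C`, the inner points of the edges
of `C` and of the edges between `S` and `C`, and the ends that live in `C`. -/
def hat {S : Finset V(G)} (C : G.toSimpleGraph.ComponentCompl (S : Set V(G))) :
    Set (Freudenthal o) :=
  {x | match x with
    | .vertex x => x ∈ C
    | .inner e _ => o.src e ∈ C ∨ o.tgt e ∈ C
    | .ofEnd ω => ω.LivesIn C}

/-- The open sets of the 1-complex `G`, viewed as sets of points of `|G|`. -/
def complexOpens : Set (Set (Freudenthal o)) :=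
  {A | (∀ ω, Freudenthal.ofEnd ω ∉ A) ∧ ∀ e, IsOpen (edgeMap o e ⁻¹' A)}

/-- The sets `Ĉ(S, ω)`, for finite vertex sets `S` and ends `ω`. -/
def endOpens : Set (Set (Freudenthal o)) :=
  {A | ∃ (S : Finset V(G)) (ω : Ends G) (C : G.toSimpleGraph.ComponentCompl (S : Set V(G))),
    ω.LivesIn C ∧ A = hat o C}

/-- The topology of `|G|`, generated by the open sets of the 1-complex `G` and the sets
`Ĉ(S, ω)`. -/
instance : TopologicalSpace (Freudenthal o) :=
  TopologicalSpace.generateFrom (complexOpens o ∪ endOpens o)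

end

/-! # The oriented topological cycle space -/

/-- An oriented edge: a triple `(e, x, y)` consisting of an edge with one of its two directions. -/
structure OEdge (G : Graph α β) where
  edge : E(G)
  fst : V(G)
  snd : V(G)
  isLink : G.IsLink edge fst snd

/-- The other orientation of the same edge. -/
def OEdge.rev {G : Graph α β} (a : OEdge G) : OEdge G := ⟨a.edge, a.snd, a.fst, a.isLink.symm⟩

/-- The natural orientation of an edge. -/
def Direction.natural {G : Graph α β} (o : Direction G) (e : E(G)) : OEdge G :=
  ⟨e, o.src e, o.tgt e, o.isLink e⟩

/-- The group of all integer-valued functions `φ` on the oriented edges with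
`φ (e, y, x) = - φ (e, x, y)`. -/
def edgeSpace (G : Graph α β) : AddSubgroup (OEdge G → ℤ) where
  carrier := {φ | ∀ a, φ a.rev = -φ a}
  zero_mem' := fun _ => by simp
  add_mem' := fun {φ ψ} hφ hψ a => by simp [hφ a, hψ a, add_comm]
  neg_mem' := fun {φ} hφ a => by simp [hφ a]

section

variable {G : Graph α β} (o : Direction G)

/-- A circle in `|G|`: an injective continuous map from the circle `ℝ/ℤ` to `|G|`, i.e. a loop
that is injective on `[0,1)`. -/
structure CircleIn where
  toFun : C(UnitAddCircle, Freudenthal o)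
  injective : Function.Injective toFun

variable {o}

/-- The circle `γ` traverses the oriented edge `a = (e, x, y)`: on some interval `[s,t]` (of the
universal cover `ℝ` of `ℝ/ℤ`, so that the interval may contain the base point of the loop), it runs
from `x` to `y` and maps `(s,t)` onto the open edge `e`. -/
def CircleIn.Traverses (γ : CircleIn o) (a : OEdge G) : Prop :=
  ∃ s t : ℝ, s < t ∧ γ.toFun (s : UnitAddCircle) = .vertex a.fst ∧
    γ.toFun (t : UnitAddCircle) = .vertex a.snd ∧
    (fun r : ℝ => γ.toFun (r : UnitAddCircle)) '' Set.Ioo s t = openEdge o a.edge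

open Classical in
/-- The oriented circuit of a circle `γ`: the function that is `1` on the oriented edges traversed
by `γ`, is `-1` on those whose reverse is traversed by `γ`, and is `0` otherwise. (A circle cannot
traverse both orientations of an edge.) -/
noncomputable def CircleIn.orientedCircuit (γ : CircleIn o) (a : OEdge G) : ℤ :=
  (if γ.Traverses a then 1 else 0) - (if γ.Traverses a.rev then 1 else 0)

/-- The circle run through backwards. -/
def CircleIn.reverse (γ : CircleIn o) : CircleIn o where
  toFun := γ.toFun.comp ⟨fun x => -x, continuous_neg⟩
  injective := γ.injective.comp neg_injective

theorem CircleIn.Traverses.reverse {γ : CircleIn o} {a : OEdge G} (h : γ.Traverses a) :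
    γ.reverse.Traverses a.rev := by
  obtain ⟨s, t, hst, hs, ht, h⟩ := h
  refine ⟨-t, -s, neg_lt_neg hst, ?_, ?_, ?_⟩
  · simpa [CircleIn.reverse, OEdge.rev] using ht
  · simpa [CircleIn.reverse, OEdge.rev] using hs
  · rw [show openEdge o a.rev.edge = openEdge o a.edge from rfl, ← h,
      ← Set.image_neg_Ioo, Set.image_image]
    simp [CircleIn.reverse]

theorem CircleIn.orientedCircuit_reverse (γ : CircleIn o) (a : OEdge G) :
    γ.reverse.orientedCircuit a = -γ.orientedCircuit a := by
  have hrr : γ.reverse.reverse = γ := by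
    cases γ
    simp only [CircleIn.reverse, CircleIn.mk.injEq]
    ext x
    simp
  have h₁ : ∀ b : OEdge G, γ.reverse.Traverses b ↔ γ.Traverses b.rev := fun b =>
    ⟨fun h => hrr ▸ h.reverse, fun h => h.reverse⟩
  have h₂ : a.rev.rev = a := rfl
  simp only [CircleIn.orientedCircuit]
  rw [propext (h₁ a), propext (h₁ a.rev), h₂, neg_sub]

/-- A family of functions on the oriented edges is thin if every oriented edge has a non-zero value
under only finitely many of its members. -/
def Thin {I : Type*} (φ : I → OEdge G → ℤ) : Prop :=
  ∀ a, (Function.support fun i => φ i a).Finite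

variable (o)

/-- The oriented topological cycle space of `G`: the group of all thin sums of oriented circuits. -/
noncomputable def cycleSpace : AddSubgroup (edgeSpace G) where
  carrier := {φ | ∃ (I : Type (max u v)) (γ : I → CircleIn o),
    Thin (fun i => (γ i).orientedCircuit) ∧
      ∀ a, (φ : OEdge G → ℤ) a = ∑ᶠ i, (γ i).orientedCircuit a}
  zero_mem' := ⟨PEmpty, PEmpty.elim, fun _ => Set.toFinite _, fun _ => by
    rw [finsum_of_isEmpty]; rfl⟩
  add_mem' := by
    rintro φ ψ ⟨I, γ, hγ, hφ⟩ ⟨J, δ, hδ, hψ⟩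
    have hfin : ∀ a, (Function.support fun k : I ⊕ J =>
        (Sum.elim γ δ k).orientedCircuit a).Finite := fun a => by
      refine (((hγ a).image Sum.inl).union ((hδ a).image Sum.inr)).subset ?_
      rintro (i | j) h
      · exact Or.inl ⟨i, h, rfl⟩
      · exact Or.inr ⟨j, h, rfl⟩
    refine ⟨I ⊕ J, Sum.elim γ δ, hfin, fun a => ?_⟩
    have h := finsum_mem_union' (f := fun k : I ⊕ J => (Sum.elim γ δ k).orientedCircuit a)
      (s := Set.range Sum.inl) (t := Set.range Sum.inr)
      (Set.isCompl_range_inl_range_inr.disjoint)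
      ((hfin a).subset Set.inter_subset_right) ((hfin a).subset Set.inter_subset_right)
    rw [Set.range_inl_union_range_inr, finsum_mem_univ,
      finsum_mem_range Sum.inl_injective, finsum_mem_range Sum.inr_injective] at h
    simpa [hφ, hψ] using h.symm
  neg_mem' := by
    rintro φ ⟨I, γ, hγ, hφ⟩
    refine ⟨I, fun i => (γ i).reverse, fun a => ?_, fun a => ?_⟩
    · simpa [CircleIn.orientedCircuit_reverse, Function.support] using hγ a
    · simp only [CircleIn.orientedCircuit_reverse, finsum_neg_distrib, ← hφ]
      rfl

variable {o} in
/-- The value of an element of the cycle space on the natural orientation of an edge. -/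
def value (φ : cycleSpace o) (e : E(G)) : ℤ :=
  ((φ : edgeSpace G) : OEdge G → ℤ) (o.natural e)

/-! # The coefficient of a Čech class at an edge -/

/-- The complement in `|G|` of the closed middle third of the edge `e`. -/
def outerPart (e : E(G)) : Set (Freudenthal o) :=
  (Freudenthal.inner e '' {t | 1 / 3 ≤ (t : ℝ) ∧ (t : ℝ) ≤ 2 / 3})ᶜ

/-- The open first two thirds of the edge `e`. -/
def initialPart (e : E(G)) : Set (Freudenthal o) :=
  Freudenthal.inner e '' {t | (t : ℝ) < 2 / 3}

/-- The open last two thirds of the edge `e`. -/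
def terminalPart (e : E(G)) : Set (Freudenthal o) :=
  Freudenthal.inner e '' {t | 1 / 3 < (t : ℝ)}

theorem Ends.exists_livesIn (ω : Ends G) (S : Finset V(G)) :
    ∃ C : G.toSimpleGraph.ComponentCompl (S : Set V(G)), ω.LivesIn C := by
  induction ω using Quotient.inductionOn with
  | h R =>
    obtain ⟨C, hC⟩ := R.exists_tailIn S
    refine ⟨C, fun R' h => ?_⟩
    obtain ⟨D, h₁, h₂⟩ := Quotient.exact h S
    exact h₂.unique hC ▸ h₁

theorem edgeMap_mem_image_inner {e e' : E(G)} {K : Set ℝ} {t : unitInterval} :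
    edgeMap o e' t ∈ Freudenthal.inner e '' {t : Set.Ioo (0 : ℝ) 1 | (t : ℝ) ∈ K} ↔
      e' = e ∧ (t : ℝ) ∈ Set.Ioo (0 : ℝ) 1 ∩ K := by
  unfold edgeMap
  split_ifs with h₀ h₁
  · simp [h₀]
  · simp [h₁]
  · have h₂ := unitInterval.pos_iff_ne_zero.2 h₀
    have h₃ := unitInterval.lt_one_iff_ne_one.2 h₁
    constructor
    · rintro ⟨s, hs, h⟩
      cases h
      exact ⟨rfl, ⟨h₂, h₃⟩, hs⟩
    · rintro ⟨rfl, -, h⟩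
      exact ⟨⟨t, h₂, h₃⟩, h, rfl⟩

theorem isOpen_image_inner (e : E(G)) {K : Set ℝ} (hK : IsOpen K) :
    IsOpen (Freudenthal.inner e '' {t : Set.Ioo (0 : ℝ) 1 | (t : ℝ) ∈ K} :
      Set (Freudenthal o)) := by
  refine TopologicalSpace.isOpen_generateFrom_of_mem (Or.inl ⟨fun ω => by simp, fun e' => ?_⟩)
  have : edgeMap o e' ⁻¹' (Freudenthal.inner e '' {t : Set.Ioo (0 : ℝ) 1 | (t : ℝ) ∈ K}) =
      {t : unitInterval | e' = e ∧ (t : ℝ) ∈ Set.Ioo (0 : ℝ) 1 ∩ K} :=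
    Set.ext fun t => edgeMap_mem_image_inner o
  rw [this]
  by_cases h : e' = e
  · simp only [h, true_and]
    exact (isOpen_Ioo.inter hK).preimage continuous_subtype_val
  · simp [h]

theorem isOpen_outerPart (e : E(G)) : IsOpen (outerPart o e) := by
  classical
  have hK : outerPart o e = (Freudenthal.inner e ''
      {t : Set.Ioo (0 : ℝ) 1 | (t : ℝ) ∈ Set.Icc (1 / 3 : ℝ) (2 / 3)})ᶜ := rfl
  rw [isOpen_iff_forall_mem_open]
  intro x hx
  by_cases hω : ∃ ω, x = Freudenthal.ofEnd ω
  · obtain ⟨ω, rfl⟩ := hω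
    obtain ⟨C, hC⟩ := ω.exists_livesIn {o.src e, o.tgt e}
    refine ⟨hat o C, ?_, TopologicalSpace.isOpen_generateFrom_of_mem
      (Or.inr ⟨_, ω, C, hC, rfl⟩), hC⟩
    rintro _ h ⟨t, -, rfl⟩
    rcases h with h | h
    · exact SimpleGraph.ComponentCompl.notMem_of_mem h (by simp)
    · exact SimpleGraph.ComponentCompl.notMem_of_mem h (by simp)
  · refine ⟨outerPart o e ∩ {y | ∀ ω, y ≠ Freudenthal.ofEnd ω}, Set.inter_subset_left,
      TopologicalSpace.isOpen_generateFrom_of_mem (Or.inl ⟨fun ω h => h.2 ω rfl, fun e' => ?_⟩),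
      hx, fun ω h => hω ⟨ω, h⟩⟩
    have : edgeMap o e' ⁻¹' (outerPart o e ∩ {y | ∀ ω, y ≠ Freudenthal.ofEnd ω}) =
        {t : unitInterval | e' = e ∧
          (t : ℝ) ∈ Set.Ioo (0 : ℝ) 1 ∩ Set.Icc (1 / 3 : ℝ) (2 / 3)}ᶜ := by
      ext t
      have h₁ : ∀ ω, edgeMap o e' t ≠ Freudenthal.ofEnd ω := fun ω => by
        unfold edgeMap
        split_ifs <;> simp
      rw [hK, Set.mem_preimage, Set.mem_inter_iff, Set.mem_compl_iff, edgeMap_mem_image_inner]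
      exact ⟨fun h => h.1, fun h => ⟨h, h₁⟩⟩
    rw [this, isOpen_compl_iff]
    by_cases h : e' = e
    · have : Set.Ioo (0 : ℝ) 1 ∩ Set.Icc (1 / 3 : ℝ) (2 / 3) = Set.Icc (1 / 3 : ℝ) (2 / 3) :=
        Set.inter_eq_right.2 fun t ht => ⟨by linarith [ht.1], by linarith [ht.2]⟩
      rw [this]
      simp only [h, true_and]
      exact isClosed_Icc.preimage continuous_subtype_val
    · simp [h]

/-- The open cover of `|G|` by three sets that separates the middle of the edge `e` from the rest of
`|G|`. Any two of the three sets meet but there is no point common to all three, so the nerve is a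
triangle without interior: it is the pull-back of the cover of the circle by three arcs under
the map that wraps `e` once round the circle and sends the rest of `|G|` to one point. -/
def edgeCover (e : E(G)) : Cech.OpenCover (Freudenthal o) where
  sets := {outerPart o e, initialPart o e, terminalPart o e}
  isOpen_of_mem := by
    rintro A (rfl | rfl | rfl)
    · exact isOpen_outerPart o e
    · exact isOpen_image_inner o e isOpen_Iio
    · exact isOpen_image_inner o e isOpen_Ioi
  sUnion_eq := by
    rw [Set.eq_univ_iff_forall]
    intro x
    by_cases hx : x ∈ outerPart o e
    · exact ⟨_, Or.inl rfl, hx⟩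
    · obtain ⟨t, -, rfl⟩ := not_not.1 hx
      rcases lt_or_ge (t : ℝ) (2 / 3) with h | h
      · exact ⟨_, Or.inr (Or.inl rfl), t, h, rfl⟩
      · exact ⟨_, Or.inr (Or.inr rfl), t, show (1 / 3 : ℝ) < t by linarith, rfl⟩

/-- A point in the middle of the edge `e` shows that the initial and the terminal part overlap. -/
theorem initialPart_inter_terminalPart (e : E(G)) :
    (initialPart o e ∩ terminalPart o e).Nonempty :=
  ⟨.inner e ⟨1 / 2, by norm_num, by norm_num⟩, ⟨_, by norm_num [Set.mem_ofPred_eq], rfl⟩,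
    ⟨_, by norm_num [Set.mem_ofPred_eq], rfl⟩⟩

/-- The ordered 1-simplex of the nerve of `edgeCover o e` that runs from the initial to the terminal
part of `e`, through the middle of `e`. -/
def forwardSimplex (e : E(G)) : Cech.Simplex (edgeCover o e) 1 :=
  ⟨![⟨initialPart o e, Or.inr (Or.inl rfl)⟩, ⟨terminalPart o e, Or.inr (Or.inr rfl)⟩],
    (initialPart_inter_terminalPart o e).mono
      (Set.subset_iInter fun i => by
        fin_cases i
        · exact Set.inter_subset_left
        · exact Set.inter_subset_right)⟩

/-- The same 1-simplex, run through backwards. -/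
def backwardSimplex (e : E(G)) : Cech.Simplex (edgeCover o e) 1 :=
  ⟨![⟨terminalPart o e, Or.inr (Or.inr rfl)⟩, ⟨initialPart o e, Or.inr (Or.inl rfl)⟩],
    (initialPart_inter_terminalPart o e).mono
      (Set.subset_iInter fun i => by
        fin_cases i
        · exact Set.inter_subset_right
        · exact Set.inter_subset_left)⟩

/-- The integer `k` is the coefficient of the Čech class `c` at the edge `e`, i.e. the net number of
times that `c` runs through `e` in its natural direction: for every 1-cycle `z` representing `c` in
the nerve of `edgeCover o e`, it is the coefficient in `z` of the oriented 1-simplex running through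
the middle of `e`. -/
def IsCoeff (c : Cech.H1 (Freudenthal o)) (e : E(G)) (k : ℤ) : Prop :=
  ∀ z : Cech.cycles (edgeCover o e),
    Submodule.Quotient.mk z = (c : ∀ U, Cech.NerveH1 U) (edgeCover o e) →
      k = (z : Cech.Chain (edgeCover o e) 1) (forwardSimplex o e) -
        (z : Cech.Chain (edgeCover o e) 1) (backwardSimplex o e)

end

/-! # Normal spanning trees -/

/-- A normal spanning tree of `G` with root `r`: a spanning tree `T` such that the end-vertices of
every edge of `G` are comparable in the tree order, where `x ≤ y` if `x` lies on the path in `T`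
from `r` to `y`. -/
structure IsNormalSpanningTree (G T : Graph α β) (r : V(T)) : Prop where
  le : T ≤ G
  vertexSet_eq : V(T) = V(G)
  simple : T.Simple
  isTree : T.toSimpleGraph.IsTree
  comparable : ∀ x y : V(T), G.Adj x y →
    (∀ p : T.toSimpleGraph.Walk r y, p.IsPath → x ∈ p.support) ∨
      (∀ p : T.toSimpleGraph.Walk r x, p.IsPath → y ∈ p.support)

end EndGraph

/-! ### Cochains and the homology of nerves -/

namespace Cech

universe u

variable {X : Type u} [TopologicalSpace X] {U V W : OpenCover X}

/-! Both groups are identified with a third one, the group `flows o` of integer-valued functions on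
the edges whose net value across every finite cut is zero. The isomorphism sought is the composite
of `coeffEquiv` and the inverse of `valueEquiv`. It is unique because an element of the cycle space
is determined by its values on natural orientations.

Cycle space. The value of a circuit at `e` is the degree along the circle of the map `wrap e` that
wraps `e` once round ℝ/ℤ (`CircleIn.lift_sub_eq_orientedCircuit`). For a finite cut, the signed sum
of these maps over the cut lifts to a real-valued function on |G| (`coe_cutHeight`), which has no
net increment along a closed curve; so circuits are flows, and so are their thin sums. Conversely,
if a flow vanishes on a finite edge set but not at `e`, then `e` lies on a finite cycle avoiding
that set (`IsFlow.exists_circle`), since otherwise some finite cut would carry flow through `e`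
alone. Clearing the countably many edges one after another writes the flow as a thin sum of circuits
(`IsFlow.exists_value_eq`).

Čech homology. A partition of the vertices with finitely many cross-edges, each of them subdivided,
gives an open cover of |G|. Its nerve is essentially a graph: the classes are its branch vertices,
joined by the subdivided cross-edges. Hence a homology class is determined by its numbers of
passages through the cross-edges, these numbers satisfy the cut condition at every class, and every
flow is realized by a cycle. A compactness argument based on König's lemma
(`exists_finset_hat_subset`) shows that these covers are cofinal
(`exists_partitionCover_refinement`). In the limit, a Čech class is the same as a flow.

Chords. In a normal spanning tree the fundamental cuts are finite (`exists_fundamental_cut`). So the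
value of a flow on a tree edge can be computed from its values on finitely many chords, and any
integer multiples of the fundamental cycles form a thin family. Both facts together show that a flow
is the same as an arbitrary function on the chords. -/

theorem Chain.hom_ext {n : ℕ} {M : Type*} [AddCommGroup M] {f g : Chain U n →ₗ[ℤ] M}
    (h : ∀ s, f (Finsupp.single s 1) = g (Finsupp.single s 1)) : f = g := by
  refine Finsupp.lhom_ext fun s a => ?_
  rw [show Finsupp.single s a = a • Finsupp.single s (1 : ℤ) by simp, map_smul, map_smul, h]

/-- The ordered simplex with given vertices, all of which contain the point `x`. -/
def Simplex.ofPoint {n : ℕ} (s : Fin (n + 1) → U.sets) (x : X) (h : ∀ i, x ∈ (s i : Set X)) :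
    Simplex U n :=
  ⟨s, x, Set.mem_iInter.2 h⟩

/-- The ordered 1-simplex with given vertices. -/
def Simplex.pair (A B : U.sets) (h : ((A : Set X) ∩ B).Nonempty) : Simplex U 1 :=
  ⟨![A, B], h.mono (Set.subset_iInter fun i => by
    fin_cases i
    · exact Set.inter_subset_left
    · exact Set.inter_subset_right)⟩

theorem Simplex.ext_one {s t : Simplex U 1} (h₀ : s.1 0 = t.1 0) (h₁ : s.1 1 = t.1 1) : s = t := by
  refine Subtype.ext (funext fun i => ?_)
  fin_cases i
  · exact h₀
  · exact h₁

theorem Simplex.ext_zero {s t : Simplex U 0} (h₀ : s.1 0 = t.1 0) : s = t := by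
  refine Subtype.ext (funext fun i => ?_)
  fin_cases i
  exact h₀

theorem Simplex.exists_mem {n : ℕ} (s : Simplex U n) : ∃ x, ∀ i, x ∈ (s.1 i : Set X) := by
  obtain ⟨x, hx⟩ := s.2
  exact ⟨x, Set.mem_iInter.1 hx⟩

/-- The 1-simplex with its two vertices exchanged. -/
def Simplex.swap (s : Simplex U 1) : Simplex U 1 :=
  ⟨![s.1 1, s.1 0], by
    obtain ⟨x, hx⟩ := s.exists_mem
    refine ⟨x, Set.mem_iInter.2 fun i => ?_⟩
    fin_cases i
    · exact hx 1
    · exact hx 0⟩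

@[simp] theorem Simplex.swap_zero (s : Simplex U 1) : s.swap.1 0 = s.1 1 := rfl
@[simp] theorem Simplex.swap_one (s : Simplex U 1) : s.swap.1 1 = s.1 0 := rfl
@[simp] theorem Simplex.swap_swap (s : Simplex U 1) : s.swap.swap = s := Simplex.ext_one rfl rfl

theorem boundary_single_one (s : Simplex U 1) (a : ℤ) :
    boundary U 0 (Finsupp.single s a) =
      a • (Finsupp.single (s.face 0) 1 - Finsupp.single (s.face 1) 1) := by
  simp [boundary, Finsupp.linearCombination_single, Fin.sum_univ_two, sub_eq_add_neg]

theorem boundary_single_two (s : Simplex U 2) (a : ℤ) :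
    boundary U 1 (Finsupp.single s a) =
      a • (Finsupp.single (s.face 0) 1 - Finsupp.single (s.face 1) 1 +
        Finsupp.single (s.face 2) 1) := by
  simp [boundary, Finsupp.linearCombination_single, Fin.sum_univ_three, sub_eq_add_neg]

/-- The pairing of 1-chains with a 1-cochain. -/
noncomputable def pairing (f : U.sets → U.sets → ℤ) : Chain U 1 →ₗ[ℤ] ℤ :=
  Finsupp.linearCombination ℤ fun s : Simplex U 1 => f (s.1 0) (s.1 1)

theorem pairing_single (f : U.sets → U.sets → ℤ) (s : Simplex U 1) (a : ℤ) :
    pairing f (Finsupp.single s a) = a * f (s.1 0) (s.1 1) := by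
  simp [pairing]

/-- The vertices of a 1-simplex of the nerve meet, so the values of a cochain on disjoint pairs
never enter. -/
theorem pairing_congr {f g : U.sets → U.sets → ℤ}
    (h : ∀ A B : U.sets, ((A : Set X) ∩ B).Nonempty → f A B = g A B) : pairing f = pairing g := by
  refine Finsupp.lhom_ext fun s a => ?_
  obtain ⟨x, hx⟩ := s.exists_mem
  rw [pairing_single, pairing_single, h _ _ ⟨x, hx 0, hx 1⟩]

theorem pairing_add (f g : U.sets → U.sets → ℤ) (z : Chain U 1) :
    pairing (fun A B => f A B + g A B) z = pairing f z + pairing g z := by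
  have : pairing (fun A B => f A B + g A B) = pairing f + pairing g :=
    Finsupp.lhom_ext fun s a => by
      rw [LinearMap.add_apply, pairing_single, pairing_single, pairing_single, mul_add]
  rw [this, LinearMap.add_apply]

theorem pairing_smul (c : ℤ) (f : U.sets → U.sets → ℤ) (z : Chain U 1) :
    pairing (fun A B => c * f A B) z = c * pairing f z := by
  have : pairing (fun A B => c * f A B) = c • pairing f :=
    Finsupp.lhom_ext fun s a => by
      rw [LinearMap.smul_apply, pairing_single, pairing_single, smul_eq_mul]
      ring
  rw [this, LinearMap.smul_apply, smul_eq_mul]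

theorem pairing_sum {I : Type*} (t : Finset I) (f : I → U.sets → U.sets → ℤ) (z : Chain U 1) :
    pairing (fun A B => ∑ i ∈ t, f i A B) z = ∑ i ∈ t, pairing (f i) z := by
  have : pairing (fun A B => ∑ i ∈ t, f i A B) = ∑ i ∈ t, pairing (f i) :=
    Finsupp.lhom_ext fun s a => by
      simp [LinearMap.sum_apply, pairing_single, Finset.mul_sum]
  rw [this, LinearMap.sum_apply]

/-- Pairing with the coboundary of `g` amounts to pairing `g` with the boundary. On cycles this
trades one count of passages for another. -/
theorem pairing_coboundary (g : U.sets → ℤ) {z : Chain U 1} (hz : z ∈ cycles U) :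
    pairing (fun A B => g B - g A) z = 0 := by
  have h : pairing (fun A B => g B - g A) =
      (Finsupp.linearCombination ℤ fun s : Simplex U 0 => g (s.1 0)).comp (boundary U 0) := by
    refine Finsupp.lhom_ext fun s a => ?_
    rw [pairing_single, LinearMap.comp_apply, boundary_single_one]
    simp only [map_smul, map_sub, Finsupp.linearCombination_single, smul_eq_mul, one_mul]
    rfl
  rw [h, LinearMap.comp_apply, LinearMap.mem_ker.1 hz, map_zero]

/-- 1-cocycles of the nerve. -/
def IsCocycle (f : U.sets → U.sets → ℤ) : Prop :=
  ∀ A B C : U.sets, ((A : Set X) ∩ B ∩ C).Nonempty → f B C - f A C + f A B = 0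

theorem IsCocycle.pairing_boundary {f : U.sets → U.sets → ℤ} (hf : IsCocycle f)
    (w : Chain U 2) : pairing f (boundary U 1 w) = 0 := by
  have h : (pairing f).comp (boundary U 1) = 0 := by
    refine Finsupp.lhom_ext fun s a => ?_
    obtain ⟨x, hx⟩ := s.exists_mem
    rw [LinearMap.comp_apply, boundary_single_two]
    simp only [map_smul, map_sub, map_add, pairing_single, smul_eq_mul, one_mul,
      LinearMap.zero_apply]
    exact mul_eq_zero_of_right _ (hf (s.1 0) (s.1 1) (s.1 2) ⟨x, ⟨hx 0, hx 1⟩, hx 2⟩)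
  exact LinearMap.congr_fun h w

/-- The homomorphism on homology given by a 1-cocycle. -/
noncomputable def IsCocycle.onH1 {f : U.sets → U.sets → ℤ} (hf : IsCocycle f) :
    NerveH1 U →ₗ[ℤ] ℤ :=
  (boundaries U).liftQ ((pairing f).comp (cycles U).subtype) (by
    rintro z ⟨w, hw⟩
    rw [LinearMap.mem_ker, LinearMap.comp_apply, ← hw, hf.pairing_boundary])

theorem IsCocycle.onH1_mk {f : U.sets → U.sets → ℤ} (hf : IsCocycle f) (z : cycles U) :
    hf.onH1 (Submodule.Quotient.mk z) = pairing f z := rfl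

theorem pairing_mapChain (r : Refinement V U) (f : U.sets → U.sets → ℤ) (z : Chain V 1) :
    pairing f (r.mapChain 1 z) = pairing (fun A B => f (r.proj A) (r.proj B)) z := by
  have h : (pairing f).comp (r.mapChain 1) = pairing (fun A B => f (r.proj A) (r.proj B)) := by
    refine Finsupp.lhom_ext fun s a => ?_
    rw [LinearMap.comp_apply, Refinement.mapChain, Finsupp.lmapDomain_apply,
      Finsupp.mapDomain_single, pairing_single, pairing_single]
    rfl
  exact LinearMap.congr_fun h z

open Classical in
/-- The cochain that counts the net number of passages from `A` to `B`. -/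
noncomputable def passage (A B C D : U.sets) : ℤ :=
  (if C = A ∧ D = B then 1 else 0) - (if C = B ∧ D = A then 1 else 0)

theorem pairing_passage {s : Simplex U 1} (z : Chain U 1) :
    pairing (passage (s.1 0) (s.1 1)) z = z s - z s.swap := by
  classical
  have h : pairing (passage (s.1 0) (s.1 1)) = Finsupp.lapply s - Finsupp.lapply s.swap := by
    refine Finsupp.lhom_ext fun t a => ?_
    have h₁ : (t.1 0 = s.1 0 ∧ t.1 1 = s.1 1) ↔ t = s :=
      ⟨fun h => Simplex.ext_one h.1 h.2, fun h => h ▸ ⟨rfl, rfl⟩⟩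
    have h₂ : (t.1 0 = s.1 1 ∧ t.1 1 = s.1 0) ↔ t = s.swap :=
      ⟨fun h => Simplex.ext_one h.1 h.2, fun h => h ▸ ⟨rfl, rfl⟩⟩
    rw [pairing_single, LinearMap.sub_apply, Finsupp.lapply_apply, Finsupp.lapply_apply,
      Finsupp.single_apply, Finsupp.single_apply, passage]
    simp only [h₁, h₂]
    split_ifs <;> simp
  rw [h]
  rfl

/-- A triple with a common point that contains both `A` and `B` has a repeated entry, and there the
terms cancel by antisymmetry; on all other triples every term vanishes. -/
theorem isCocycle_passage {A B : U.sets}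
    (h : ∀ C : U.sets, ((A : Set X) ∩ B ∩ C).Nonempty → C = A ∨ C = B) :
    IsCocycle (passage A B) := by
  intro C D E hx
  by_cases hAB : A = B
  · subst hAB
    simp [passage]
  obtain ⟨x, ⟨hC, hD⟩, hE⟩ := hx
  have h₁ : C = A → D = B → E = A ∨ E = B := by
    rintro rfl rfl
    exact h E ⟨x, ⟨hC, hD⟩, hE⟩
  have h₂ : C = B → D = A → E = A ∨ E = B := by
    rintro rfl rfl
    exact h E ⟨x, ⟨hD, hC⟩, hE⟩
  have h₃ : D = A → E = B → C = A ∨ C = B := by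
    rintro rfl rfl
    exact h C ⟨x, ⟨hD, hE⟩, hC⟩
  have h₄ : D = B → E = A → C = A ∨ C = B := by
    rintro rfl rfl
    exact h C ⟨x, ⟨hE, hD⟩, hC⟩
  have h₅ : C = A → E = B → D = A ∨ D = B := by
    rintro rfl rfl
    exact h D ⟨x, ⟨hC, hE⟩, hD⟩
  have h₆ : C = B → E = A → D = A ∨ D = B := by
    rintro rfl rfl
    exact h D ⟨x, ⟨hE, hC⟩, hD⟩
  have key : ∀ P : U.sets, ¬ (P = A ∧ P = B) := fun P h => hAB (h.1.symm.trans h.2)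
  have kC := key C
  have kD := key D
  have kE := key E
  clear h key
  unfold passage
  by_cases c1 : C = A <;> by_cases c2 : C = B <;> by_cases d1 : D = A <;> by_cases d2 : D = B <;>
    by_cases e1 : E = A <;> by_cases e2 : E = B <;> simp_all

/-- A 1-chain that takes equal values on both orders of every edge is a boundary. -/
theorem mem_range_boundary_of_symm {z : Chain U 1} (hz : ∀ s, z s = z s.swap) :
    z ∈ LinearMap.range (boundary U 1) := by
  classical
  -- The order selects an orientation of every edge. Modulo boundaries each simplex equals plus or
  -- minus its selected orientation, or zero if it is degenerate. This replacement `T` kills `z`,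
  -- because the coefficients of the two orders enter with opposite signs.
  obtain ⟨lt, hlt⟩ : ∃ lt : U.sets → U.sets → Prop, IsStrictTotalOrder U.sets lt :=
    ⟨WellOrderingRel, inferInstance⟩
  have irr : ∀ A, ¬ lt A A := fun A => hlt.irrefl A
  have asymm' : ∀ {A B}, lt A B → ¬ lt B A := fun h h' => irr _ (hlt.trans _ _ _ h h')
  have tri : ∀ {A B}, ¬ lt A B → ¬ lt B A → A = B := fun h h' => hlt.trichotomous _ _ h h'
  set R := LinearMap.range (boundary U 1)
  have htri : ∀ (A B C : U.sets) (x : X), x ∈ (A : Set X) → x ∈ (B : Set X) → x ∈ (C : Set X) →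
      ∀ s t u : Simplex U 1, s.1 = ![A, B] → t.1 = ![B, C] → u.1 = ![A, C] →
      Finsupp.single t (1 : ℤ) - Finsupp.single u 1 + Finsupp.single s 1 ∈ R := by
    intro A B C x hA hB hC s t u hs ht hu
    refine ⟨Finsupp.single (Simplex.ofPoint ![A, B, C] x fun i => by
      fin_cases i <;> assumption) 1, ?_⟩
    rw [boundary_single_two, one_smul]
    congr 1
    · congr 1
      · congr 1
        exact Simplex.ext_one (by rw [ht]; rfl) (by rw [ht]; rfl)
      · congr 1
        exact Simplex.ext_one (by rw [hu]; rfl) (by rw [hu]; rfl)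
    · congr 1
      exact Simplex.ext_one (by rw [hs]; rfl) (by rw [hs]; rfl)
  have hdiag : ∀ s : Simplex U 1, s.1 0 = s.1 1 → Finsupp.single s (1 : ℤ) ∈ R := by
    intro s hs
    obtain ⟨x, hx⟩ := s.exists_mem
    have h1 : s.1 = ![s.1 0, s.1 0] := by
      funext i
      fin_cases i
      · rfl
      · exact hs.symm
    have := htri _ _ _ x (hx 0) (hx 0) (hx 0) s s s h1 h1 h1
    simpa using this
  have hswap : ∀ s : Simplex U 1,
      Finsupp.single s (1 : ℤ) + Finsupp.single s.swap 1 ∈ R := by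
    intro s
    obtain ⟨x, hx⟩ := s.exists_mem
    have hd := hdiag (Simplex.pair (s.1 0) (s.1 0) ⟨x, hx 0, hx 0⟩) rfl
    -- The boundary of the triple `(A, B, A)` is `s.swap - (A, A) + s`, and `(A, A)` is itself a
    -- boundary.
    have h := htri _ _ _ x (hx 0) (hx 1) (hx 0) s s.swap
      (Simplex.pair (s.1 0) (s.1 0) ⟨x, hx 0, hx 0⟩)
      (by funext i; fin_cases i <;> rfl) rfl rfl
    convert R.add_mem h hd using 1
    abel
  let T : Chain U 1 →ₗ[ℤ] Chain U 1 := Finsupp.linearCombination ℤ fun s =>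
    if lt (s.1 0) (s.1 1) then Finsupp.single s 1 else
      if lt (s.1 1) (s.1 0) then -Finsupp.single s.swap 1 else 0
  have hT : ∀ s, T (Finsupp.single s 1) = (if lt (s.1 0) (s.1 1) then Finsupp.single s (1 : ℤ) else
      if lt (s.1 1) (s.1 0) then -Finsupp.single s.swap 1 else 0) := fun s => by
    simp only [T, Finsupp.linearCombination_single, one_smul]
  have h₁ : R.mkQ = R.mkQ.comp T := by
    refine Chain.hom_ext fun s => ?_
    rw [LinearMap.comp_apply, hT, ← sub_eq_zero, ← map_sub, Submodule.mkQ_apply,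
      Submodule.Quotient.mk_eq_zero]
    split_ifs with h h'
    · simp
    · rw [sub_neg_eq_add]
      exact hswap s
    · rw [sub_zero]
      exact hdiag s (tri h h')
  have h₂ : ∀ t, (Finsupp.lapply t).comp T =
      if lt (t.1 0) (t.1 1) then Finsupp.lapply t - Finsupp.lapply t.swap else 0 := by
    intro t
    refine Chain.hom_ext fun s => ?_
    rw [LinearMap.comp_apply, hT]
    have hst : s = t.swap ↔ s.swap = t :=
      ⟨fun h => by rw [h, Simplex.swap_swap], fun h => by rw [← h, Simplex.swap_swap]⟩
    have ht : t = t.swap → t.1 0 = t.1 1 := fun h => congrArg (fun s : Simplex U 1 => s.1 0) h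
    by_cases h1 : s = t
    · subst h1
      have h2 : s.swap = s ↔ s.1 0 = s.1 1 :=
        ⟨fun h => ht h.symm, fun h => Simplex.ext_one h.symm h⟩
      split_ifs with h h'
      · have : s ≠ s.swap := fun h' => irr _ (ht h' ▸ h)
        simp [this]
      · have : s.swap ≠ s := fun h => irr _ (h2.1 h ▸ h')
        simp [this]
      · simp
    · by_cases h3 : s.swap = t
      · subst h3
        have h4 : s ≠ s.swap := h1
        simp only [Simplex.swap_zero, Simplex.swap_one, Simplex.swap_swap]
        split_ifs with h h' h'
        · exact absurd h (asymm' h')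
        · simp [h4]
        · simp [h4]
        · simp
      · split_ifs <;> simp [h1, h3, hst]
  have h₃ : T z = 0 := by
    ext t
    have := LinearMap.congr_fun (h₂ t) z
    rw [LinearMap.comp_apply, Finsupp.lapply_apply] at this
    rw [this]
    split_ifs
    · simp [hz t]
    · rfl
  have h₄ := LinearMap.congr_fun h₁ z
  rwa [LinearMap.comp_apply, h₃, map_zero, Submodule.mkQ_apply,
    Submodule.Quotient.mk_eq_zero] at h₄

/-- Any two refinement projections between the same covers agree on homology. -/
theorem Refinement.mapH1_eq (r s : Refinement V U) : r.mapH1 = s.mapH1 := by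
  have hp : ∀ t : Simplex V 1, ∃ p : Simplex U 2,
      p.1 = ![r.proj (t.1 0), r.proj (t.1 1), s.proj (t.1 1)] := fun t => by
    obtain ⟨x, hx⟩ := t.exists_mem
    refine ⟨Simplex.ofPoint _ x fun i => ?_, rfl⟩
    fin_cases i
    exacts [r.subset_proj _ (hx 0), r.subset_proj _ (hx 1), s.subset_proj _ (hx 1)]
  have hq : ∀ t : Simplex V 1, ∃ q : Simplex U 2,
      q.1 = ![r.proj (t.1 0), s.proj (t.1 0), s.proj (t.1 1)] := fun t => by
    obtain ⟨x, hx⟩ := t.exists_mem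
    refine ⟨Simplex.ofPoint _ x fun i => ?_, rfl⟩
    fin_cases i
    exacts [r.subset_proj _ (hx 0), s.subset_proj _ (hx 0), s.subset_proj _ (hx 1)]
  have hl : ∀ t : Simplex V 0, ∃ l : Simplex U 1,
      l.1 = ![r.proj (t.1 0), s.proj (t.1 0)] := fun t => by
    obtain ⟨x, hx⟩ := t.exists_mem
    refine ⟨Simplex.ofPoint _ x fun i => ?_, rfl⟩
    fin_cases i
    exacts [r.subset_proj _ (hx 0), s.subset_proj _ (hx 0)]
  choose p hp using hp
  choose q hq using hq
  choose l hl using hl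
  -- The prism operator: the square between the images of an edge under `r` and `s` is cut into the
  -- triangles `p` and `q`. The term `E ∘ ∂` in the homotopy formula vanishes on cycles.
  let D : Chain V 1 →ₗ[ℤ] Chain U 2 := Finsupp.linearCombination ℤ fun t =>
    Finsupp.single (p t) (1 : ℤ) - Finsupp.single (q t) 1
  have hD : ∀ t, D (Finsupp.single t 1) =
      Finsupp.single (p t) (1 : ℤ) - Finsupp.single (q t) 1 := fun t => by simp [D]
  let E : Chain V 0 →ₗ[ℤ] Chain U 1 := Finsupp.linearCombination ℤ fun t =>
    Finsupp.single (l t) (1 : ℤ)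
  have hE : ∀ t, E (Finsupp.single t 1) = Finsupp.single (l t) (1 : ℤ) := fun t => by simp [E]
  have h : (boundary U 1).comp D = r.mapChain 1 - s.mapChain 1 + E.comp (boundary V 0) := by
    refine Chain.hom_ext fun t => ?_
    have e₀ : (p t).face 0 = l (t.face 0) :=
      Simplex.ext_one (by rw [hl]; exact congrFun (hp t) 1) (by rw [hl]; exact congrFun (hp t) 2)
    have e₁ : (p t).face 1 = (q t).face 1 :=
      Simplex.ext_one ((congrFun (hp t) 0).trans (congrFun (hq t) 0).symm)
        ((congrFun (hp t) 2).trans (congrFun (hq t) 2).symm)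
    have e₂ : (p t).face 2 = r.mapSimplex 1 t :=
      Simplex.ext_one (congrFun (hp t) 0) (congrFun (hp t) 1)
    have e₃ : (q t).face 0 = s.mapSimplex 1 t :=
      Simplex.ext_one (congrFun (hq t) 1) (congrFun (hq t) 2)
    have e₄ : (q t).face 2 = l (t.face 1) :=
      Simplex.ext_one (by rw [hl]; exact congrFun (hq t) 0) (by rw [hl]; exact congrFun (hq t) 1)
    rw [LinearMap.comp_apply, LinearMap.add_apply, LinearMap.sub_apply, LinearMap.comp_apply,
      boundary_single_one, one_smul, map_sub, hD, hE, hE, map_sub, boundary_single_two,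
      boundary_single_two, one_smul, one_smul, e₀, e₁, e₂, e₃, e₄, mapChain, mapChain,
      Finsupp.lmapDomain_apply, Finsupp.mapDomain_single, Finsupp.lmapDomain_apply,
      Finsupp.mapDomain_single]
    abel
  refine Submodule.linearMap_qext _ (LinearMap.ext fun z => ?_)
  rw [LinearMap.comp_apply, LinearMap.comp_apply, Submodule.mkQ_apply]
  refine (Submodule.Quotient.eq _).2 ⟨D z, ?_⟩
  have h' := LinearMap.congr_fun h (z : Chain V 1)
  rw [LinearMap.add_apply, LinearMap.comp_apply, LinearMap.comp_apply, LinearMap.mem_ker.1 z.2,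
    map_zero, add_zero] at h'
  exact h'

/-- Composition of refinement projections. -/
def Refinement.comp (r : Refinement V U) (s : Refinement W V) : Refinement W U where
  proj A := r.proj (s.proj A)
  subset_proj A := (s.subset_proj A).trans (r.subset_proj _)

theorem Refinement.mapChain_comp (r : Refinement V U) (s : Refinement W V) (n : ℕ)
    (z : Chain W n) : (r.comp s).mapChain n z = r.mapChain n (s.mapChain n z) := by
  rw [mapChain, mapChain, mapChain, Finsupp.lmapDomain_apply, Finsupp.lmapDomain_apply,
    Finsupp.lmapDomain_apply, ← Finsupp.mapDomain_comp]
  rfl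

theorem Refinement.mapH1_comp (r : Refinement V U) (s : Refinement W V) (x : NerveH1 W) :
    (r.comp s).mapH1 x = r.mapH1 (s.mapH1 x) := by
  induction x using Submodule.Quotient.induction_on with
  | H z => exact congrArg Submodule.Quotient.mk (Subtype.ext (r.mapChain_comp s 1 z))

theorem Refinement.mapH1_mk (r : Refinement V U) (z : cycles V) :
    r.mapH1 (Submodule.Quotient.mk z) = Submodule.Quotient.mk (r.mapCycles z) := rfl

theorem IsCocycle.onH1_mapH1 {f : U.sets → U.sets → ℤ} (hf : IsCocycle f) (r : Refinement V U)
    (z : cycles V) : hf.onH1 (r.mapH1 (Submodule.Quotient.mk z)) =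
      pairing (fun A B => f (r.proj A) (r.proj B)) z := by
  rw [r.mapH1_mk, hf.onH1_mk]
  exact pairing_mapChain r f z

/-- A refinement projection exists as soon as every member of one cover lies in a member of the
other. -/
noncomputable def Refinement.ofSubset (h : ∀ A ∈ V.sets, ∃ B ∈ U.sets, A ⊆ B) :
    Refinement V U where
  proj A := ⟨(h A A.2).choose, (h A A.2).choose_spec.1⟩
  subset_proj A := (h A A.2).choose_spec.2

/-- The common refinement of two covers. -/
def OpenCover.inter (U V : OpenCover X) : OpenCover X where
  sets := {A | ∃ B ∈ U.sets, ∃ C ∈ V.sets, A = B ∩ C}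
  isOpen_of_mem := by
    rintro _ ⟨B, hB, C, hC, rfl⟩
    exact (U.isOpen_of_mem B hB).inter (V.isOpen_of_mem C hC)
  sUnion_eq := by
    refine Set.eq_univ_of_forall fun x => ?_
    obtain ⟨B, hB, hxB⟩ := Set.eq_univ_iff_forall.1 U.sUnion_eq x
    obtain ⟨C, hC, hxC⟩ := Set.eq_univ_iff_forall.1 V.sUnion_eq x
    exact ⟨B ∩ C, ⟨B, hB, C, hC, rfl⟩, hxB, hxC⟩

theorem OpenCover.exists_refinement_inter (U V : OpenCover X) :
    Nonempty (Refinement (U.inter V) U) ∧ Nonempty (Refinement (U.inter V) V) := by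
  constructor <;> refine ⟨Refinement.ofSubset ?_⟩
  · rintro _ ⟨B, hB, C, hC, rfl⟩
    exact ⟨B, hB, Set.inter_subset_left⟩
  · rintro _ ⟨B, hB, C, hC, rfl⟩
    exact ⟨C, hC, Set.inter_subset_right⟩

end Cech

/-! ### The topology of |G| and continuous functions on it -/

namespace EndGraph

open scoped Graph

universe u v

variable {α : Type u} {β : Type v} {G : Graph α β}

section

variable (o : Direction G)

theorem Direction.src_ne_tgt [G.Loopless] (e : E(G)) : o.src e ≠ o.tgt e :=
  fun h => (o.isLink e).ne (congrArg Subtype.val h)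

theorem Direction.eq_or_eq_of_isLink {e : E(G)} {x y : V(G)} (h : G.IsLink e x y) :
    (o.src e = x ∧ o.tgt e = y) ∨ (o.src e = y ∧ o.tgt e = x) := by
  rcases (o.isLink e).eq_and_eq_or_eq_and_eq h with h | h
  · exact Or.inl ⟨Subtype.ext h.1, Subtype.ext h.2⟩
  · exact Or.inr ⟨Subtype.ext h.1, Subtype.ext h.2⟩

theorem Direction.exists_edge {x y : V(G)} (h : G.Adj x y) :
    ∃ e : E(G), (o.src e = x ∧ o.tgt e = y) ∨ (o.src e = y ∧ o.tgt e = x) := by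
  obtain ⟨e, he⟩ := h
  exact ⟨⟨e, he.edge_mem⟩, o.eq_or_eq_of_isLink he⟩

theorem Direction.adj [G.Loopless] (e : E(G)) : G.toSimpleGraph.Adj (o.src e) (o.tgt e) :=
  ⟨o.src_ne_tgt e, _, o.isLink e⟩

theorem LocallyFinite.finite_incident (hfin : LocallyFinite G) (x : V(G)) :
    {e : E(G) | o.src e = x ∨ o.tgt e = x}.Finite := by
  refine ((hfin x x.2).preimage Subtype.val_injective.injOn).subset ?_
  rintro e (rfl | rfl)
  · exact ⟨_, o.isLink e⟩
  · exact ⟨_, (o.isLink e).symm⟩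

variable {o}

@[simp] theorem edgeMap_zero (e : E(G)) : edgeMap o e 0 = .vertex (o.src e) := by simp [edgeMap]

@[simp] theorem edgeMap_one (e : E(G)) : edgeMap o e 1 = .vertex (o.tgt e) := by simp [edgeMap]

theorem edgeMap_of_mem (e : E(G)) (t : Set.Ioo (0 : ℝ) 1) (ht : (t : ℝ) ∈ unitInterval) :
    edgeMap o e ⟨t, ht⟩ = .inner e t := by
  have h₀ : (⟨t, ht⟩ : unitInterval) ≠ 0 := fun h => t.2.1.ne' (congrArg Subtype.val h)
  have h₁ : (⟨t, ht⟩ : unitInterval) ≠ 1 := fun h => t.2.2.ne (congrArg Subtype.val h)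
  simp [edgeMap, h₀, h₁]

theorem edgeMap_cases (e : E(G)) (t : unitInterval) :
    (t = 0 ∧ edgeMap o e t = .vertex (o.src e)) ∨ (t = 1 ∧ edgeMap o e t = .vertex (o.tgt e)) ∨
      ∃ s : Set.Ioo (0 : ℝ) 1, (s : ℝ) = t ∧ edgeMap o e t = .inner e s := by
  by_cases h₀ : t = 0
  · exact Or.inl ⟨h₀, by rw [h₀, edgeMap_zero]⟩
  by_cases h₁ : t = 1
  · exact Or.inr (Or.inl ⟨h₁, by rw [h₁, edgeMap_one]⟩)
  · exact Or.inr (Or.inr ⟨⟨t, unitInterval.pos_iff_ne_zero.2 h₀,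
      unitInterval.lt_one_iff_ne_one.2 h₁⟩, rfl, by simp [edgeMap, h₀, h₁]⟩)

theorem edgeMap_ne_ofEnd (e : E(G)) (t : unitInterval) (ω : Ends G) :
    edgeMap o e t ≠ .ofEnd ω := by
  rcases edgeMap_cases (o := o) e t with h | h | ⟨s, -, h⟩
  · rw [h.2]; simp
  · rw [h.2]; simp
  · rw [h]; simp

theorem mem_hat_vertex {S : Finset V(G)} {C : G.toSimpleGraph.ComponentCompl (S : Set V(G))}
    {x : V(G)} : Freudenthal.vertex x ∈ hat o C ↔ x ∈ C := Iff.rfl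

theorem mem_hat_inner {S : Finset V(G)} {C : G.toSimpleGraph.ComponentCompl (S : Set V(G))}
    {e : E(G)} {t : Set.Ioo (0 : ℝ) 1} :
    Freudenthal.inner e t ∈ hat o C ↔ o.src e ∈ C ∨ o.tgt e ∈ C := Iff.rfl

theorem Ends.LivesIn.mono {ω : Ends G} {S S' : Finset V(G)}
    {C : G.toSimpleGraph.ComponentCompl (S : Set V(G))}
    {D : G.toSimpleGraph.ComponentCompl (S' : Set V(G))} (h : ω.LivesIn C)
    (hCD : ∀ x ∈ C, x ∈ D) : ω.LivesIn D := fun R hR => by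
  obtain ⟨N, hN⟩ := h R hR
  exact ⟨N, fun n hn => hCD _ (hN n hn)⟩

theorem hat_mono {S S' : Finset V(G)} {C : G.toSimpleGraph.ComponentCompl (S : Set V(G))}
    {D : G.toSimpleGraph.ComponentCompl (S' : Set V(G))} (h : ∀ x ∈ C, x ∈ D) :
    hat o C ⊆ hat o D := by
  rintro (x | ⟨e, t⟩ | ω) hx
  · exact h x hx
  · exact hx.imp (h _) (h _)
  · exact Ends.LivesIn.mono hx h

/-- Both components contain tails of a ray of `ω`, so they meet; and `C`, connected in `G - S`,
remains connected in the larger graph `G - S'`. -/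
theorem Ends.LivesIn.subset {ω : Ends G} {S S' : Finset V(G)} (hS : S' ⊆ S)
    {C : G.toSimpleGraph.ComponentCompl (S : Set V(G))}
    {D : G.toSimpleGraph.ComponentCompl (S' : Set V(G))} (hC : ω.LivesIn C) (hD : ω.LivesIn D) :
    ∀ x ∈ C, x ∈ D := by
  have hS' : (S' : Set V(G)) ⊆ S := by exact_mod_cast hS
  have h := (SimpleGraph.ComponentCompl.hom_eq_iff_not_disjoint C hS' D).2 (by
    induction ω using Quotient.inductionOn with
    | h R =>
      obtain ⟨N, hN⟩ := hC R rfl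
      obtain ⟨M, hM⟩ := hD R rfl
      exact Set.not_disjoint_iff.2 ⟨_, hN (max N M) (le_max_left _ _), hM _ (le_max_right _ _)⟩)
  exact (SimpleGraph.ComponentCompl.hom_eq_iff_le C hS' D).1 h

/-- The sets `Ĉ` form a neighbourhood base at an end: generators from the 1-complex contain no end,
and two sets `Ĉ` at the same end are refined by the one for the union of their vertex sets. -/
theorem exists_hat_subset {A : Set (Freudenthal o)} (hA : IsOpen A) {ω : Ends G}
    (hω : Freudenthal.ofEnd ω ∈ A) :
    ∃ (S : Finset V(G)) (C : G.toSimpleGraph.ComponentCompl (S : Set V(G))),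
      ω.LivesIn C ∧ hat o C ⊆ A := by
  classical
  induction hA with
  | basic A h =>
    rcases h with h | ⟨S, ω', C, hC, rfl⟩
    · exact absurd hω (h.1 ω)
    · exact ⟨S, C, hω, subset_rfl⟩
  | univ =>
    obtain ⟨C, hC⟩ := ω.exists_livesIn ∅
    exact ⟨∅, C, hC, Set.subset_univ _⟩
  | inter A B _ _ ihA ihB =>
    obtain ⟨S, C, hC, hCA⟩ := ihA hω.1
    obtain ⟨S', D, hD, hDB⟩ := ihB hω.2
    obtain ⟨E, hE⟩ := ω.exists_livesIn (S ∪ S')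
    exact ⟨_, E, hE, Set.subset_inter
      ((hat_mono (hE.subset Finset.subset_union_left hC)).trans hCA)
      ((hat_mono (hE.subset Finset.subset_union_right hD)).trans hDB)⟩
  | sUnion 𝒜 _ ih =>
    obtain ⟨A, hA, hωA⟩ := hω
    obtain ⟨S, C, hC, hCA⟩ := ih A hA hωA
    exact ⟨S, C, hC, hCA.trans (Set.subset_sUnion_of_mem hA)⟩

theorem continuous_edgeMap (e : E(G)) : Continuous (edgeMap o e) := by
  refine continuous_generateFrom_iff.2 ?_
  rintro A (hA | ⟨S, ω, C, -, rfl⟩)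
  · exact hA.2 e
  -- `Ĉ` contains the whole open edge as soon as it contains an endvertex. So the preimage is empty,
  -- or is `[0,1]` with those endpoints removed whose vertices lie outside `C`.
  · have h : edgeMap o e ⁻¹' hat o C = {t | t = 0 → o.src e ∈ C} ∩ {t | t = 1 → o.tgt e ∈ C} ∩
        {_t | o.src e ∈ C ∨ o.tgt e ∈ C} := by
      ext t
      simp only [Set.mem_preimage, Set.mem_inter_iff, Set.mem_ofPred_eq]
      rcases edgeMap_cases (o := o) e t with ⟨rfl, h⟩ | ⟨rfl, h⟩ | ⟨s, hs, h⟩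
      · rw [h, mem_hat_vertex]
        simpa only [true_implies, zero_ne_one, false_implies, and_true] using
          ⟨fun h => ⟨h, Or.inl h⟩, fun h => h.1⟩
      · rw [h, mem_hat_vertex]
        simpa only [true_implies, one_ne_zero, false_implies, true_and] using
          ⟨fun h => ⟨h, Or.inr h⟩, fun h => h.1⟩
      · have h₀ : t ≠ 0 := fun h => s.2.1.ne' (hs.trans (congrArg Subtype.val h))
        have h₁ : t ≠ 1 := fun h => s.2.2.ne (hs.trans (congrArg Subtype.val h))
        rw [h, mem_hat_inner]
        simp [h₀, h₁]
    rw [h]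
    refine (IsOpen.inter ?_ ?_).inter isOpen_const
    · by_cases h : o.src e ∈ C
      · simp [h]
      · simp only [h, imp_false]
        exact isOpen_compl_singleton (x := (0 : unitInterval))
    · by_cases h : o.tgt e ∈ C
      · simp [h]
      · simp only [h, imp_false]
        exact isOpen_compl_singleton (x := (1 : unitInterval))

/-- Points of `A` other than ends have the neighbourhood `A` minus all ends, which is open in the
1-complex; an end has some `Ĉ`. -/
theorem isOpen_iff_edgeMap_hat {A : Set (Freudenthal o)} :
    IsOpen A ↔ (∀ e, IsOpen (edgeMap o e ⁻¹' A)) ∧ ∀ ω, Freudenthal.ofEnd ω ∈ A →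
      ∃ (S : Finset V(G)) (C : G.toSimpleGraph.ComponentCompl (S : Set V(G))),
        ω.LivesIn C ∧ hat o C ⊆ A := by
  refine ⟨fun h => ⟨fun e => h.preimage (continuous_edgeMap e), fun ω => exists_hat_subset h⟩,
    fun h => ?_⟩
  rw [isOpen_iff_forall_mem_open]
  intro x hx
  by_cases hω : ∃ ω, x = Freudenthal.ofEnd ω
  · obtain ⟨ω, rfl⟩ := hω
    obtain ⟨S, C, hC, hCA⟩ := h.2 ω hx
    exact ⟨hat o C, hCA, TopologicalSpace.isOpen_generateFrom_of_mem
      (Or.inr ⟨S, ω, C, hC, rfl⟩), hC⟩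
  · refine ⟨A ∩ {y | ∀ ω, y ≠ Freudenthal.ofEnd ω}, Set.inter_subset_left,
      TopologicalSpace.isOpen_generateFrom_of_mem (Or.inl ⟨fun ω h => h.2 ω rfl, fun e => ?_⟩),
      hx, fun ω h => hω ⟨ω, h⟩⟩
    convert h.1 e using 1
    ext t
    exact ⟨fun h => h.1, fun h => ⟨h, edgeMap_ne_ofEnd e t⟩⟩

/-- A function on `|G|` is continuous if it is continuous along every edge and constant near every
end. -/
theorem continuous_of_edgeMap_of_hat {Y : Type*} [TopologicalSpace Y] {f : Freudenthal o → Y}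
    (h₁ : ∀ e, Continuous fun t => f (edgeMap o e t))
    (h₂ : ∀ ω, ∃ (S : Finset V(G)) (C : G.toSimpleGraph.ComponentCompl (S : Set V(G))),
      ω.LivesIn C ∧ ∀ x ∈ hat o C, f x = f (.ofEnd ω)) : Continuous f := by
  refine continuous_def.2 fun A hA => isOpen_iff_edgeMap_hat.2 ⟨fun e => hA.preimage (h₁ e),
    fun ω hω => ?_⟩
  obtain ⟨S, C, hC, h⟩ := h₂ ω
  exact ⟨S, C, hC, fun x hx => by rw [Set.mem_preimage, h x hx]; exact hω⟩

theorem isOpen_openEdge (e : E(G)) : IsOpen (openEdge o e) := by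
  have := isOpen_image_inner o e (K := Set.univ) isOpen_univ
  simpa [openEdge] using this

variable (o) in
/-- Every end has a neighbourhood `Ĉ` that avoids given finite sets of vertices and edges. -/
theorem Ends.exists_livesIn_avoiding (ω : Ends G) {A : Set V(G)} (hA : A.Finite) {F : Set E(G)}
    (hF : F.Finite) :
    ∃ (S : Finset V(G)) (C : G.toSimpleGraph.ComponentCompl (S : Set V(G))),
      ω.LivesIn C ∧ (∀ x ∈ A, x ∉ C) ∧ ∀ e ∈ F, o.src e ∉ C ∧ o.tgt e ∉ C := by
  classical
  obtain ⟨C, hC⟩ := ω.exists_livesIn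
    (hA.toFinset ∪ hF.toFinset.image o.src ∪ hF.toFinset.image o.tgt)
  refine ⟨_, C, hC, fun x hx h => SimpleGraph.ComponentCompl.notMem_of_mem h ?_, fun e he =>
    ⟨fun h => SimpleGraph.ComponentCompl.notMem_of_mem h ?_,
      fun h => SimpleGraph.ComponentCompl.notMem_of_mem h ?_⟩⟩
  · simp [hx]
  · simp only [Finset.coe_union, Finset.coe_image, Set.Finite.coe_toFinset]
    exact Or.inl (Or.inr ⟨e, he, rfl⟩)
  · simp only [Finset.coe_union, Finset.coe_image, Set.Finite.coe_toFinset]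
    exact Or.inr ⟨e, he, rfl⟩

/-- A function on the vertices that is preserved by the edges of `G - S` is constant on the
components of `G - S`. -/
theorem eq_of_mem_componentCompl {ι : Type*} {P : V(G) → ι} {S : Set V(G)}
    {C : G.toSimpleGraph.ComponentCompl S}
    (h : ∀ e, P (o.src e) ≠ P (o.tgt e) → o.src e ∉ C ∧ o.tgt e ∉ C) {x y : V(G)}
    (hx : x ∈ C) (hy : y ∈ C) : P x = P y := by
  have key : ∀ a b : (Sᶜ : Set V(G)), (G.toSimpleGraph.induce Sᶜ).Walk a b → (a : V(G)) ∈ C →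
      P a = P b := by
    intro a b p
    induction p with
    | nil => exact fun _ => rfl
    | @cons a b c hab p ih =>
      intro ha
      have hab' : G.toSimpleGraph.Adj a b := hab
      have hb : (b : V(G)) ∈ C := SimpleGraph.ComponentCompl.mem_of_adj _ _ ha b.2 hab'
      rw [← ih hb]
      by_contra hne
      obtain ⟨e, he⟩ := o.exists_edge hab'.2
      rcases he with ⟨h₁, h₂⟩ | ⟨h₁, h₂⟩
      · exact (h e (by rwa [h₁, h₂])).1 (h₁ ▸ ha)
      · exact (h e (by rw [h₁, h₂]; exact fun h => hne h.symm)).1 (h₁ ▸ hb)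
  obtain ⟨hx', rfl⟩ := hx
  obtain ⟨hy', hyx⟩ := hy
  obtain ⟨p⟩ := SimpleGraph.ConnectedComponent.exact hyx.symm
  exact key ⟨x, hx'⟩ ⟨y, hy'⟩ p ⟨hx', rfl⟩

/-- All rays of the end `ω` run into `X`. -/
def Ends.EventuallyIn (ω : Ends G) (X : Set V(G)) : Prop :=
  ∀ R : Ray G, Quotient.mk (raySetoid G) R = ω → ∃ N, ∀ n, N ≤ n → R.vert n ∈ X

theorem Ends.LivesIn.eventuallyIn {ω : Ends G} {S : Finset V(G)}
    {C : G.toSimpleGraph.ComponentCompl (S : Set V(G))} (h : ω.LivesIn C) {X : Set V(G)}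
    (hX : ∀ x ∈ C, x ∈ X) : ω.EventuallyIn X := fun R hR => by
  obtain ⟨N, hN⟩ := h R hR
  exact ⟨N, fun n hn => hX _ (hN n hn)⟩

theorem Ends.EventuallyIn.exists_mem {ω : Ends G} {X Y : Set V(G)} (hX : ω.EventuallyIn X)
    (hY : ω.EventuallyIn Y) : (X ∩ Y).Nonempty := by
  induction ω using Quotient.inductionOn with
  | h R =>
    obtain ⟨N, hN⟩ := hX R rfl
    obtain ⟨M, hM⟩ := hY R rfl
    exact ⟨_, hN (max N M) (le_max_left _ _), hM _ (le_max_right _ _)⟩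

variable (o) in
-- Deleting the endvertices of the finitely many cross-edges of `P` leaves components that no
-- cross-edge touches. This is how a partition with finite cuts extends to the ends.
theorem Ends.exists_livesIn_const (ω : Ends G) {ι : Type*} {P : V(G) → ι}
    (hP : {e | P (o.src e) ≠ P (o.tgt e)}.Finite) :
    ∃ (S : Finset V(G)) (C : G.toSimpleGraph.ComponentCompl (S : Set V(G))) (i : ι),
      ω.LivesIn C ∧ (∀ x ∈ C, P x = i) ∧
        ∀ e, P (o.src e) ≠ P (o.tgt e) → o.src e ∉ C ∧ o.tgt e ∉ C := by
  obtain ⟨S, C, hC, -, h⟩ := ω.exists_livesIn_avoiding o Set.finite_empty hP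
  obtain ⟨x, hx⟩ := C.nonempty
  exact ⟨S, C, P x, hC, fun y hy => eq_of_mem_componentCompl h hy hx, h⟩

open Classical in
/-- The distance from the vertex `x`, cut off at `1`. -/
noncomputable def vertexDist (x : V(G)) : Freudenthal o → ℝ
  | .vertex y => if y = x then 0 else 1
  | .inner e t => if o.src e = x then t else if o.tgt e = x then 1 - t else 1
  | .ofEnd _ => 1

open Classical in
theorem vertexDist_edgeMap [G.Loopless] (x : V(G)) (e : E(G)) (t : unitInterval) :
    vertexDist x (edgeMap o e t) =
      if o.src e = x then (t : ℝ) else if o.tgt e = x then 1 - (t : ℝ) else 1 := by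
  have := o.src_ne_tgt e
  rcases edgeMap_cases (o := o) e t with ⟨rfl, h⟩ | ⟨rfl, h⟩ | ⟨s, hs, h⟩
  · rw [h]
    simp [vertexDist]
  · rw [h]
    by_cases h₁ : o.src e = x
    · have h₂ : o.tgt e ≠ x := fun h => this (h₁.trans h.symm)
      simp [vertexDist, h₁, h₂]
    · simp [vertexDist, h₁]
  · rw [h, ← hs]
    simp [vertexDist]

/-- By local finiteness every end has a neighbourhood `Ĉ` that avoids `x` and all edges at `x`;
there the function is constantly 1. -/
theorem continuous_vertexDist [G.Loopless] (hfin : LocallyFinite G) (x : V(G)) :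
    Continuous (vertexDist x : Freudenthal o → ℝ) := by
  classical
  refine continuous_of_edgeMap_of_hat (fun e => ?_) fun ω => ?_
  · simp only [vertexDist_edgeMap]
    split_ifs <;> fun_prop
  · obtain ⟨S, C, hC, h₁, h₂⟩ := ω.exists_livesIn_avoiding o (Set.finite_singleton x)
      (hfin.finite_incident o x)
    refine ⟨S, C, hC, ?_⟩
    rintro (y | ⟨e, t⟩ | ω') hy
    · have : y ≠ x := fun h => h₁ x rfl (h ▸ hy)
      simp [vertexDist, this]
    · have h₃ : ¬ (o.src e = x ∨ o.tgt e = x) := fun h => by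
        have := h₂ e h
        exact hy.elim this.1 this.2
      rw [not_or] at h₃
      simp [vertexDist, h₃.1, h₃.2]
    · rfl

theorem eq_vertex_of_vertexDist_eq_zero {x : V(G)} {p : Freudenthal o}
    (h : vertexDist x p = 0) : p = .vertex x := by
  match p with
  | .vertex y =>
    by_contra h'
    have : y ≠ x := fun h => h' (by rw [h])
    simp [vertexDist, this] at h
  | .inner e t =>
    exfalso
    have := t.2.1
    have := t.2.2
    simp only [vertexDist] at h
    split_ifs at h <;> linarith
  | .ofEnd _ => simp [vertexDist] at h

open Classical in
/-- The map to the circle that wraps the edge `e` once round and is constant elsewhere. -/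
noncomputable def wrap (e : E(G)) : Freudenthal o → UnitAddCircle
  | .inner e' t => if e' = e then ((t : ℝ) : UnitAddCircle) else 0
  | _ => 0

open Classical in
theorem wrap_edgeMap (e e' : E(G)) (t : unitInterval) :
    wrap e (edgeMap o e' t) = if e' = e then ((t : ℝ) : UnitAddCircle) else 0 := by
  rcases edgeMap_cases (o := o) e' t with ⟨rfl, h⟩ | ⟨rfl, h⟩ | ⟨s, hs, h⟩
  · rw [h]
    simp [wrap]
  · rw [h]
    simpa [wrap] using fun _ => (AddCircle.coe_period (1 : ℝ)).symm
  · rw [h, ← hs]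
    simp [wrap]

theorem continuous_wrap (e : E(G)) : Continuous (wrap e : Freudenthal o → UnitAddCircle) := by
  classical
  refine continuous_of_edgeMap_of_hat (fun e' => ?_) fun ω => ?_
  · simp only [wrap_edgeMap]
    split_ifs
    · exact (AddCircle.continuous_mk' 1).comp continuous_subtype_val
    · exact continuous_const
  · obtain ⟨S, C, hC, -, h₂⟩ := ω.exists_livesIn_avoiding o Set.finite_empty
      (Set.finite_singleton e)
    refine ⟨S, C, hC, ?_⟩
    rintro (y | ⟨e', t⟩ | ω') hy
    · rfl
    · have h₃ : e' ≠ e := fun h => hy.elim (h ▸ (h₂ e rfl).1) (h ▸ (h₂ e rfl).2)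
      simp [wrap, h₃]
    · rfl

theorem wrap_eq_zero {e : E(G)} {p : Freudenthal o} (h : p ∉ openEdge o e) : wrap e p = 0 := by
  match p with
  | .vertex y => rfl
  | .inner e' t =>
    have : e' ≠ e := by
      rintro rfl
      exact h ⟨t, rfl⟩
    simp [wrap, this]
  | .ofEnd _ => rfl

theorem wrap_inner (e : E(G)) (t : Set.Ioo (0 : ℝ) 1) :
    wrap (o := o) e (.inner e t) = ((t : ℝ) : UnitAddCircle) := by
  simp [wrap]

open Classical in
/-- The map to `[0,1]` that is `1` on a set `X` of vertices, is `0` on the other vertices, and is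
affine on the edges. -/
noncomputable def cutHeight (X : Set V(G)) : Freudenthal o → ℝ
  | .vertex y => X.indicator 1 y
  | .inner e t => (1 - t) * X.indicator 1 (o.src e) + t * X.indicator 1 (o.tgt e)
  | .ofEnd ω => if ω.EventuallyIn X then 1 else 0

theorem cutHeight_edgeMap (X : Set V(G)) (e : E(G)) (t : unitInterval) :
    cutHeight X (edgeMap o e t) =
      (1 - (t : ℝ)) * X.indicator 1 (o.src e) + t * X.indicator 1 (o.tgt e) := by
  rcases edgeMap_cases (o := o) e t with ⟨rfl, h⟩ | ⟨rfl, h⟩ | ⟨s, hs, h⟩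
  · rw [h]
    simp [cutHeight]
  · rw [h]
    simp [cutHeight]
  · rw [h, ← hs]
    rfl

theorem continuous_cutHeight {X : Set V(G)}
    (hX : {e | (o.src e ∈ X) ≠ (o.tgt e ∈ X)}.Finite) :
    Continuous (cutHeight X : Freudenthal o → ℝ) := by
  classical
  refine continuous_of_edgeMap_of_hat (fun e => ?_) fun ω => ?_
  · simp only [cutHeight_edgeMap]
    fun_prop
  · obtain ⟨S, C, i, hC, hi, h⟩ := ω.exists_livesIn_const o (P := (· ∈ X)) hX
    refine ⟨S, C, hC, ?_⟩
    have key : ∀ ω' : Ends G, ω'.LivesIn C → (ω'.EventuallyIn X ↔ i) := fun ω' hω' => by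
      refine ⟨fun h' => ?_, fun h' => hω'.eventuallyIn fun x hx => (hi x hx).symm ▸ h'⟩
      obtain ⟨x, hx, hxC⟩ := h'.exists_mem (hω'.eventuallyIn (X := {x | x ∈ C}) fun x hx => hx)
      exact hi x hxC ▸ hx
    have hind : ∀ x, ((x ∈ X) = i) → X.indicator (1 : V(G) → ℝ) x = if i then 1 else 0 :=
      fun x hx => by
        simp [Set.indicator_apply, hx]
    have hend : ∀ ω' : Ends G, ω'.LivesIn C → cutHeight (o := o) X (.ofEnd ω') =
        if i then 1 else 0 := fun ω' hω' => by
      simp [cutHeight, key ω' hω']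
    rw [hend ω hC]
    rintro (y | ⟨e, t⟩ | ω') hy
    · exact hind y (hi y hy)
    · have h₁ : (o.src e ∈ X) = (o.tgt e ∈ X) := by
        by_contra h'
        exact hy.elim (h e h').1 (h e h').2
      have h₂ : (o.src e ∈ X) = i := hy.elim (hi _) fun h' => h₁.trans (hi _ h')
      have h₃ : (o.tgt e ∈ X) = i := h₁.symm.trans h₂
      simp only [cutHeight, hind _ h₂, hind _ h₃]
      ring
    · exact hend ω' hy

end

end EndGraph

/-! ### Intermediate values and lifts to the real line -/

theorem not_injOn_Ioo_of_eq_endpoints {f : ℝ → ℝ} {s m t : ℝ} (hm : m ∈ Set.Ioo s t)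
    (hf : ContinuousOn f (Set.Icc s t)) (hst : f s = f t) (hne : f m ≠ f s) :
    ¬ Set.InjOn f (Set.Ioo s t) := by
  intro hinj
  -- The value halfway between `f s = f t` and `f m` is taken on both sides of `m`.
  have hc : (f s + f m) / 2 ∈ Set.uIcc (f s) (f m) := by
    rcases le_total (f s) (f m) with h | h
    · rw [Set.uIcc_of_le h]
      constructor <;> linarith
    · rw [Set.uIcc_of_ge h]
      constructor <;> linarith
  have hcs : (f s + f m) / 2 ≠ f s := fun h => hne (by linarith)
  have hcm : (f s + f m) / 2 ≠ f m := fun h => hne (by linarith)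
  obtain ⟨x, hx, hxc⟩ := intermediate_value_uIcc
    (hf.mono (by rw [Set.uIcc_of_le hm.1.le]; exact Set.Icc_subset_Icc_right hm.2.le)) hc
  obtain ⟨y, hy, hyc⟩ := intermediate_value_uIcc (a := t) (b := m)
    (hf.mono (by rw [Set.uIcc_of_ge hm.2.le]; exact Set.Icc_subset_Icc_left hm.1.le))
    (by rwa [← hst])
  rw [Set.uIcc_of_le hm.1.le] at hx
  rw [Set.uIcc_of_ge hm.2.le] at hy
  have hx₁ : s < x := lt_of_le_of_ne hx.1 fun h => hcs (by rw [← hxc, ← h])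
  have hx₂ : x < m := lt_of_le_of_ne hx.2 fun h => hcm (by rw [← hxc, h])
  have hy₁ : m < y := lt_of_le_of_ne hy.1 fun h => hcm (by rw [← hyc, ← h])
  have hy₂ : y < t := lt_of_le_of_ne hy.2 fun h => hcs (by rw [← hyc, h, hst])
  have := hinj ⟨hx₁, hx₂.trans hm.2⟩ ⟨hm.1.trans hy₁, hy₂⟩ (hxc.trans hyc.symm)
  linarith

/-- Two lifts of the same path in the circle have the same increment. -/
theorem sub_eq_sub_of_coe_unitAddCircle_eq {f g : ℝ → ℝ} {a b : ℝ}
    (hf : ContinuousOn f (Set.uIcc a b)) (hg : ContinuousOn g (Set.uIcc a b))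
    (h : ∀ r ∈ Set.uIcc a b, (f r : UnitAddCircle) = g r) : f b - f a = g b - g a := by
  have hint : ∀ r ∈ Set.uIcc a b, ∃ n : ℤ, f r - g r = n := fun r hr => by
    have : ((f r - g r : ℝ) : UnitAddCircle) = 0 := by
      rw [AddCircle.coe_sub, h r hr, sub_self]
    obtain ⟨n, hn⟩ := (AddCircle.coe_eq_zero_iff (1 : ℝ)).1 this
    exact ⟨n, by simpa using hn.symm⟩
  obtain ⟨m, hm⟩ := hint a Set.left_mem_uIcc
  obtain ⟨n, hn⟩ := hint b Set.right_mem_uIcc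
  suffices m = n by
    subst this
    linarith
  by_contra hne
  -- The difference of the lifts is continuous and integer-valued, so it cannot pass through a
  -- half-integer.
  have hmid : ((min m n : ℤ) : ℝ) + 1 / 2 ∈ Set.uIcc (f a - g a) (f b - g b) := by
    rw [hm, hn]
    rcases lt_or_gt_of_ne hne with h' | h'
    · have h₁ : (m : ℝ) + 1 ≤ n := by exact_mod_cast h'
      rw [min_eq_left h'.le, Set.uIcc_of_le (by linarith)]
      constructor <;> linarith
    · have h₁ : (n : ℝ) + 1 ≤ m := by exact_mod_cast h'
      rw [min_eq_right h'.le, Set.uIcc_of_ge (by linarith)]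
      constructor <;> linarith
  obtain ⟨r, hr, hrm⟩ := intermediate_value_uIcc (hf.sub hg) hmid
  obtain ⟨k, hk⟩ := hint r hr
  have h₁ : ((2 * k : ℤ) : ℝ) = ((2 * min m n + 1 : ℤ) : ℝ) := by
    have : f r - g r = ((min m n : ℤ) : ℝ) + 1 / 2 := hrm
    push_cast at this ⊢
    linarith
  have h₂ : 2 * k = 2 * min m n + 1 := by exact_mod_cast h₁
  omega

theorem exists_lift_unitAddCircle {f : ℝ → UnitAddCircle} (hf : Continuous f) :
    ∃ L : ℝ → ℝ, Continuous L ∧ ∀ r, (L r : UnitAddCircle) = f r := by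
  obtain ⟨a, ha⟩ := QuotientAddGroup.mk_surjective (f 0)
  obtain ⟨L, ⟨-, hL⟩, -⟩ := (AddCircle.isCoveringMap_coe (1 : ℝ)).existsUnique_continuousMap_lifts
    ⟨f, hf⟩ 0 a ha
  exact ⟨L, L.continuous, fun r => congrFun hL r⟩

/-! ### Degrees of circles, and circuits as flows -/

namespace EndGraph

open scoped Graph

universe u v

variable {α : Type u} {β : Type v} {G : Graph α β}

section

variable {o : Direction G}

theorem vertexDist_mem_Icc (x : V(G)) (p : Freudenthal o) :
    vertexDist x p ∈ Set.Icc (0 : ℝ) 1 := by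
  match p with
  | .vertex y =>
    simp only [vertexDist]
    split_ifs <;> simp
  | .inner e t =>
    have h₁ := t.2.1
    have h₂ := t.2.2
    simp only [vertexDist]
    split_ifs <;> constructor <;> linarith
  | .ofEnd ω => simp [vertexDist]

theorem vertexDist_src (e : E(G)) (t : Set.Ioo (0 : ℝ) 1) :
    vertexDist (o := o) (o.src e) (.inner e t) = t := by
  simp [vertexDist]

theorem vertexDist_tgt [G.Loopless] (e : E(G)) (t : Set.Ioo (0 : ℝ) 1) :
    vertexDist (o := o) (o.tgt e) (.inner e t) = 1 - t := by
  simp [vertexDist, o.src_ne_tgt e]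

namespace CircleIn

/-- The loop `ℝ → |G|` given by a circle. -/
def loop (γ : CircleIn o) (r : ℝ) : Freudenthal o := γ.toFun (r : UnitAddCircle)

theorem continuous_loop (γ : CircleIn o) : Continuous γ.loop :=
  γ.toFun.continuous.comp (AddCircle.continuous_mk' 1)

theorem loop_add_intCast (γ : CircleIn o) (r : ℝ) (n : ℤ) : γ.loop (r + n) = γ.loop r := by
  simp [loop]

theorem loop_add_one (γ : CircleIn o) (r : ℝ) : γ.loop (r + 1) = γ.loop r := by
  simpa using γ.loop_add_intCast r 1

theorem eq_of_loop_eq (γ : CircleIn o) {r r' : ℝ} (h : γ.loop r = γ.loop r')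
    (h' : |r - r'| < 1) : r = r' := by
  have h₁ : ((r - r' : ℝ) : UnitAddCircle) = 0 := by
    rw [AddCircle.coe_sub, γ.injective h, sub_self]
  obtain ⟨n, hn⟩ := (AddCircle.coe_eq_zero_iff (1 : ℝ)).1 h₁
  rw [← hn] at h'
  have h₂ : |n| < 1 := by
    have : |(n : ℝ)| < 1 := by simpa using h'
    exact_mod_cast this
  rw [Int.abs_lt_one_iff.1 h₂] at hn
  simp at hn
  linarith

theorem inner_vertexDist {e : E(G)} {p : Freudenthal o} (hp : p ∈ openEdge o e) :
    ∃ h : vertexDist (o.src e) p ∈ Set.Ioo (0 : ℝ) 1, p = .inner e ⟨_, h⟩ := by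
  obtain ⟨t, rfl⟩ := hp
  exact ⟨by rw [vertexDist_src]; exact t.2, by simp [vertexDist_src]⟩

/-- The distance from the source is a coordinate on the open edge, and a circle is injective on open
intervals of length at most 1. -/
theorem injOn_vertexDist_loop (γ : CircleIn o) {e : E(G)} {s t : ℝ}
    (h : ∀ r ∈ Set.Ioo s t, γ.loop r ∈ openEdge o e) (hst : t ≤ s + 1) :
    Set.InjOn (fun r => vertexDist (o.src e) (γ.loop r)) (Set.Ioo s t) := by
  intro r hr r' hr' hrr'
  obtain ⟨h₁, h₂⟩ := inner_vertexDist (h r hr)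
  obtain ⟨h₃, h₄⟩ := inner_vertexDist (h r' hr')
  refine γ.eq_of_loop_eq ?_ ?_
  · rw [h₂, h₄]
    congr 2
  · rw [abs_lt]
    constructor <;> linarith [hr.1, hr.2, hr'.1, hr'.2]

/-- The shift of `L` by a period lifts the same path as `L`. So the degree can be computed over a
period starting anywhere, and traversals through the base point need no separate treatment. -/
theorem lift_sub_const (γ : CircleIn o) {e : E(G)} {L : ℝ → ℝ}
    (hL : Continuous L) (hLe : ∀ r, (L r : UnitAddCircle) = wrap e (γ.loop r)) (s : ℝ) :
    L (s + 1) - L s = L 1 - L 0 := by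
  have := sub_eq_sub_of_coe_unitAddCircle_eq (a := 0) (b := s) (f := fun r => L (r + 1)) (g := L)
    (by fun_prop) (by fun_prop) fun r _ => by
      rw [hLe, hLe, γ.loop_add_one]
  rw [zero_add] at this
  linarith

theorem orientedCircuit_eq_zero (γ : CircleIn o) {e : E(G)}
    (h : ∀ r, γ.loop r ∉ openEdge o e) : γ.orientedCircuit (o.natural e) = 0 := by
  have h' : ∀ a : OEdge G, a.edge = e → ¬ γ.Traverses a := by
    rintro a rfl ⟨s, t, hst, -, -, ha⟩
    refine h ((s + t) / 2) (ha ▸ ⟨(s + t) / 2, ⟨by linarith, by linarith⟩, rfl⟩)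
  simp [orientedCircuit, h' (o.natural e) rfl, h' (o.natural e).rev rfl]

theorem orientedCircuit_rev (γ : CircleIn o) (a : OEdge G) :
    γ.orientedCircuit a.rev = -γ.orientedCircuit a := by
  have : a.rev.rev = a := rfl
  rw [orientedCircuit, orientedCircuit, this, neg_sub]

variable [G.Loopless]

/-- If a circle runs through an edge `e` during the interval `(s, t)`, then the distance from the
source of `e` is a lift of `wrap e` along the circle on `[s, t]`. -/
theorem coe_vertexDist_eq_wrap (hfin : LocallyFinite G) (γ : CircleIn o) {e : E(G)} {s t : ℝ}
    (hst : s < t) (h : ∀ r ∈ Set.Ioo s t, γ.loop r ∈ openEdge o e) {r : ℝ}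
    (hr : r ∈ Set.Icc s t) :
    ((vertexDist (o.src e) (γ.loop r) : ℝ) : UnitAddCircle) = wrap e (γ.loop r) ∧
      vertexDist (o.tgt e) (γ.loop r) = 1 - vertexDist (o.src e) (γ.loop r) := by
  have hc := (continuous_vertexDist (o := o) hfin (o.src e)).comp γ.continuous_loop
  have hc' := (continuous_vertexDist (o := o) hfin (o.tgt e)).comp γ.continuous_loop
  -- Both equations hold on `(s,t)`, where the distance is the coordinate of the edge. They are
  -- closed conditions, so they persist at `s` and `t`.
  have hcl : IsClosed {r | ((vertexDist (o.src e) (γ.loop r) : ℝ) : UnitAddCircle) =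
      wrap e (γ.loop r) ∧ vertexDist (o.tgt e) (γ.loop r) =
        1 - vertexDist (o.src e) (γ.loop r)} :=
    (isClosed_eq ((AddCircle.continuous_mk' 1).comp hc)
      ((continuous_wrap e).comp γ.continuous_loop)).inter
      (isClosed_eq hc' (continuous_const.sub hc))
  rw [← closure_Ioo hst.ne] at hr
  refine hcl.closure_subset_iff.2 (fun r hr => ?_) hr
  obtain ⟨τ, hτ⟩ := h r hr
  rw [Set.mem_ofPred_eq, ← hτ, vertexDist_src, vertexDist_tgt, wrap_inner]
  exact ⟨rfl, rfl⟩

/-- Off the open edge `wrap e` is zero, so the distance from the source is an integer in `[0,1]`.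
Distance 0 means the source; at distance 1 the distance from the target is 0. -/
theorem loop_eq_vertex_of_notMem (hfin : LocallyFinite G) (γ : CircleIn o) {e : E(G)} {s t : ℝ}
    (hst : s < t) (h : ∀ r ∈ Set.Ioo s t, γ.loop r ∈ openEdge o e) {r : ℝ}
    (hr : r ∈ Set.Icc s t) (hr' : γ.loop r ∉ openEdge o e) :
    (vertexDist (o.src e) (γ.loop r) = 0 ∧ γ.loop r = .vertex (o.src e)) ∨
      (vertexDist (o.src e) (γ.loop r) = 1 ∧ γ.loop r = .vertex (o.tgt e)) := by
  obtain ⟨h₁, h₂⟩ := γ.coe_vertexDist_eq_wrap hfin hst h hr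
  rw [wrap_eq_zero hr'] at h₁
  obtain ⟨n, hn⟩ := (AddCircle.coe_eq_zero_iff (1 : ℝ)).1 h₁
  obtain ⟨h₃, h₄⟩ := vertexDist_mem_Icc (o.src e) (γ.loop r)
  rw [← hn] at h₃ h₄
  have h₅ : 0 ≤ n := by
    have : (0 : ℝ) ≤ n := by simpa using h₃
    exact_mod_cast this
  have h₆ : n ≤ 1 := by
    have : (n : ℝ) ≤ 1 := by simpa using h₄
    exact_mod_cast this
  obtain rfl | rfl : n = 0 ∨ n = 1 := by omega
  · have h₇ : vertexDist (o.src e) (γ.loop r) = 0 := by simpa using hn.symm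
    exact Or.inl ⟨h₇, eq_vertex_of_vertexDist_eq_zero h₇⟩
  · have h₇ : vertexDist (o.src e) (γ.loop r) = 1 := by simpa using hn.symm
    exact Or.inr ⟨h₇, eq_vertex_of_vertexDist_eq_zero (by rw [h₂, h₇, sub_self])⟩

/-- A circle inside an open edge would have a coordinate that is injective on `(0,1)`, has equal
values at 0 and 1, and has a different value at `1 / 2`. -/
theorem exists_loop_notMem_openEdge (hfin : LocallyFinite G) (γ : CircleIn o) (e : E(G)) :
    ∃ r, γ.loop r ∉ openEdge o e := by
  by_contra! hall
  have hc := (continuous_vertexDist (o := o) hfin (o.src e)).comp γ.continuous_loop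
  have hinj := γ.injOn_vertexDist_loop (s := 0) (t := 1) (fun r _ => hall r) (by norm_num)
  refine not_injOn_Ioo_of_eq_endpoints (m := 1 / 2) ⟨by norm_num, by norm_num⟩ hc.continuousOn
    ?_ ?_ hinj
  · have := γ.loop_add_one 0
    rw [zero_add] at this
    simp [this]
  · intro heq
    obtain ⟨h₁, h₂⟩ := inner_vertexDist (hall (1 / 2))
    obtain ⟨h₃, h₄⟩ := inner_vertexDist (hall 0)
    have := γ.eq_of_loop_eq (r := 1 / 2) (r' := 0) (by
      rw [h₂, h₄]
      congr 2) (by rw [abs_lt]; norm_num)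
    norm_num at this

/-- A circle that meets the interior of an edge traverses it in one of its two directions. -/
theorem traverses_or_of_mem (hfin : LocallyFinite G) (γ : CircleIn o) {e : E(G)} {r₀ : ℝ}
    (hr₀ : γ.loop r₀ ∈ openEdge o e) :
    γ.Traverses (o.natural e) ∨ γ.Traverses (o.natural e).rev := by
  obtain ⟨q, hq⟩ := γ.exists_loop_notMem_openEdge hfin e
  set B : Set ℝ := γ.loop ⁻¹' openEdge o e
  have hB : IsClosed Bᶜ := ((isOpen_openEdge e).preimage γ.continuous_loop).isClosed_compl
  obtain ⟨r₁, hr₁, h₁, h₂⟩ : ∃ r₁ ∉ B, r₁ ≤ r₀ ∧ r₀ ≤ r₁ + 1 := by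
    refine ⟨q + ⌊r₀ - q⌋, ?_, ?_, ?_⟩
    · change γ.loop _ ∉ openEdge o e
      rwa [γ.loop_add_intCast]
    · linarith [Int.floor_le (r₀ - q)]
    · linarith [Int.lt_floor_add_one (r₀ - q)]
  have hr₁' : r₁ + 1 ∉ B := by
    change γ.loop _ ∉ openEdge o e
    rwa [γ.loop_add_one]
  -- `(s,t)` is the maximal interval around `r₀` on which the circle stays in the open edge; it has
  -- length at most 1, as `r₁` and `r₁ + 1` are not in `B`.
  obtain ⟨s, ⟨hsB, hs⟩, hsmax⟩ := (isCompact_Icc.inter_left hB).exists_isGreatest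
    (⟨r₁, hr₁, ⟨le_rfl, h₁⟩⟩ : (Bᶜ ∩ Set.Icc r₁ r₀).Nonempty)
  obtain ⟨t, ⟨htB, ht⟩, htmin⟩ := (isCompact_Icc.inter_left hB).exists_isLeast
    (⟨r₁ + 1, hr₁', ⟨h₂, le_rfl⟩⟩ : (Bᶜ ∩ Set.Icc r₀ (r₁ + 1)).Nonempty)
  have hsr : s < r₀ := lt_of_le_of_ne hs.2 fun h => hsB (h ▸ hr₀)
  have hrt : r₀ < t := lt_of_le_of_ne ht.1 fun h => htB (h ▸ hr₀)
  have hst : s < t := hsr.trans hrt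
  have hin : ∀ r ∈ Set.Ioo s t, γ.loop r ∈ openEdge o e := fun r hr => by
    by_contra hrB
    rcases le_total r r₀ with h | h
    · exact absurd (hsmax ⟨hrB, hs.1.trans hr.1.le, h⟩) (not_le.2 hr.1)
    · exact absurd (htmin ⟨hrB, h, hr.2.le.trans ht.2⟩) (not_le.2 hr.2)
  have hc := (continuous_vertexDist (o := o) hfin (o.src e)).comp γ.continuous_loop
  have hinj := γ.injOn_vertexDist_loop hin (by linarith [hs.1, ht.2])
  have hS := γ.loop_eq_vertex_of_notMem hfin hst hin (Set.left_mem_Icc.2 hst.le) hsB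
  have hT := γ.loop_eq_vertex_of_notMem hfin hst hin (Set.right_mem_Icc.2 hst.le) htB
  have hmid := (inner_vertexDist hr₀).1
  -- If the circle entered and left the edge at the same endvertex, its coordinate would take some
  -- value twice.
  have hne : vertexDist (o.src e) (γ.loop s) ≠ vertexDist (o.src e) (γ.loop t) := fun heq => by
    refine not_injOn_Ioo_of_eq_endpoints ⟨hsr, hrt⟩ hc.continuousOn heq ?_ hinj
    simp only [Function.comp_apply]
    rcases hS with h | h
    · rw [h.1]
      exact hmid.1.ne'
    · rw [h.1]
      exact hmid.2.ne
  have hsurj : (∀ τ ∈ Set.Ioo (0 : ℝ) 1, τ ∈ Set.uIcc (vertexDist (o.src e) (γ.loop s))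
      (vertexDist (o.src e) (γ.loop t))) →
      (fun r : ℝ => γ.toFun (r : UnitAddCircle)) '' Set.Ioo s t = openEdge o e := by
    intro hτ
    refine Set.Subset.antisymm ?_ ?_
    · rintro _ ⟨r, hr, rfl⟩
      exact hin r hr
    · rintro _ ⟨τ, rfl⟩
      obtain ⟨r, hr, hrτ⟩ := intermediate_value_uIcc (a := s) (b := t) hc.continuousOn (hτ τ τ.2)
      rw [Set.uIcc_of_le hst.le] at hr
      simp only [Function.comp_apply] at hrτ
      have h₃ : r ≠ s := by
        rintro rfl
        have := τ.2.1
        have := τ.2.2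
        rcases hS with h | h <;> linarith [h.1]
      have h₄ : r ≠ t := by
        rintro rfl
        have := τ.2.1
        have := τ.2.2
        rcases hT with h | h <;> linarith [h.1]
      have hr' : r ∈ Set.Ioo s t := ⟨lt_of_le_of_ne hr.1 h₃.symm, lt_of_le_of_ne hr.2 h₄⟩
      obtain ⟨h₅, h₆⟩ := inner_vertexDist (hin r hr')
      refine ⟨r, hr', h₆.trans ?_⟩
      congr 1
      exact Subtype.ext hrτ
  rcases hS with hS | hS <;> rcases hT with hT | hT
  · exact absurd (hS.1.trans hT.1.symm) hne
  · refine Or.inl ⟨s, t, hst, hS.2, hT.2, hsurj ?_⟩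
    rw [hS.1, hT.1, Set.uIcc_of_le zero_le_one]
    exact fun τ hτ => Set.Ioo_subset_Icc_self hτ
  · refine Or.inr ⟨s, t, hst, hS.2, hT.2, hsurj ?_⟩
    rw [hS.1, hT.1, Set.uIcc_of_ge zero_le_one]
    exact fun τ hτ => Set.Ioo_subset_Icc_self hτ
  · exact absurd (hS.1.trans hT.1.symm) hne

/-- The increment of a lift of `wrap e` along a circle that traverses `e`. -/
theorem lift_sub_of_traverses (hfin : LocallyFinite G) (γ : CircleIn o) {e : E(G)} {L : ℝ → ℝ}
    (hL : Continuous L) (hLe : ∀ r, (L r : UnitAddCircle) = wrap e (γ.loop r)) {s t : ℝ}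
    (hst : s < t) {x y : V(G)} (hs : γ.loop s = .vertex x) (ht : γ.loop t = .vertex y)
    (h : γ.loop '' Set.Ioo s t = openEdge o e) :
    L (s + 1) - L s =
      vertexDist (o := o) (o.src e) (.vertex y) - vertexDist (o := o) (o.src e) (.vertex x) := by
  have hin : ∀ r ∈ Set.Ioo s t, γ.loop r ∈ openEdge o e := fun r hr => h ▸ ⟨r, hr, rfl⟩
  have hts : t ≤ s + 1 := by
    by_contra! hlt
    have := hin (s + 1) ⟨by linarith, hlt⟩
    rw [γ.loop_add_one, hs] at this
    obtain ⟨τ, hτ⟩ := this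
    cases hτ
  have hc := (continuous_vertexDist (o := o) hfin (o.src e)).comp γ.continuous_loop
  -- Over the period from `s` to `s + 1`, the lift grows like the distance from the source on
  -- `[s,t]` and is constant on `[t,s+1]`, where injectivity keeps the circle off the edge.
  have h₁ := sub_eq_sub_of_coe_unitAddCircle_eq (a := s) (b := t) hL.continuousOn hc.continuousOn
    fun r hr => by
      rw [Set.uIcc_of_le hst.le] at hr
      rw [hLe, ← (γ.coe_vertexDist_eq_wrap hfin hst hin hr).1]
      rfl
  have h₂ := sub_eq_sub_of_coe_unitAddCircle_eq (a := t) (b := s + 1) (g := fun _ => 0)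
    hL.continuousOn continuousOn_const fun r hr => by
      rw [Set.uIcc_of_le hts] at hr
      rw [hLe, wrap_eq_zero]
      · simp
      · rw [← h]
        rintro ⟨r', hr', hrr'⟩
        have := γ.eq_of_loop_eq hrr' (by
          rw [abs_lt]
          constructor <;> linarith [hr.1, hr.2, hr'.1, hr'.2])
        linarith [hr.1, hr'.2]
  simp only [Function.comp_apply, hs, ht] at h₁
  linarith

/-- The value of the oriented circuit of a circle on `e` is the degree of `wrap e` along it. -/
theorem lift_sub_eq_orientedCircuit (hfin : LocallyFinite G) (γ : CircleIn o) {e : E(G)}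
    {L : ℝ → ℝ} (hL : Continuous L) (hLe : ∀ r, (L r : UnitAddCircle) = wrap e (γ.loop r)) :
    L 1 - L 0 = γ.orientedCircuit (o.natural e) := by
  have hne := o.src_ne_tgt e
  have h₁ : γ.Traverses (o.natural e) → L 1 - L 0 = 1 := by
    rintro ⟨s, t, hst, hs, ht, h⟩
    rw [← γ.lift_sub_const hL hLe s, γ.lift_sub_of_traverses hfin hL hLe hst hs ht h]
    simp [vertexDist, Direction.natural, hne.symm]
  have h₂ : γ.Traverses (o.natural e).rev → L 1 - L 0 = -1 := by
    rintro ⟨s, t, hst, hs, ht, h⟩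
    rw [← γ.lift_sub_const hL hLe s, γ.lift_sub_of_traverses hfin hL hLe hst hs ht h]
    simp [vertexDist, Direction.natural, OEdge.rev, hne.symm]
  by_cases h₃ : γ.Traverses (o.natural e)
  · have h₄ : ¬ γ.Traverses (o.natural e).rev := fun h => by
      have := (h₁ h₃).symm.trans (h₂ h)
      norm_num at this
    simp [orientedCircuit, h₃, h₄, h₁ h₃]
  · by_cases h₄ : γ.Traverses (o.natural e).rev
    · simp [orientedCircuit, h₃, h₄, h₂ h₄]
    · have := sub_eq_sub_of_coe_unitAddCircle_eq (a := 0) (b := 1) (f := L) (g := fun _ => 0)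
        (by fun_prop) (by fun_prop) fun r _ => by
          rw [hLe, wrap_eq_zero]
          · simp
          · intro h
            exact (γ.traverses_or_of_mem hfin h).elim h₃ h₄
      simp [orientedCircuit, h₃, h₄, this]

theorem orientedCircuit_eq_one_or_neg_one (hfin : LocallyFinite G) (γ : CircleIn o) {e : E(G)}
    {r : ℝ} (hr : γ.loop r ∈ openEdge o e) :
    γ.orientedCircuit (o.natural e) = 1 ∨ γ.orientedCircuit (o.natural e) = -1 := by
  have hne := o.src_ne_tgt e
  obtain ⟨L, hL, hLe⟩ := exists_lift_unitAddCircle ((continuous_wrap e).comp γ.continuous_loop)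
  have h := γ.lift_sub_eq_orientedCircuit hfin hL hLe
  rcases γ.traverses_or_of_mem hfin hr with ⟨s, t, hst, hs, ht, h'⟩ | ⟨s, t, hst, hs, ht, h'⟩
  · left
    have h₁ : (γ.orientedCircuit (o.natural e) : ℝ) = 1 := by
      rw [← h, ← γ.lift_sub_const hL hLe s, γ.lift_sub_of_traverses hfin hL hLe hst hs ht h']
      simp [vertexDist, Direction.natural, hne.symm]
    exact_mod_cast h₁
  · right
    have h₁ : (γ.orientedCircuit (o.natural e) : ℝ) = -1 := by
      rw [← h, ← γ.lift_sub_const hL hLe s, γ.lift_sub_of_traverses hfin hL hLe hst hs ht h']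
      simp [vertexDist, Direction.natural, OEdge.rev, hne.symm]
    exact_mod_cast h₁

end CircleIn

variable (o) in
/-- An integer-valued function on the edges is a flow if its net value across every finite cut is
zero. The condition is stated for finite edge sets containing the cut. -/
def IsFlow (φ : E(G) → ℤ) : Prop :=
  ∀ (X : Set V(G)) (F : Finset E(G)), (∀ e, (o.src e ∈ X) ≠ (o.tgt e ∈ X) → e ∈ F) →
    ∑ e ∈ F, φ e * (X.indicator 1 (o.tgt e) - X.indicator 1 (o.src e)) = 0

/-- On an edge the height is constant if the edge does not cross the cut and is otherwise `t` or `1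
- t`, which is plus or minus `wrap` modulo 1. All other summands vanish there, and non-crossing
edges of `F` have coefficient zero. -/
theorem coe_cutHeight {X : Set V(G)} {F : Finset E(G)}
    (hF : ∀ e, (o.src e ∈ X) ≠ (o.tgt e ∈ X) → e ∈ F) (p : Freudenthal o) :
    ((cutHeight X p : ℝ) : UnitAddCircle) =
      ∑ e ∈ F, (X.indicator 1 (o.tgt e) - X.indicator 1 (o.src e) : ℤ) • wrap e p := by
  classical
  have h1 : ((1 : ℝ) : UnitAddCircle) = 0 := AddCircle.coe_period 1
  match p with
  | .vertex y =>
    by_cases hy : y ∈ X <;> simp [wrap, cutHeight, hy, h1]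
  | .ofEnd ω =>
    by_cases hω : ω.EventuallyIn X <;> simp [wrap, cutHeight, hω, h1]
  | .inner e t =>
    have h₁ : ∑ e' ∈ F, (X.indicator 1 (o.tgt e') - X.indicator 1 (o.src e') : ℤ) •
        wrap (o := o) e' (.inner e t) =
        (X.indicator 1 (o.tgt e) - X.indicator 1 (o.src e) : ℤ) • ((t : ℝ) : UnitAddCircle) := by
      by_cases he : e ∈ F
      · rw [Finset.sum_eq_single_of_mem e he, wrap_inner]
        intro e' _ hne
        simp [wrap, hne.symm]
      · have : (o.src e ∈ X) = (o.tgt e ∈ X) := not_not.1 fun h => he (hF e h)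
        rw [Finset.sum_eq_zero]
        · simp [Set.indicator_apply, this]
        · intro e' he'
          have hne : e ≠ e' := by
            rintro rfl
            exact he he'
          simp [wrap, hne]
    rw [h₁]
    by_cases h₂ : o.src e ∈ X <;> by_cases h₃ : o.tgt e ∈ X <;> simp [cutHeight, h₂, h₃, h1]

/-- The signed sum of lifts of the maps `wrap e` over the cut and the function `cutHeight X` along
the circle are lifts of the same path. The first increases by the net value of the circuit across
the cut, the second returns to its initial value. -/
theorem CircleIn.isFlow [G.Loopless] (hfin : LocallyFinite G) (γ : CircleIn o) :
    IsFlow o fun e => γ.orientedCircuit (o.natural e) := by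
  intro X F hF
  choose L hL hLe using fun e : E(G) =>
    exists_lift_unitAddCircle ((continuous_wrap e).comp γ.continuous_loop)
  have hcut : Continuous (cutHeight X : Freudenthal o → ℝ) :=
    continuous_cutHeight (F.finite_toSet.subset fun e he => hF e he)
  have h := sub_eq_sub_of_coe_unitAddCircle_eq (a := 0) (b := 1)
    (f := fun r => ∑ e ∈ F, (X.indicator 1 (o.tgt e) - X.indicator 1 (o.src e) : ℤ) • L e r)
    (g := fun r => cutHeight X (γ.loop r))
    (Continuous.continuousOn (continuous_finsetSum _ fun e _ => (hL e).zsmul _))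
    (hcut.comp γ.continuous_loop).continuousOn fun r _ => by
      rw [coe_cutHeight hF]
      have : ((∑ e ∈ F, (X.indicator 1 (o.tgt e) - X.indicator 1 (o.src e) : ℤ) • L e r : ℝ) :
          UnitAddCircle) = ∑ e ∈ F, (((X.indicator 1 (o.tgt e) - X.indicator 1 (o.src e) : ℤ) •
            L e r : ℝ) : UnitAddCircle) :=
        map_sum (QuotientAddGroup.mk' (AddSubgroup.zmultiples (1 : ℝ))) _ _
      rw [this]
      refine Finset.sum_congr rfl fun e _ => ?_
      rw [AddCircle.coe_zsmul, hLe]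
      rfl
  have h01 : γ.loop 1 = γ.loop 0 := by simpa using γ.loop_add_one 0
  simp only [h01, sub_self, ← Finset.sum_sub_distrib, ← smul_sub,
    fun e => γ.lift_sub_eq_orientedCircuit hfin (hL e) (hLe e)] at h
  have h' : ((∑ e ∈ F, γ.orientedCircuit (o.natural e) *
      (X.indicator 1 (o.tgt e) - X.indicator 1 (o.src e)) : ℤ) : ℝ) = 0 := by
    rw [← h, Int.cast_sum]
    refine Finset.sum_congr rfl fun e _ => ?_
    rw [Int.cast_mul, zsmul_eq_mul, mul_comm]
  exact_mod_cast h'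

end

end EndGraph

/-! ### Concatenation of curves -/

theorem glue_eq {Y : Type*} {f : ℕ → ℝ → Y} {n : ℕ}
    (hglue : ∀ i < n, f i 1 = f (i + 1) 0) {k : ℕ} (hk : k ≤ n) {r : ℝ}
    (hr : r ∈ Set.Icc (k : ℝ) (k + 1)) :
    f (min ⌊r⌋₊ n) (r - (min ⌊r⌋₊ n : ℕ)) = f k (r - k) := by
  rcases hr.2.lt_or_eq with h | rfl
  · rw [(Nat.floor_eq_iff ((Nat.cast_nonneg k).trans hr.1)).2 ⟨hr.1, h⟩, min_eq_left hk]
  -- At the right end of a piece the floor already gives the next index, and the next piece starts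
  -- where this one stops. For the last piece the cutoff at `n` keeps the index.
  · have : ⌊(k : ℝ) + 1⌋₊ = k + 1 := by
      rw [← Nat.cast_succ, Nat.floor_natCast]
    rw [this]
    rcases hk.lt_or_eq with h | rfl
    · rw [min_eq_left h]
      simp [hglue k h]
    · simp

/-- Concatenation of finitely many continuous curves. -/
theorem continuousOn_glue {Y : Type*} [TopologicalSpace Y] {f : ℕ → ℝ → Y}
    (hf : ∀ i, Continuous (f i)) {n : ℕ} (hglue : ∀ i < n, f i 1 = f (i + 1) 0) :
    ContinuousOn (fun r => f (min ⌊r⌋₊ n) (r - (min ⌊r⌋₊ n : ℕ)))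
      (Set.Icc (0 : ℝ) (n + 1 : ℕ)) := by
  have h : ∀ k ≤ n + 1, ContinuousOn (fun r => f (min ⌊r⌋₊ n) (r - (min ⌊r⌋₊ n : ℕ)))
      (Set.Icc (0 : ℝ) k) := by
    intro k
    induction k with
    | zero => simp
    | succ k ih =>
      intro hk
      have hU : Set.Icc (0 : ℝ) (k + 1 : ℕ) = Set.Icc (0 : ℝ) k ∪ Set.Icc (k : ℝ) (k + 1 : ℕ) :=
        (Set.Icc_union_Icc_eq_Icc (Nat.cast_nonneg k) (by simp)).symm
      rw [hU]
      refine (ih (by omega)).union_of_isClosed ?_ isClosed_Icc isClosed_Icc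
      refine ContinuousOn.congr (f := fun r => f k (r - k)) ?_ fun r hr => ?_
      · exact ((hf k).comp (continuous_sub_right _)).continuousOn
      · exact glue_eq hglue (by omega) (by simpa using hr)
  exact h (n + 1) le_rfl

/-! ### Circles from finite cycles, and flows as thin sums of circuits -/

namespace EndGraph

open scoped Graph

universe u v

variable {α : Type u} {β : Type v} {G : Graph α β}

section

variable {o : Direction G}

variable (o) in
theorem OEdge.eq_natural_or (a : OEdge G) :
    a = o.natural a.edge ∨ a = (o.natural a.edge).rev := by
  obtain ⟨e, x, y, h⟩ := a
  rcases o.eq_or_eq_of_isLink h with ⟨rfl, rfl⟩ | ⟨rfl, rfl⟩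
  · exact Or.inl rfl
  · exact Or.inr rfl

/-- An edge, run through in a given direction. -/
theorem exists_arc {e : E(G)} {x y : V(G)} (h : G.IsLink e x y) :
    ∃ f : ℝ → Freudenthal o, Continuous f ∧ f 0 = .vertex x ∧ f 1 = .vertex y ∧
      (∀ t ∈ Set.Ioo (0 : ℝ) 1, f t ∈ openEdge o e) ∧ Set.InjOn f (Set.Ioo 0 1) := by
  have hc : Continuous fun t : ℝ => edgeMap o e (Set.projIcc 0 1 zero_le_one t) :=
    (continuous_edgeMap e).comp continuous_projIcc
  have h0 : edgeMap o e (Set.projIcc 0 1 zero_le_one 0) = .vertex (o.src e) := by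
    rw [Set.projIcc_left]
    exact edgeMap_zero e
  have h1 : edgeMap o e (Set.projIcc 0 1 zero_le_one 1) = .vertex (o.tgt e) := by
    rw [Set.projIcc_right]
    exact edgeMap_one e
  have hin : ∀ t (ht : t ∈ Set.Ioo (0 : ℝ) 1),
      edgeMap o e (Set.projIcc 0 1 zero_le_one t) = .inner e ⟨t, ht⟩ := fun t ht => by
    rw [Set.projIcc_of_mem _ (Set.Ioo_subset_Icc_self ht)]
    exact edgeMap_of_mem e ⟨t, ht⟩ _
  have hneg : ∀ t ∈ Set.Ioo (0 : ℝ) 1, 1 - t ∈ Set.Ioo (0 : ℝ) 1 := fun t ht =>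
    ⟨by linarith [ht.2], by linarith [ht.1]⟩
  rcases o.eq_or_eq_of_isLink h with ⟨rfl, rfl⟩ | ⟨rfl, rfl⟩
  · refine ⟨_, hc, h0, h1, fun t ht => ⟨_, (hin t ht).symm⟩, fun s hs t ht hst => ?_⟩
    simp only [hin s hs, hin t ht] at hst
    cases hst
    rfl
  · refine ⟨_, hc.comp (continuous_sub_left 1), ?_, ?_,
      fun t ht => ⟨_, (hin (1 - t) (hneg t ht)).symm⟩, fun s hs t ht hst => ?_⟩
    · simp
    · simp
    · simp only [Function.comp_apply, hin _ (hneg s hs), hin _ (hneg t ht)] at hst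
      have := congrArg (fun p => vertexDist (o.src e) p) hst
      simp only [vertexDist_src] at this
      linarith

/-- A finite cycle in the graph, given by its vertices and edges, yields a circle that runs through
exactly these edges. -/
theorem exists_circle {n : ℕ} {x : ℕ → V(G)} {a : ℕ → E(G)}
    (hlink : ∀ i ≤ n, G.IsLink (a i) (x i) (x (i + 1))) (hclosed : x (n + 1) = x 0)
    (hx : Set.InjOn x (Set.Iic n)) (ha : Set.InjOn a (Set.Iic n)) :
    ∃ γ : CircleIn o, (∀ i ≤ n, ∃ r, γ.loop r ∈ openEdge o (a i)) ∧
      ∀ e, (∀ i ≤ n, a i ≠ e) → ∀ r, γ.loop r ∉ openEdge o e := by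
  have hf' : ∀ i, ∃ f : ℝ → Freudenthal o, Continuous f ∧ (i ≤ n → f 0 = .vertex (x i) ∧
      f 1 = .vertex (x (i + 1)) ∧ (∀ t ∈ Set.Ioo (0 : ℝ) 1, f t ∈ openEdge o (a i)) ∧
      Set.InjOn f (Set.Ioo 0 1)) := fun i => by
    by_cases hi : i ≤ n
    · obtain ⟨f, hf, h⟩ := exists_arc (o := o) (hlink i hi)
      exact ⟨f, hf, fun _ => h⟩
    -- Curves with index beyond `n` are placeholders that the concatenation never uses.
    · exact ⟨fun _ => .vertex (x 0), continuous_const, fun h => absurd h hi⟩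
  choose f hf hf' using hf'
  have hglue : ∀ i < n, f i 1 = f (i + 1) 0 := fun i hi => by
    rw [(hf' i hi.le).2.1, (hf' (i + 1) hi).1]
  set F : ℝ → Freudenthal o := fun r => f (min ⌊r⌋₊ n) (r - (min ⌊r⌋₊ n : ℕ)) with hF
  have hFk : ∀ k ≤ n, ∀ r ∈ Set.Icc (k : ℝ) (k + 1), F r = f k (r - k) := fun k hk r hr =>
    glue_eq hglue hk hr
  have hn : (0 : ℝ) < (n + 1 : ℕ) := by positivity
  have hFc : ContinuousOn (fun r => F ((n + 1 : ℕ) * r)) (Set.Icc (0 : ℝ) 1) := by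
    refine (continuousOn_glue hf hglue).comp (by fun_prop) fun r hr => ?_
    exact ⟨mul_nonneg hn.le hr.1, mul_le_of_le_one_right hn.le hr.2⟩
  have hF0 : F 0 = .vertex (x 0) := by
    rw [hFk 0 (Nat.zero_le n) 0 (by simp)]
    simpa using (hf' 0 (Nat.zero_le n)).1
  have hF1 : F (n + 1 : ℕ) = .vertex (x 0) := by
    rw [hFk n le_rfl (n + 1 : ℕ) (by simp)]
    simpa [hclosed] using (hf' n le_rfl).2.1
  -- A parameter is either a breakpoint, mapped to a vertex, or is inside one segment, mapped into
  -- the open edge. Injectivity then reduces to that of `x`, of `a` and of each arc.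
  have hcase : ∀ r ∈ Set.Ico (0 : ℝ) (n + 1 : ℕ), ∃ k ≤ n,
      (r = k ∧ F r = .vertex (x k)) ∨
        (r - k ∈ Set.Ioo (0 : ℝ) 1 ∧ F r = f k (r - k) ∧ F r ∈ openEdge o (a k)) := by
    intro r hr
    have h₁ := Nat.floor_le hr.1
    have h₂ := Nat.lt_floor_add_one r
    have h₃ : ⌊r⌋₊ ≤ n := Nat.lt_succ_iff.1 ((Nat.floor_lt hr.1).2 hr.2)
    have h₄ := hFk _ h₃ r ⟨h₁, h₂.le⟩
    refine ⟨⌊r⌋₊, h₃, ?_⟩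
    rcases h₁.eq_or_lt with h | h
    · refine Or.inl ⟨h.symm, ?_⟩
      rw [h₄, ← h, Nat.floor_natCast, sub_self]
      exact (hf' _ h₃).1
    · have h₅ : r - ⌊r⌋₊ ∈ Set.Ioo (0 : ℝ) 1 := ⟨by linarith, by linarith⟩
      exact Or.inr ⟨h₅, h₄, h₄ ▸ (hf' _ h₃).2.2.1 _ h₅⟩
  have hFinj : Set.InjOn F (Set.Ico (0 : ℝ) (n + 1 : ℕ)) := by
    intro r hr s hs hrs
    obtain ⟨k, hk, h₁ | ⟨h₁, h₂, h₃⟩⟩ := hcase r hr <;>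
      obtain ⟨l, hl, h₄ | ⟨h₄, h₅, h₆⟩⟩ := hcase s hs
    · have h₇ : Freudenthal.vertex (o := o) (x k) = .vertex (x l) := by
        rw [← h₁.2, ← h₄.2, hrs]
      rw [h₁.1, h₄.1, hx hk hl (Freudenthal.vertex.inj h₇)]
    · rw [← hrs, h₁.2] at h₆
      obtain ⟨t, ht⟩ := h₆
      cases ht
    · rw [hrs, h₄.2] at h₃
      obtain ⟨t, ht⟩ := h₃
      cases ht
    · have h₇ : a k = a l := by
        obtain ⟨t, ht⟩ := h₃
        obtain ⟨t', ht'⟩ := h₆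
        exact (Freudenthal.inner.inj (ht.trans (hrs.trans ht'.symm))).1
      have h₈ := ha hk hl h₇
      subst h₈
      have := (hf' k hk).2.2.2 h₁ h₄ (by rw [← h₂, ← h₅, hrs])
      linarith
  have hmul : ∀ r ∈ Set.Ico (0 : ℝ) 1, ((n + 1 : ℕ) : ℝ) * r ∈ Set.Ico (0 : ℝ) (n + 1 : ℕ) :=
    fun r hr => ⟨mul_nonneg hn.le hr.1, mul_lt_of_lt_one_right hn hr.2⟩
  have hrep : ∀ p : UnitAddCircle, ∃ r ∈ Set.Ico (0 : ℝ) 1, (r : UnitAddCircle) = p := fun p => by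
    have : p ∈ (QuotientAddGroup.mk '' Set.Ico (0 : ℝ) (0 + 1) : Set UnitAddCircle) := by
      rw [AddCircle.coe_image_Ico_eq (1 : ℝ) 0]
      trivial
    simpa using this
  have happ : ∀ r ∈ Set.Ico (0 : ℝ) 1,
      AddCircle.liftIco (1 : ℝ) 0 (fun r => F ((n + 1 : ℕ) * r)) (r : UnitAddCircle) =
        F ((n + 1 : ℕ) * r) := fun r hr => AddCircle.liftIco_zero_coe_apply hr
  let γ : CircleIn o :=
    { toFun := ⟨AddCircle.liftIco (1 : ℝ) 0 fun r => F ((n + 1 : ℕ) * r),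
        AddCircle.liftIco_zero_continuous (by rw [mul_zero, mul_one, hF0, hF1]) hFc⟩
      injective := by
        intro p q hpq
        obtain ⟨r, hr, rfl⟩ := hrep p
        obtain ⟨s, hs, rfl⟩ := hrep q
        rw [ContinuousMap.coe_mk, happ r hr, happ s hs] at hpq
        rw [mul_left_cancel₀ hn.ne' (hFinj (hmul r hr) (hmul s hs) hpq)] }
  refine ⟨γ, fun i hi => ?_, fun e he r => ?_⟩
  · have hi' : (i : ℝ) ≤ n := Nat.cast_le.2 hi
    have hi0 : (0 : ℝ) ≤ i := Nat.cast_nonneg i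
    have hs : ((i : ℝ) + 1 / 2) / (n + 1 : ℕ) ∈ Set.Ico (0 : ℝ) 1 := by
      refine ⟨by positivity, ?_⟩
      rw [div_lt_one hn]
      push_cast
      linarith
    refine ⟨((i : ℝ) + 1 / 2) / (n + 1 : ℕ), ?_⟩
    change AddCircle.liftIco (1 : ℝ) 0 (fun r => F ((n + 1 : ℕ) * r)) _ ∈ _
    rw [happ _ hs, mul_div_cancel₀ _ hn.ne', hFk i hi _ ⟨by linarith, by linarith⟩]
    refine (hf' i hi).2.2.1 _ ⟨?_, ?_⟩ <;> norm_num
  · obtain ⟨s, hs, hsr⟩ := hrep r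
    have : γ.loop r = F ((n + 1 : ℕ) * s) := by
      rw [CircleIn.loop, ← hsr]
      exact happ s hs
    rw [this]
    rintro ⟨t, ht⟩
    obtain ⟨k, hk, h | ⟨-, -, h⟩⟩ := hcase _ (hmul s hs)
    · rw [h.2] at ht
      cases ht
    · rw [← ht] at h
      obtain ⟨t', ht'⟩ := h
      cases ht'
      exact he k hk rfl

variable (o) in
/-- The group of flows. -/
def flows : AddSubgroup (E(G) → ℤ) where
  carrier := {φ | IsFlow o φ}
  zero_mem' := fun X F _ => by simp
  add_mem' := fun {φ ψ} hφ hψ X F hF => by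
    simp only [Pi.add_apply, add_mul, Finset.sum_add_distrib, hφ X F hF, hψ X F hF, add_zero]
  neg_mem' := fun {φ} hφ X F hF => by
    simp only [Pi.neg_apply, neg_mul, Finset.sum_neg_distrib, hφ X F hF, neg_zero]

theorem mem_flows {φ : E(G) → ℤ} : φ ∈ flows o ↔ IsFlow o φ := Iff.rfl

/-- The pointwise sum of a thin family of flows is a flow. -/
theorem isFlow_finsum {I : Type*} {ψ : I → E(G) → ℤ} (hψ : ∀ i, IsFlow o (ψ i))
    (hthin : ∀ e, (Function.support fun i => ψ i e).Finite) :
    IsFlow o fun e => ∑ᶠ i, ψ i e := by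
  classical
  intro X F hF
  -- Only finitely many members of the family are non-zero somewhere on `F`, so the sums may be
  -- interchanged.
  have h : ∀ e ∈ F, ∑ᶠ i, ψ i e = ∑ i ∈ F.biUnion fun e => (hthin e).toFinset, ψ i e :=
    fun e he => by
      refine finsum_eq_sum_of_support_subset _ fun i hi => ?_
      simp only [Finset.coe_biUnion, Set.mem_iUnion]
      exact ⟨e, he, by simpa using hi⟩
  have h' : ∀ e ∈ F, (∑ᶠ i, ψ i e) * (X.indicator 1 (o.tgt e) - X.indicator 1 (o.src e)) =
      ∑ i ∈ F.biUnion fun e => (hthin e).toFinset,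
        ψ i e * (X.indicator 1 (o.tgt e) - X.indicator 1 (o.src e)) := fun e he => by
    rw [h e he, Finset.sum_mul]
  rw [Finset.sum_congr rfl h', Finset.sum_comm]
  exact Finset.sum_eq_zero fun i _ => hψ i X F hF

/-- The oriented circuit of a circle as a function on the edges in their natural direction. -/
noncomputable def CircleIn.circuit (γ : CircleIn o) (e : E(G)) : ℤ :=
  γ.orientedCircuit (o.natural e)

theorem isFlow_value [G.Loopless] (hfin : LocallyFinite G) (φ : cycleSpace o) :
    IsFlow o (value φ) := by
  obtain ⟨I, γ, hγ, h⟩ := φ.2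
  have : value φ = fun e => ∑ᶠ i, (γ i).orientedCircuit (o.natural e) := funext fun e => h _
  rw [this]
  exact isFlow_finsum (fun i => (γ i).isFlow hfin) fun e => hγ _

theorem value_injective : Function.Injective (value : cycleSpace o → E(G) → ℤ) := by
  intro φ ψ h
  refine Subtype.ext (Subtype.ext (funext fun a => ?_))
  have h' : ∀ e, ((φ : edgeSpace G) : OEdge G → ℤ) (o.natural e) =
      ((ψ : edgeSpace G) : OEdge G → ℤ) (o.natural e) := fun e => congrFun h e
  rcases a.eq_natural_or o with ha | ha
  · rw [ha, h']
  · rw [ha, (φ : edgeSpace G).2, (ψ : edgeSpace G).2, h']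

/-- If a flow vanishes on a finite edge set `A` but not on `e`, then some circle runs through `e` and
avoids `A`. -/
theorem IsFlow.exists_circle [G.Loopless] {φ : E(G) → ℤ} (hφ : IsFlow o φ) {A : Finset E(G)}
    (hA : ∀ a ∈ A, φ a = 0) {e : E(G)} (he : φ e ≠ 0) :
    ∃ γ : CircleIn o, (∃ r, γ.loop r ∈ openEdge o e) ∧
      ∀ a ∈ A, ∀ r, γ.loop r ∉ openEdge o a := by
  classical
  let H : SimpleGraph V(G) :=
    { Adj := fun x y => x ≠ y ∧ ∃ a : E(G), a ∉ insert e A ∧ G.IsLink a x y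
      symm := ⟨fun x y h => ⟨h.1.symm, h.2.imp fun _ h => ⟨h.1, h.2.symm⟩⟩⟩ }
  have hne := o.src_ne_tgt e
  -- Otherwise the set of vertices reachable from `o.tgt e`, possibly infinite, is bounded by a
  -- finite cut inside `insert e A`, across which `e` alone carries flow.
  have hreach : H.Reachable (o.tgt e) (o.src e) := by
    by_contra hnot
    let X : Set V(G) := {x | H.Reachable (o.tgt e) x}
    have hcut : ∀ a, (o.src a ∈ X) ≠ (o.tgt a ∈ X) → a ∈ insert e A := fun a ha => by
      by_contra hmem
      have hadj : H.Adj (o.src a) (o.tgt a) := ⟨o.src_ne_tgt a, a, hmem, o.isLink a⟩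
      exact ha (propext ⟨fun h => h.trans hadj.reachable, fun h => h.trans hadj.symm.reachable⟩)
    have h := hφ X _ hcut
    rw [Finset.sum_eq_single_of_mem e (Finset.mem_insert_self e A)] at h
    · have h₁ : o.tgt e ∈ X := SimpleGraph.Reachable.refl _
      have h₂ : o.src e ∉ X := hnot
      simp [h₁, h₂, he] at h
    · intro a ha hae
      rw [hA a ((Finset.mem_insert.1 ha).resolve_left hae), zero_mul]
  obtain ⟨p, hp⟩ := hreach.exists_isPath
  have hpos : 0 < p.length := by
    rw [Nat.pos_iff_ne_zero]
    intro h
    exact hne (SimpleGraph.Walk.eq_of_length_eq_zero h).symm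
  choose b hb using fun i : {i // i < p.length} => (p.adj_getVert_succ i.2).2
  -- The path from `o.tgt e` to `o.src e` is closed up by `e`, which gets the index `p.length`; the
  -- vertex after that is again the start of the path.
  let x : ℕ → V(G) := fun i => if i ≤ p.length then p.getVert i else o.tgt e
  let a : ℕ → E(G) := fun i => if h : i < p.length then b ⟨i, h⟩ else e
  have hxi : ∀ i ≤ p.length, x i = p.getVert i := fun i hi => by simp [x, hi]
  have hai : ∀ i (hi : i < p.length), a i = b ⟨i, hi⟩ := fun i hi => by simp [a, hi]
  have han : a p.length = e := by simp [a]
  have hinj := hp.getVert_injOn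
  obtain ⟨γ, hγ, hγ'⟩ := EndGraph.exists_circle (o := o) (n := p.length) (x := x) (a := a)
    (fun i hi => by
      rcases hi.lt_or_eq with h | rfl
      · rw [hai i h, hxi i hi, hxi (i + 1) h]
        exact (hb ⟨i, h⟩).2
      · rw [han, hxi _ le_rfl, SimpleGraph.Walk.getVert_length]
        simpa [x] using o.isLink e)
    (by simp [x]) (fun i hi j hj hij => by
      rw [hxi i hi, hxi j hj] at hij
      exact hinj hi hj hij)
    (fun i hi j hj hij => by
      have hbe : ∀ k, b k ≠ e := fun k h => (hb k).1 (by simp [h])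
      rcases (show i ≤ p.length from hi).lt_or_eq with h | rfl <;>
        rcases (show j ≤ p.length from hj).lt_or_eq with h' | rfl
      · rw [hai i h, hai j h'] at hij
        have h₁ := (hb ⟨i, h⟩).2
        have h₂ := (hb ⟨j, h'⟩).2
        rw [hij] at h₁
        rcases h₁.eq_and_eq_or_eq_and_eq h₂ with ⟨h₃, -⟩ | ⟨h₃, h₄⟩
        · exact hinj h.le h'.le (Subtype.ext h₃)
        -- Using the same edge in opposite directions would require both `i = j + 1` and `i + 1 =
        -- j`.
        · have h₅ : i = j + 1 := hinj h.le (Set.mem_ofPred_eq ▸ h') (Subtype.ext h₃)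
          have h₆ : i + 1 = j := hinj (Set.mem_ofPred_eq ▸ h) h'.le (Subtype.ext h₄)
          omega
      · rw [hai i h, han] at hij
        exact absurd hij (hbe _)
      · rw [hai j h', han] at hij
        exact absurd hij.symm (hbe _)
      · rfl)
  refine ⟨γ, han ▸ hγ _ le_rfl, fun c hc r => hγ' c (fun i hi => ?_) r⟩
  rcases hi.lt_or_eq with h | rfl
  · rw [hai i h]
    rintro rfl
    exact (hb ⟨i, h⟩).1 (Finset.mem_insert_of_mem hc)
  · rw [han]
    rintro rfl
    exact he (hA _ hc)

theorem CircleIn.circuit_reverse (γ : CircleIn o) (e : E(G)) :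
    γ.reverse.circuit e = -γ.circuit e := γ.orientedCircuit_reverse _

/-- Subtract `|φ e|` copies of a circuit through `e` that avoids `A`, directed according to the sign
of `φ e`. Thin sums have no coefficients, so the multiplicity is recorded by repetition in a list.
-/
theorem IsFlow.exists_sub_circuits [G.Loopless] (hfin : LocallyFinite G) {φ : E(G) → ℤ}
    (hφ : IsFlow o φ) {A : Finset E(G)} (hA : ∀ a ∈ A, φ a = 0) (e : E(G)) :
    ∃ (L : List (CircleIn o)) (φ' : E(G) → ℤ), IsFlow o φ' ∧ (∀ a ∈ A, φ' a = 0) ∧ φ' e = 0 ∧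
      (∀ γ ∈ L, ∀ a ∈ A, γ.circuit a = 0) ∧
      ∀ a, φ a - φ' a = (L.map fun γ => γ.circuit a).sum := by
  by_cases he : φ e = 0
  · exact ⟨[], φ, hφ, hA, he, by simp, by simp⟩
  obtain ⟨γ, hγ₁, hγ₂⟩ : ∃ γ : CircleIn o, γ.circuit e = (φ e).sign ∧
      ∀ a ∈ A, γ.circuit a = 0 := by
    obtain ⟨γ, ⟨r, hr⟩, hγ⟩ := hφ.exists_circle hA he
    have h₁ : ∀ a ∈ A, γ.circuit a = 0 := fun a ha => γ.orientedCircuit_eq_zero (hγ a ha)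
    have h₂ : γ.reverse.circuit e = (φ e).sign ∨ γ.circuit e = (φ e).sign := by
      rw [γ.circuit_reverse]
      have h₃ : γ.circuit e = 1 ∨ γ.circuit e = -1 :=
        γ.orientedCircuit_eq_one_or_neg_one hfin hr
      rcases lt_or_gt_of_ne he with h | h
      · rw [Int.sign_eq_neg_one_of_neg h]
        omega
      · rw [Int.sign_eq_one_of_pos h]
        omega
    rcases h₂ with h₂ | h₂
    · exact ⟨γ.reverse, h₂, fun a ha => by rw [γ.circuit_reverse, h₁ a ha, neg_zero]⟩
    · exact ⟨γ, h₂, h₁⟩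
  have hflow : (φ - (φ e).natAbs • γ.circuit) ∈ flows o :=
    (flows o).sub_mem hφ ((flows o).nsmul_mem (γ.isFlow hfin) _)
  refine ⟨List.replicate (φ e).natAbs γ, _, hflow, fun a ha => ?_, ?_, fun δ hδ a ha => ?_,
    fun a => ?_⟩
  · simp [hA a ha, hγ₂ a ha]
  · have := Int.sign_mul_natAbs (φ e)
    rw [Pi.sub_apply, Pi.smul_apply, hγ₁, nsmul_eq_mul, mul_comm, Int.sign_mul_natAbs, sub_self]
  · rw [List.eq_of_mem_replicate hδ]
    exact hγ₂ a ha
  · simp [List.sum_replicate]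

theorem finite_walk_length [G.Loopless] (hfin : LocallyFinite G) (o : Direction G) (n : ℕ) :
    ∀ r : V(G), {x | ∃ p : G.toSimpleGraph.Walk r x, p.length = n}.Finite := by
  induction n with
  | zero =>
    refine fun r => (Set.finite_singleton r).subset ?_
    rintro x ⟨p, hp⟩
    exact (SimpleGraph.Walk.eq_of_length_eq_zero hp).symm
  | succ n ih =>
    intro r
    have hN : {y | G.toSimpleGraph.Adj r y}.Finite := by
      refine (((hfin.finite_incident o r).image o.src).union
        ((hfin.finite_incident o r).image o.tgt)).subset ?_
      intro y hy
      obtain ⟨e, ⟨h₁, h₂⟩ | ⟨h₁, h₂⟩⟩ := o.exists_edge hy.2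
      · exact Or.inr ⟨e, Or.inl h₁, h₂⟩
      · exact Or.inl ⟨e, Or.inr h₂, h₁⟩
    refine (hN.biUnion fun y _ => ih y).subset ?_
    rintro x ⟨p, hp⟩
    cases p with
    | nil => simp at hp
    | @cons _ y _ h p => exact Set.mem_biUnion h ⟨p, by simpa using hp⟩

theorem countable_edgeSet [G.Loopless] (hconn : G.toSimpleGraph.Connected)
    (hfin : LocallyFinite G) (o : Direction G) : Countable E(G) := by
  obtain ⟨r⟩ := hconn.nonempty
  have hV : (Set.univ : Set V(G)).Countable := by
    refine (Set.countable_iUnion fun n => (finite_walk_length hfin o n r).countable).mono ?_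
    intro x _
    obtain ⟨p⟩ := hconn.preconnected r x
    exact Set.mem_iUnion.2 ⟨p.length, p, rfl⟩
  have hE : (Set.univ : Set E(G)).Countable := by
    refine (hV.biUnion fun x _ => (hfin.finite_incident o x).countable).mono ?_
    intro e _
    exact Set.mem_biUnion (Set.mem_univ (o.src e)) (Or.inl rfl)
  exact Set.countable_univ_iff.1 hE

/-- Every flow is a thin sum of oriented circuits. -/
theorem IsFlow.exists_value_eq [G.Loopless] (hconn : G.toSimpleGraph.Connected)
    (hfin : LocallyFinite G) {φ : E(G) → ℤ} (hφ : IsFlow o φ) :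
    ∃ x : cycleSpace o, value x = φ := by
  classical
  rcases isEmpty_or_nonempty E(G) with hE | hE
  · exact ⟨0, funext fun e => hE.elim e⟩
  have := countable_edgeSet hconn hfin o
  obtain ⟨f, hf⟩ := exists_surjective_nat E(G)
  -- A state of index `k` is a remainder vanishing on `f 0, …, f (k - 1)`. Circuits split off at
  -- stage `k` avoid these edges, so `f j` meets only circuits from stages up to `j`, which gives
  -- thinness. At `f j` the stage sums telescope from `φ` to a remainder that is zero there.
  let State : ℕ → Type v := fun k => {ψ : E(G) → ℤ // IsFlow o ψ ∧ ∀ j < k, ψ (f j) = 0}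
  have hstep : ∀ k (s : State k), ∃ (s' : State (k + 1)) (L : List (CircleIn o)),
      (∀ γ ∈ L, ∀ j < k, γ.circuit (f j) = 0) ∧
        ∀ a, s.1 a - s'.1 a = (L.map fun γ => γ.circuit a).sum := by
    rintro k ⟨ψ, hψ, hψ'⟩
    obtain ⟨L, ψ', h₁, h₂, h₃, h₄, h₅⟩ := hψ.exists_sub_circuits hfin
      (A := (Finset.range k).image f) (by simpa using hψ') (f k)
    refine ⟨⟨ψ', h₁, fun j hj => ?_⟩, L, fun γ hγ j hj => h₄ γ hγ _ ?_, h₅⟩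
    · rcases (Nat.lt_succ_iff.1 hj).lt_or_eq with h | rfl
      · exact h₂ _ (Finset.mem_image_of_mem f (Finset.mem_range.2 h))
      · exact h₃
    · exact Finset.mem_image_of_mem f (Finset.mem_range.2 hj)
  choose next L hL hnext using hstep
  let s : ∀ k, State k := Nat.rec ⟨φ, hφ, by simp⟩ next
  have hs : ∀ k, s (k + 1) = next k (s k) := fun k => rfl
  let I := ULift.{max u v} (Σ k : ℕ, Fin (L k (s k)).length)
  let γ : I → CircleIn o := fun i => (L i.down.1 (s i.down.1))[i.down.2]
  have hsupp : ∀ j, (Function.support fun i => (γ i).circuit (f j)) ⊆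
      (((Finset.range (j + 1)).sigma fun k =>
        (Finset.univ : Finset (Fin (L k (s k)).length))).map Equiv.ulift.symm.toEmbedding :
          Finset I) := by
    rintro j ⟨k, i⟩ hi
    have : k ≤ j := by
      by_contra! hlt
      exact hi (hL k (s k) _ (List.getElem_mem _) j hlt)
    refine Finset.mem_coe.2 (Finset.mem_map.2 ⟨⟨k, i⟩, ?_, rfl⟩)
    simpa [Nat.lt_succ_iff] using this
  have hval : ∀ j, ∑ᶠ i, (γ i).circuit (f j) = φ (f j) := by
    intro j
    rw [finsum_eq_sum_of_support_subset _ (hsupp j), Finset.sum_map, Finset.sum_sigma]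
    have h : ∀ k, ∑ i : Fin (L k (s k)).length,
        (γ (Equiv.ulift.symm.toEmbedding ⟨k, i⟩)).circuit (f j) =
          (s k).1 (f j) - (s (k + 1)).1 (f j) := fun k => by
      rw [hs, hnext, ← Fin.sum_univ_fun_getElem]
      rfl
    rw [Finset.sum_congr rfl fun k _ => h k, Finset.sum_range_sub' fun k => (s k).1 (f j),
      (s (j + 1)).2.2 j (Nat.lt_succ_self j), sub_zero]
    rfl
  have hthin : Thin fun i => (γ i).orientedCircuit := by
    intro a
    obtain ⟨j, hj⟩ := hf a.edge
    refine (Finset.finite_toSet _).subset (Set.Subset.trans (fun i hi => ?_) (hsupp j))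
    rw [Function.mem_support, hj]
    rcases a.eq_natural_or o with ha | ha
    · rw [Function.mem_support, ha] at hi
      exact hi
    · rw [Function.mem_support, ha] at hi
      exact neg_ne_zero.1 (((γ i).orientedCircuit_rev _).symm.trans_ne hi)
  refine ⟨⟨⟨fun a => ∑ᶠ i, (γ i).orientedCircuit a, fun a => ?_⟩, I, γ, hthin, fun a => rfl⟩, ?_⟩
  · simp only [CircleIn.orientedCircuit_rev, finsum_neg_distrib]
  · funext e
    obtain ⟨j, rfl⟩ := hf e
    exact hval j

end

end EndGraph

/-! ### Covers given by vertex partitions, and their nerves -/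

namespace EndGraph

open scoped Graph

universe u v w

variable {α : Type u} {β : Type v} {G : Graph α β} {ι : Type w}

section

variable (o : Direction G) (P : V(G) → ι) (n : ℕ)

/-- The part of `|G|` that belongs to the class `i` of a partition `P` of the vertices: the
vertices in `i`, the edges inside `i`, the first `n`-th of the edges leaving `i`, and the ends of
the rays that are eventually in `i`. -/
def block (i : ι) : Set (Freudenthal o) :=
  {p | match p with
    | .vertex x => P x = i
    | .inner e t => (P (o.src e) = i ∧ (n : ℝ) * t < 1) ∨ (P (o.tgt e) = i ∧ (n : ℝ) - n * t < 1) ∨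
        (P (o.src e) = i ∧ P (o.tgt e) = i)
    | .ofEnd ω => ω.EventuallyIn (P ⁻¹' {i})}

/-- An open subinterval of the edge `e`, around the `j`-th point of the subdivision into `n` parts. -/
def piece (e : E(G)) (j : ℕ) : Set (Freudenthal o) :=
  Freudenthal.inner e '' {t | (j : ℝ) - 1 < n * t ∧ (n : ℝ) * t < j + 1}

variable {o P n}

theorem vertex_mem_block {x : V(G)} {i : ι} : Freudenthal.vertex x ∈ block o P n i ↔ P x = i :=
  Iff.rfl

theorem inner_mem_block {e : E(G)} {t : Set.Ioo (0 : ℝ) 1} {i : ι} :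
    Freudenthal.inner e t ∈ block o P n i ↔ (P (o.src e) = i ∧ (n : ℝ) * t < 1) ∨
      (P (o.tgt e) = i ∧ (n : ℝ) - n * t < 1) ∨ (P (o.src e) = i ∧ P (o.tgt e) = i) := Iff.rfl

theorem ofEnd_mem_block {ω : Ends G} {i : ι} :
    Freudenthal.ofEnd ω ∈ block o P n i ↔ ω.EventuallyIn (P ⁻¹' {i}) := Iff.rfl

theorem inner_mem_piece {e e' : E(G)} {t : Set.Ioo (0 : ℝ) 1} {j : ℕ} :
    Freudenthal.inner e' t ∈ piece o n e j ↔
      e' = e ∧ (j : ℝ) - 1 < n * t ∧ (n : ℝ) * t < j + 1 := by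
  constructor
  · rintro ⟨s, hs, h⟩
    cases h
    exact ⟨rfl, hs⟩
  · rintro ⟨rfl, h⟩
    exact ⟨t, h, rfl⟩

theorem vertex_notMem_piece {e : E(G)} {x : V(G)} {j : ℕ} :
    Freudenthal.vertex x ∉ piece o n e j := by
  rintro ⟨s, hs, h⟩
  cases h

theorem ofEnd_notMem_piece {e : E(G)} {ω : Ends G} {j : ℕ} :
    Freudenthal.ofEnd ω ∉ piece o n e j := by
  rintro ⟨s, hs, h⟩
  cases h

theorem isOpen_piece (e : E(G)) (j : ℕ) : IsOpen (piece o n e j) := by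
  have hK : IsOpen {t : ℝ | (j : ℝ) - 1 < n * t ∧ (n : ℝ) * t < j + 1} :=
    IsOpen.and (isOpen_lt continuous_const (by fun_prop)) (isOpen_lt (by fun_prop) continuous_const)
  exact isOpen_image_inner o e hK

theorem isOpen_block (hP : {e | P (o.src e) ≠ P (o.tgt e)}.Finite) (hn : 0 < n) (i : ι) :
    IsOpen (block o P n i) := by
  have hn1 : (1 : ℝ) ≤ n := by exact_mod_cast hn
  refine isOpen_iff_edgeMap_hat.2 ⟨fun e => ?_, fun ω hω => ?_⟩
  -- The formula for inner points is also right at 0 and 1: because `1 ≤ n`, neither endpoint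
  -- satisfies the inequality belonging to the other one.
  · have h : edgeMap o e ⁻¹' block o P n i = {t : unitInterval |
        (P (o.src e) = i ∧ (n : ℝ) * t < 1) ∨ (P (o.tgt e) = i ∧ (n : ℝ) - n * t < 1) ∨
          (P (o.src e) = i ∧ P (o.tgt e) = i)} := by
      ext t
      rw [Set.mem_preimage, Set.mem_ofPred_eq]
      rcases edgeMap_cases (o := o) e t with ⟨rfl, h⟩ | ⟨rfl, h⟩ | ⟨s, hs, h⟩
      · rw [h, vertex_mem_block]
        simp only [Set.Icc.coe_zero, mul_zero, zero_lt_one, and_true, sub_zero, not_lt.2 hn1,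
          and_false, false_or]
        tauto
      · rw [h, vertex_mem_block]
        simp only [Set.Icc.coe_one, mul_one, sub_self, zero_lt_one, and_true, not_lt.2 hn1,
          and_false, false_or]
        tauto
      · rw [h, ← hs, inner_mem_block]
    rw [h]
    simp only [Set.ofPred_or]
    refine IsOpen.union (IsOpen.and isOpen_const (isOpen_lt ?_ continuous_const))
      (IsOpen.union (IsOpen.and isOpen_const (isOpen_lt ?_ continuous_const)) isOpen_const) <;>
      fun_prop
  · obtain ⟨S, C, i', hC, hi', h⟩ := ω.exists_livesIn_const o hP
    obtain ⟨x, hx, hxC⟩ := (ofEnd_mem_block.1 hω).exists_mem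
      (hC.eventuallyIn (X := {x | x ∈ C}) fun x hx => hx)
    obtain rfl : i' = i := (hi' x hxC).symm.trans hx
    refine ⟨S, C, hC, ?_⟩
    rintro (y | ⟨e, t⟩ | ω') hy
    · exact hi' y hy
    · have heq : P (o.src e) = P (o.tgt e) := by
        by_contra hne
        exact hy.elim (h e hne).1 (h e hne).2
      rw [inner_mem_block, ← heq]
      refine Or.inr (Or.inr ?_)
      rcases hy with hy | hy
      · exact ⟨hi' _ hy, hi' _ hy⟩
      · rw [heq]
        exact ⟨hi' _ hy, hi' _ hy⟩
    · exact Ends.LivesIn.eventuallyIn hy fun x hx => hi' x hx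

variable (o P n) in
open Classical in
/-- The sets that cover the edge `e`, in the order of `e`. -/
noncomputable def nodeSet (e : E(G)) (j : ℕ) : Set (Freudenthal o) :=
  if j = 0 then block o P n (P (o.src e)) else
    if n ≤ j then block o P n (P (o.tgt e)) else piece o n e j

theorem nodeSet_zero (e : E(G)) : nodeSet o P n e 0 = block o P n (P (o.src e)) := if_pos rfl

theorem nodeSet_last (hn : 0 < n) (e : E(G)) :
    nodeSet o P n e n = block o P n (P (o.tgt e)) := by
  rw [nodeSet, if_neg hn.ne', if_pos le_rfl]

theorem nodeSet_mid (e : E(G)) {j : ℕ} (hj : 0 < j) (hjn : j < n) :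
    nodeSet o P n e j = piece o n e j := by
  rw [nodeSet, if_neg hj.ne', if_neg (not_le.2 hjn)]

/-- Along a cross-edge the two blocks and the pieces between them have a uniform description, `|n *
t - j| < 1`. This makes precisely the consecutive ones meet. -/
theorem inner_mem_nodeSet {e : E(G)} (he : P (o.src e) ≠ P (o.tgt e)) {j : ℕ}
    (hjn : j ≤ n) {t : Set.Ioo (0 : ℝ) 1} :
    Freudenthal.inner e t ∈ nodeSet o P n e j ↔ (j : ℝ) - 1 < n * t ∧ (n : ℝ) * t < j + 1 := by
  have h₁ := t.2.1
  have h₂ := t.2.2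
  rcases Nat.eq_zero_or_pos j with rfl | hj
  · rw [nodeSet_zero, inner_mem_block]
    have : (0 : ℝ) ≤ n * t := by positivity
    simp only [true_and, he.symm, false_and, and_false, or_false, Nat.cast_zero]
    exact ⟨fun h => ⟨by linarith, by linarith⟩, fun h => by linarith⟩
  · rcases hjn.lt_or_eq with h | rfl
    · rw [nodeSet_mid e hj h, inner_mem_piece]
      simp
    · rw [nodeSet_last hj, inner_mem_block]
      have : (j : ℝ) * t ≤ j := mul_le_of_le_one_right (Nat.cast_nonneg j) h₂.le
      simp only [he, false_and, true_and, false_or, or_false]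
      exact ⟨fun h => ⟨by linarith, by linarith⟩, fun h => by linarith⟩

/-- The cover of `|G|` given by a partition `P` of the vertices with finitely many cross-edges, each
of which is subdivided into `n` parts. -/
def partitionCover (hP : {e | P (o.src e) ≠ P (o.tgt e)}.Finite) (hn : 0 < n) :
    Cech.OpenCover (Freudenthal o) where
  sets := {A | (∃ x, A = block o P n (P x)) ∨
    ∃ e j, P (o.src e) ≠ P (o.tgt e) ∧ 0 < j ∧ j < n ∧ A = piece o n e j}
  isOpen_of_mem := by
    rintro A (⟨x, rfl⟩ | ⟨e, j, -, -, -, rfl⟩)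
    · exact isOpen_block hP hn _
    · exact isOpen_piece e j
  sUnion_eq := by
    refine Set.eq_univ_of_forall fun p => ?_
    match p with
    | .vertex x => exact ⟨_, Or.inl ⟨x, rfl⟩, vertex_mem_block.2 rfl⟩
    | .ofEnd ω =>
      obtain ⟨S, C, i, hC, hi, -⟩ := ω.exists_livesIn_const o hP
      obtain ⟨x, hx⟩ := C.nonempty
      refine ⟨_, Or.inl ⟨x, rfl⟩, ofEnd_mem_block.2 (hC.eventuallyIn fun y hy => ?_)⟩
      exact (hi y hy).trans (hi x hx).symm
    | .inner e t =>
      by_cases he : P (o.src e) = P (o.tgt e)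
      · exact ⟨_, Or.inl ⟨o.src e, rfl⟩, inner_mem_block.2 (Or.inr (Or.inr ⟨rfl, he.symm⟩))⟩
      · have h₁ := t.2.1
        have h₂ := t.2.2
        have h₀ : (0 : ℝ) ≤ n * t := by positivity
        have h₃ := Nat.floor_le h₀
        have h₄ := Nat.lt_floor_add_one ((n : ℝ) * t)
        have h₅ : ⌊(n : ℝ) * t⌋₊ < n := (Nat.floor_lt h₀).2
          (mul_lt_of_lt_one_right (by exact_mod_cast hn) h₂)
        -- The floor of `n * t` is the index of a piece containing the point, with 0 standing for
        -- the source block.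
        rcases Nat.eq_zero_or_pos ⌊(n : ℝ) * t⌋₊ with h | h
        · refine ⟨_, Or.inl ⟨o.src e, rfl⟩, inner_mem_block.2 (Or.inl ⟨rfl, ?_⟩)⟩
          simpa [h] using h₄
        · exact ⟨_, Or.inr ⟨e, _, he, h, h₅, rfl⟩, inner_mem_piece.2 ⟨rfl, by linarith, h₄⟩⟩

variable {hP : {e | P (o.src e) ≠ P (o.tgt e)}.Finite} {hn : 0 < n}

theorem block_mem (x : V(G)) : block o P n (P x) ∈ (partitionCover hP hn).sets :=
  Or.inl ⟨x, rfl⟩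

theorem nodeSet_mem {e : E(G)} (he : P (o.src e) ≠ P (o.tgt e)) (j : ℕ) :
    nodeSet o P n e j ∈ (partitionCover hP hn).sets := by
  unfold nodeSet
  split_ifs with h h'
  · exact block_mem _
  · exact block_mem _
  · exact Or.inr ⟨e, j, he, Nat.pos_of_ne_zero h, not_le.1 h', rfl⟩

variable (hP hn) in
/-- The members of the cover along a cross-edge. -/
noncomputable def node (e : {e // P (o.src e) ≠ P (o.tgt e)}) (j : ℕ) :
    (partitionCover hP hn).sets := ⟨nodeSet o P n e j, nodeSet_mem e.2 j⟩

theorem block_injective {x y : V(G)} (h : block o P n (P x) = block o P n (P y)) : P x = P y := by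
  have : Freudenthal.vertex x ∈ block o P n (P x) := rfl
  rw [h] at this
  exact this

theorem block_ne_piece {x : V(G)} {e : E(G)} {j : ℕ} : block o P n (P x) ≠ piece o n e j := by
  intro h
  have : Freudenthal.vertex x ∈ block o P n (P x) := rfl
  rw [h] at this
  exact vertex_notMem_piece this

theorem piece_injective {e e' : E(G)} {j j' : ℕ} (hj : 0 < j) (hjn : j < n)
    (h : piece o n e j = piece o n e' j') : e = e' ∧ j = j' := by
  have hn : (0 : ℝ) < n := by exact_mod_cast hj.trans hjn
  -- The centre of the piece tells it from all others: it lies in the piece of index `j'` only if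
  -- `|j - j'| < 1`.
  have ht : (j : ℝ) / n ∈ Set.Ioo (0 : ℝ) 1 :=
    ⟨div_pos (by exact_mod_cast hj) hn, (div_lt_one hn).2 (by exact_mod_cast hjn)⟩
  have hmul : (n : ℝ) * (j / n) = j := mul_div_cancel₀ _ hn.ne'
  have : Freudenthal.inner e ⟨_, ht⟩ ∈ piece o n e j :=
    inner_mem_piece.2 ⟨rfl, by simp only [hmul]; constructor <;> linarith⟩
  rw [h, inner_mem_piece] at this
  simp only [hmul] at this
  obtain ⟨h₁, h₂, h₃⟩ := this
  refine ⟨h₁, ?_⟩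
  have h₄ : j' < j + 1 := by
    have : (j' : ℝ) < j + 1 := by linarith
    exact_mod_cast this
  have h₅ : j < j' + 1 := by exact_mod_cast h₃
  omega

theorem nodeSet_eq_piece {e e' : E(G)} {j j' : ℕ} (hj : 0 < j) (hjn : j < n)
    (h : nodeSet o P n e' j' = piece o n e j) : e' = e ∧ j' = j := by
  unfold nodeSet at h
  split_ifs at h with h₁ h₂
  · exact absurd h block_ne_piece
  · exact absurd h block_ne_piece
  · obtain ⟨h₃, h₄⟩ := piece_injective hj hjn h.symm
    exact ⟨h₃.symm, h₄.symm⟩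

theorem node_eq_node {e e' : {e // P (o.src e) ≠ P (o.tgt e)}} {j j' : ℕ} (hj : 0 < j)
    (hjn : j < n) (h : node hP hn e' j' = node hP hn e j) : e' = e ∧ j' = j := by
  have h' : nodeSet o P n e' j' = nodeSet o P n e j := congrArg Subtype.val h
  rw [nodeSet_mid _ hj hjn] at h'
  obtain ⟨h₁, h₂⟩ := nodeSet_eq_piece hj hjn h'
  exact ⟨Subtype.ext h₁, h₂⟩

theorem node_injOn (e : {e // P (o.src e) ≠ P (o.tgt e)}) {j j' : ℕ} (hj : j ≤ n) (hj' : j' ≤ n)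
    (h : node hP hn e j = node hP hn e j') : j = j' := by
  by_cases h₁ : 0 < j ∧ j < n
  · exact (node_eq_node h₁.1 h₁.2 h.symm).2.symm
  by_cases h₂ : 0 < j' ∧ j' < n
  · exact (node_eq_node h₂.1 h₂.2 h).2
  have h' : nodeSet o P n e j = nodeSet o P n e j' := congrArg Subtype.val h
  obtain rfl | rfl : j = 0 ∨ j = n := by omega
  · obtain rfl | rfl : j' = 0 ∨ j' = n := by omega
    · rfl
    · rw [nodeSet_zero, nodeSet_last hn] at h'
      exact absurd (block_injective h') e.2
  · obtain rfl | rfl : j' = 0 ∨ j' = j := by omega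
    · rw [nodeSet_zero, nodeSet_last hn] at h'
      exact absurd (block_injective h').symm e.2
    · rfl

/-- Distinct members of the cover that meet are consecutive along some cross-edge. -/
theorem eq_or_exists_node {A B : (partitionCover hP hn).sets}
    (h : ((A : Set (Freudenthal o)) ∩ B).Nonempty) :
    A = B ∨ ∃ (e : {e // P (o.src e) ≠ P (o.tgt e)}) (j : ℕ), j < n ∧
      ((A = node hP hn e j ∧ B = node hP hn e (j + 1)) ∨
        (A = node hP hn e (j + 1) ∧ B = node hP hn e j)) := by
  obtain ⟨p, hpA, hpB⟩ := h
  match p with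
  | .vertex x =>
    have key : ∀ A : (partitionCover hP hn).sets, Freudenthal.vertex x ∈ (A : Set (Freudenthal o)) →
        (A : Set (Freudenthal o)) = block o P n (P x) := by
      rintro ⟨C, hC⟩ hA
      rcases hC with ⟨y, rfl⟩ | ⟨e, j, _, _, _, rfl⟩
      · exact congrArg (block o P n) (vertex_mem_block.1 hA).symm
      · exact absurd hA vertex_notMem_piece
    exact Or.inl (Subtype.ext ((key A hpA).trans (key B hpB).symm))
  | .ofEnd ω =>
    have key : ∀ A : (partitionCover hP hn).sets, Freudenthal.ofEnd ω ∈ (A : Set (Freudenthal o)) →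
        ∃ x, (A : Set (Freudenthal o)) = block o P n (P x) ∧ ω.EventuallyIn (P ⁻¹' {P x}) := by
      rintro ⟨C, hC⟩ hA
      rcases hC with ⟨y, rfl⟩ | ⟨e, j, _, _, _, rfl⟩
      · exact ⟨y, rfl, hA⟩
      · exact absurd hA ofEnd_notMem_piece
    obtain ⟨x, hxA, hx⟩ := key A hpA
    obtain ⟨y, hyB, hy⟩ := key B hpB
    obtain ⟨z, hz₁, hz₂⟩ := hx.exists_mem hy
    have hz : P x = P y := (Set.mem_singleton_iff.1 hz₁).symm.trans hz₂
    exact Or.inl (Subtype.ext (by rw [hxA, hyB, hz]))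
  | .inner e t =>
    have h₁ := t.2.1
    have h₂ := t.2.2
    by_cases he : P (o.src e) = P (o.tgt e)
    · have key : ∀ A : (partitionCover hP hn).sets, Freudenthal.inner e t ∈ (A : Set (Freudenthal o)) →
          (A : Set (Freudenthal o)) = block o P n (P (o.src e)) := by
        rintro ⟨C, hC⟩ hA
        rcases hC with ⟨y, rfl⟩ | ⟨e', j, he', _, _, rfl⟩
        · rw [inner_mem_block, ← he] at hA
          have : P (o.src e) = P y := by tauto
          exact congrArg (block o P n) this.symm
        · obtain ⟨rfl, -⟩ := inner_mem_piece.1 hA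
          exact absurd he he'
      exact Or.inl (Subtype.ext ((key A hpA).trans (key B hpB).symm))
    · have key : ∀ A : (partitionCover hP hn).sets, Freudenthal.inner e t ∈ (A : Set (Freudenthal o)) →
          ∃ j ≤ n, A = node hP hn ⟨e, he⟩ j ∧ (j : ℝ) - 1 < n * t ∧ (n : ℝ) * t < j + 1 := by
        have aux : ∀ A : (partitionCover hP hn).sets, ∀ j ≤ n,
            Freudenthal.inner e t ∈ (A : Set (Freudenthal o)) → A = node hP hn ⟨e, he⟩ j →
            ∃ j ≤ n, A = node hP hn ⟨e, he⟩ j ∧ (j : ℝ) - 1 < n * t ∧ (n : ℝ) * t < j + 1 := by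
          intro A j hj hA hAj
          refine ⟨j, hj, hAj, (inner_mem_nodeSet he hj).1 ?_⟩
          rw [hAj] at hA
          exact hA
        rintro ⟨C, hC⟩ hA
        rcases hC with ⟨y, rfl⟩ | ⟨e', j, he', hj, hjn, rfl⟩
        · rcases inner_mem_block.1 hA with ⟨h, -⟩ | ⟨h, -⟩ | ⟨h, h'⟩
          · refine aux _ 0 (Nat.zero_le n) hA (Subtype.ext ?_)
            simp only [node, nodeSet_zero, h]
          · refine aux _ n le_rfl hA (Subtype.ext ?_)
            simp only [node, nodeSet_last hn, h]
          · exact absurd (h.trans h'.symm) he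
        · obtain ⟨rfl, -⟩ := inner_mem_piece.1 hA
          refine aux _ j hjn.le hA (Subtype.ext ?_)
          simp only [node, nodeSet_mid _ hj hjn]
      obtain ⟨j, hj, hAj, h₃, h₄⟩ := key A hpA
      obtain ⟨l, hl, hBl, h₅, h₆⟩ := key B hpB
      -- Both indices are less than 1 away from `n * t`, so they differ by at most 1.
      have h₇ : j < l + 2 := by
        have : (j : ℝ) < l + 2 := by linarith
        exact_mod_cast this
      have h₈ : l < j + 2 := by
        have : (l : ℝ) < j + 2 := by linarith
        exact_mod_cast this
      obtain rfl | rfl | rfl : j = l ∨ l = j + 1 ∨ j = l + 1 := by omega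
      · exact Or.inl (hAj.trans hBl.symm)
      · exact Or.inr ⟨⟨e, he⟩, j, by omega, Or.inl ⟨hAj, hBl⟩⟩
      · exact Or.inr ⟨⟨e, he⟩, l, by omega, Or.inr ⟨hAj, hBl⟩⟩

theorem node_inter_node_succ (e : {e // P (o.src e) ≠ P (o.tgt e)}) {j : ℕ} (hj : j < n) :
    ((node hP hn e j : Set (Freudenthal o)) ∩ node hP hn e (j + 1)).Nonempty := by
  have hn' : (0 : ℝ) < n := by exact_mod_cast hn
  have hj' : (j : ℝ) + 1 ≤ n := by exact_mod_cast hj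
  have hj0 : (0 : ℝ) ≤ j := Nat.cast_nonneg j
  have ht : ((j : ℝ) + 1 / 2) / n ∈ Set.Ioo (0 : ℝ) 1 :=
    ⟨by positivity, (div_lt_one hn').2 (by linarith)⟩
  have hmul : (n : ℝ) * (((j : ℝ) + 1 / 2) / n) = j + 1 / 2 := mul_div_cancel₀ _ hn'.ne'
  refine ⟨.inner e ⟨_, ht⟩, (inner_mem_nodeSet e.2 hj.le).2 ?_, (inner_mem_nodeSet e.2 hj).2 ?_⟩
  · simp only [hmul]
    constructor <;> linarith
  · simp only [hmul]
    push_cast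
    constructor <;> linarith

variable (hP hn) in
/-- The 1-simplex between consecutive members of the cover along a cross-edge. -/
noncomputable def nodeSimplex (e : {e // P (o.src e) ≠ P (o.tgt e)}) (j : Fin n) :
    Cech.Simplex (partitionCover hP hn) 1 :=
  Cech.Simplex.pair (node hP hn e j) (node hP hn e (j + 1)) (node_inter_node_succ e j.2)

variable (hP hn) in
/-- The cochain that counts the passages through the `j`-th segment of a cross-edge. -/
noncomputable def nodePassage (e : {e // P (o.src e) ≠ P (o.tgt e)}) (j : ℕ) :
    (partitionCover hP hn).sets → (partitionCover hP hn).sets → ℤ :=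
  Cech.passage (node hP hn e j) (node hP hn e (j + 1))

theorem passage_swap {X : Type*} [TopologicalSpace X] {U : Cech.OpenCover X} (A B C D : U.sets) :
    Cech.passage A B D C = -Cech.passage A B C D := by
  simp [Cech.passage, and_comm]

open Classical in
-- Of two consecutive nodes at least one is a piece, and a piece determines its edge and its index.
-- Blocks are shared by several cross-edges, so without the subdivision parallel edges could not be
-- told apart.
theorem nodePassage_node (h3 : 3 ≤ n) (e e' : {e // P (o.src e) ≠ P (o.tgt e)}) {i j : ℕ}
    (hi : i < n) (hj : j < n) :
    nodePassage hP hn e' i (node hP hn e j) (node hP hn e (j + 1)) =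
      if e = e' ∧ j = i then 1 else 0 := by
  have h₁ : (node hP hn e j = node hP hn e' i ∧ node hP hn e (j + 1) = node hP hn e' (i + 1)) ↔
      e = e' ∧ j = i := by
    refine ⟨fun h => ?_, fun h => by rw [h.1, h.2]; exact ⟨rfl, rfl⟩⟩
    rcases Nat.eq_zero_or_pos i with rfl | hi0
    · obtain ⟨h₁, h₂⟩ := node_eq_node (by omega) (by omega) h.2
      exact ⟨h₁, by omega⟩
    · exact node_eq_node hi0 hi h.1
  have h₂ : ¬ (node hP hn e j = node hP hn e' (i + 1) ∧
      node hP hn e (j + 1) = node hP hn e' i) := by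
    rintro ⟨h, h'⟩
    rcases Nat.eq_zero_or_pos i with rfl | hi0
    · obtain ⟨rfl, rfl⟩ := node_eq_node (by omega) (by omega) h
      have := node_injOn e (by omega) (by omega) h'
      omega
    · obtain ⟨rfl, rfl⟩ := node_eq_node hi0 hi h'
      have := node_injOn e (by omega) (by omega) h
      omega
  simp [nodePassage, Cech.passage, h₁, h₂]

/-- Two antisymmetric cochains on the nerve are equal if they agree along the cross-edges. -/
theorem pairing_eq_of_node {f g : (partitionCover hP hn).sets → (partitionCover hP hn).sets → ℤ}
    (hf : ∀ A B, f B A = -f A B) (hg : ∀ A B, g B A = -g A B)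
    (h : ∀ e, ∀ j < n, f (node hP hn e j) (node hP hn e (j + 1)) =
      g (node hP hn e j) (node hP hn e (j + 1))) : Cech.pairing f = Cech.pairing g := by
  refine Cech.pairing_congr fun A B hAB => ?_
  rcases eq_or_exists_node hAB with rfl | ⟨e, j, hj, ⟨rfl, rfl⟩ | ⟨rfl, rfl⟩⟩
  · have h₁ := hf A A
    have h₂ := hg A A
    omega
  · exact h e j hj
  · rw [hf, hg, h e j hj]

theorem nodePassage_swap (e : {e // P (o.src e) ≠ P (o.tgt e)}) (j : ℕ)
    (A B : (partitionCover hP hn).sets) :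
    nodePassage hP hn e j B A = -nodePassage hP hn e j A B := passage_swap _ _ _ _

/-- A cycle runs equally often through all segments of a cross-edge. -/
theorem pairing_nodePassage (h3 : 3 ≤ n) (e : {e // P (o.src e) ≠ P (o.tgt e)})
    {z : Cech.Chain (partitionCover hP hn) 1} (hz : z ∈ Cech.cycles (partitionCover hP hn))
    {j : ℕ} (hj : j < n) :
    Cech.pairing (nodePassage hP hn e j) z = Cech.pairing (nodePassage hP hn e 0) z := by
  classical
  induction j with
  | zero => rfl
  | succ j ih =>
    rw [← ih (by omega)]
    -- The coboundary of the indicator function of the node between two segments is the difference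
    -- of the two passage cochains.
    let g : (partitionCover hP hn).sets → ℤ := fun A => if A = node hP hn e (j + 1) then 1 else 0
    have h : Cech.pairing (fun A B => nodePassage hP hn e (j + 1) A B + (g B - g A)) =
        Cech.pairing (nodePassage hP hn e j) := by
      refine pairing_eq_of_node (fun A B => ?_) (nodePassage_swap e j) fun e' i hi => ?_
      · rw [nodePassage_swap]
        ring
      · rw [nodePassage_node h3 _ _ hj hi, nodePassage_node h3 _ _ (by omega) hi]
        have hg : ∀ i, g (node hP hn e' i) = if e' = e ∧ i = j + 1 then 1 else 0 := fun i => by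
          have : node hP hn e' i = node hP hn e (j + 1) ↔ e' = e ∧ i = j + 1 :=
            ⟨node_eq_node (by omega) (by omega), fun h => by rw [h.1, h.2]⟩
          simp [g, this]
        rw [hg, hg]
        by_cases he : e' = e
        · simp only [he, true_and]
          split_ifs <;> omega
        · simp [he]
    have h' := LinearMap.congr_fun h z
    rw [Cech.pairing_add, Cech.pairing_coboundary g hz, add_zero] at h'
    exact h'

/-- A cycle that does not run through any cross-edge is a boundary. -/
theorem mem_range_boundary_of_pairing (h3 : 3 ≤ n)
    {z : Cech.Chain (partitionCover hP hn) 1} (hz : z ∈ Cech.cycles (partitionCover hP hn))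
    (h : ∀ e, Cech.pairing (nodePassage hP hn e 0) z = 0) :
    z ∈ LinearMap.range (Cech.boundary (partitionCover hP hn) 1) := by
  -- On a non-degenerate simplex, `z s - z s.swap` is up to sign the net passage through one
  -- segment, hence equal to that through the first segment of the same edge.
  refine Cech.mem_range_boundary_of_symm fun s => ?_
  obtain ⟨x, hx⟩ := s.exists_mem
  rcases eq_or_exists_node (A := s.1 0) (B := s.1 1) ⟨x, hx 0, hx 1⟩ with
    hs | ⟨e, j, hj, ⟨h₀, h₁⟩ | ⟨h₀, h₁⟩⟩
  · rw [show s.swap = s from Cech.Simplex.ext_one hs.symm hs]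
  · have := Cech.pairing_passage (s := s) z
    rw [h₀, h₁] at this
    rw [← sub_eq_zero, ← this]
    exact (pairing_nodePassage h3 e hz hj).trans (h e)
  · have := Cech.pairing_passage (s := s.swap) z
    rw [Cech.Simplex.swap_zero, Cech.Simplex.swap_one, h₀, h₁, Cech.Simplex.swap_swap] at this
    rw [eq_comm, ← sub_eq_zero, ← this]
    exact (pairing_nodePassage h3 e hz hj).trans (h e)

/-- The net number of passages of a cycle into a class of the partition is zero. -/
theorem sum_pairing_nodePassage (h3 : 3 ≤ n) [Fintype {e // P (o.src e) ≠ P (o.tgt e)}]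
    {z : Cech.Chain (partitionCover hP hn) 1} (hz : z ∈ Cech.cycles (partitionCover hP hn))
    (X : Set V(G)) (hX : ∃ x, X = P ⁻¹' {P x}) :
    ∑ e : {e // P (o.src e) ≠ P (o.tgt e)}, Cech.pairing (nodePassage hP hn e 0) z *
      (X.indicator 1 (o.tgt e) - X.indicator 1 (o.src e)) = 0 := by
  classical
  obtain ⟨x, rfl⟩ := hX
  set X := P ⁻¹' {P x}
  -- The coboundary of the indicator function of the block counts entries through last segments and
  -- exits through first segments.
  let g : (partitionCover hP hn).sets → ℤ := fun A => if A.1 = block o P n (P x) then 1 else 0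
  have hg : ∀ e, ∀ i ≤ n, g (node hP hn e i) = (if i = n then X.indicator 1 (o.tgt e) else 0) +
      (if i = 0 then X.indicator 1 (o.src e) else 0) := by
    intro e i hi
    have key : ∀ y, (if block o P n (P y) = block o P n (P x) then (1 : ℤ) else 0) =
        X.indicator 1 y := fun y => by
      have : block o P n (P y) = block o P n (P x) ↔ y ∈ X :=
        ⟨block_injective, fun h => congrArg _ h⟩
      simp [this, Set.indicator_apply]
    rcases Nat.eq_zero_or_pos i with rfl | hi0
    · simp only [g, node, nodeSet_zero, key, hn.ne, if_true, if_false, zero_add]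
    · rcases hi.lt_or_eq with h | rfl
      · simp only [g, node, nodeSet_mid _ hi0 h, block_ne_piece.symm, if_false, h.ne, hi0.ne',
          add_zero]
      · simp only [g, node, nodeSet_last hi0, key, hi0.ne', if_true, if_false, add_zero]
  have h : Cech.pairing (fun A B => ∑ e : {e // P (o.src e) ≠ P (o.tgt e)},
      (X.indicator 1 (o.tgt e) * nodePassage hP hn e (n - 1) A B +
        -X.indicator 1 (o.src e) * nodePassage hP hn e 0 A B)) =
      Cech.pairing (fun A B => g B - g A) := by
    refine pairing_eq_of_node (fun A B => ?_) (fun A B => by ring) fun e i hi => ?_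
    · rw [← Finset.sum_neg_distrib]
      refine Finset.sum_congr rfl fun e _ => ?_
      rw [nodePassage_swap e _ A B, nodePassage_swap e _ A B]
      ring
    · rw [hg e _ hi.le, hg e _ hi, Finset.sum_eq_single e, nodePassage_node h3 _ _ (by omega) hi,
        nodePassage_node h3 _ _ hn hi]
      · have h₁ : i + 1 = n ↔ i = n - 1 := by omega
        simp only [h₁, true_and, hi.ne, Nat.succ_ne_zero, if_false]
        split_ifs <;> ring
      · intro e' _ hne
        rw [nodePassage_node h3 _ _ (by omega) hi, nodePassage_node h3 _ _ hn hi]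
        simp [hne.symm]
      · simp
  have h' := LinearMap.congr_fun h z
  rw [Cech.pairing_coboundary g hz, Cech.pairing_sum] at h'
  rw [← h']
  refine Finset.sum_congr rfl fun e _ => ?_
  rw [Cech.pairing_add, Cech.pairing_smul, Cech.pairing_smul,
    pairing_nodePassage h3 e hz (by omega : n - 1 < n)]
  ring

variable (hP hn) in
/-- The 1-chain that runs `φ e` times through every cross-edge `e`. -/
noncomputable def flowChain [Fintype {e // P (o.src e) ≠ P (o.tgt e)}] (φ : E(G) → ℤ) :
    Cech.Chain (partitionCover hP hn) 1 :=
  ∑ e : {e // P (o.src e) ≠ P (o.tgt e)}, φ e •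
    ∑ j : Fin n, Finsupp.single (nodeSimplex hP hn e j) (1 : ℤ)

/-- The boundary telescopes along each cross-edge, so nothing is left at a piece. At a block there
remains the net flow across the cut around its class, a finite cut. -/
theorem flowChain_mem_cycles [Fintype {e // P (o.src e) ≠ P (o.tgt e)}] {φ : E(G) → ℤ}
    (hφ : IsFlow o φ) : flowChain hP hn φ ∈ Cech.cycles (partitionCover hP hn) := by
  classical
  rw [LinearMap.mem_ker]
  ext s
  let f : ℕ → {e // P (o.src e) ≠ P (o.tgt e)} → ℤ := fun j e =>
    if node hP hn e j = s.1 0 then 1 else 0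
  have hface : ∀ e (j : Fin n), Cech.boundary (partitionCover hP hn) 0
      (Finsupp.single (nodeSimplex hP hn e j) 1) s = f (j + 1) e - f j e := by
    intro e j
    have h₀ : (nodeSimplex hP hn e j).face 0 = s ↔ node hP hn e (j + 1) = s.1 0 :=
      ⟨fun h => by rw [← h]; rfl, fun h => Cech.Simplex.ext_zero h⟩
    have h₁ : (nodeSimplex hP hn e j).face 1 = s ↔ node hP hn e j = s.1 0 :=
      ⟨fun h => by rw [← h]; rfl, fun h => Cech.Simplex.ext_zero h⟩
    rw [Cech.boundary_single_one, one_smul, Finsupp.sub_apply, Finsupp.single_apply,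
      Finsupp.single_apply]
    simp only [h₀, h₁, f]
  let X : Set V(G) := {x | block o P n (P x) = s.1 0}
  have hX : ∀ x, X.indicator (1 : V(G) → ℤ) x =
      if block o P n (P x) = s.1 0 then 1 else 0 := fun x => by
    simp [X, Set.indicator_apply]
  have hval : ∀ e : {e // P (o.src e) ≠ P (o.tgt e)},
      ∑ j : Fin n, (f (j + 1) e - f j e) = X.indicator 1 (o.tgt e) - X.indicator 1 (o.src e) := by
    intro e
    rw [Fin.sum_univ_eq_sum_range (fun j => f (j + 1) e - f j e) n,
      Finset.sum_range_sub (fun j => f j e)]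
    simp only [f, hX, Subtype.ext_iff, node, nodeSet_zero, nodeSet_last hn]
  have hflow := hφ X (Finset.univ.map (Function.Embedding.subtype fun e =>
    P (o.src e) ≠ P (o.tgt e))) (fun e he => by
      have : P (o.src e) ≠ P (o.tgt e) := fun h => he (by simp [X, h])
      simpa using this)
  rw [Finset.sum_map] at hflow
  rw [flowChain, map_sum, Finsupp.finsetSum_apply, Finsupp.zero_apply, ← hflow]
  refine Finset.sum_congr rfl fun e _ => ?_
  rw [map_smul, map_sum, Finsupp.smul_apply, Finsupp.finsetSum_apply,
    Finset.sum_congr rfl fun j _ => hface e j, hval, smul_eq_mul]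
  rfl

theorem pairing_flowChain [Fintype {e // P (o.src e) ≠ P (o.tgt e)}] (h3 : 3 ≤ n)
    (φ : E(G) → ℤ) (e : {e // P (o.src e) ≠ P (o.tgt e)}) :
    Cech.pairing (nodePassage hP hn e 0) (flowChain hP hn φ) = φ e := by
  classical
  have h : ∀ e' (j : Fin n), Cech.pairing (nodePassage hP hn e 0)
      (Finsupp.single (nodeSimplex hP hn e' j) 1) = if e' = e ∧ (j : ℕ) = 0 then 1 else 0 := by
    intro e' j
    rw [Cech.pairing_single, one_mul]
    exact nodePassage_node h3 _ _ hn j.2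
  rw [flowChain, map_sum, Finset.sum_eq_single e]
  · rw [map_smul, map_sum, Finset.sum_congr rfl fun j _ => h e j,
      Finset.sum_eq_single (⟨0, hn⟩ : Fin n)]
    · simp
    · intro j _ hj
      have : (j : ℕ) ≠ 0 := fun h => hj (Fin.ext h)
      simp [this]
    · simp
  · intro e' _ hne
    rw [map_smul, map_sum, Finset.sum_congr rfl fun j _ => h e' j]
    simp [hne]
  · simp

end

end EndGraph

/-! ### Coefficients of Čech classes at edges -/

namespace EndGraph

open scoped Graph

universe u v w

variable {α : Type u} {β : Type v} {G : Graph α β}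

section

variable (o : Direction G)

/-- The initial part of an edge as a member of its cover. -/
def initialMem (e : E(G)) : (edgeCover o e).sets := ⟨initialPart o e, Or.inr (Or.inl rfl)⟩

/-- The terminal part of an edge as a member of its cover. -/
def terminalMem (e : E(G)) : (edgeCover o e).sets := ⟨terminalPart o e, Or.inr (Or.inr rfl)⟩

/-- The outer part of an edge as a member of its cover. -/
def outerMem (e : E(G)) : (edgeCover o e).sets := ⟨outerPart o e, Or.inl rfl⟩

variable {o}

theorem inner_mem_initialPart {e e' : E(G)} {t : Set.Ioo (0 : ℝ) 1} :
    Freudenthal.inner e' t ∈ initialPart o e ↔ e' = e ∧ (t : ℝ) < 2 / 3 := by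
  constructor
  · rintro ⟨s, hs, h⟩
    cases h
    exact ⟨rfl, hs⟩
  · rintro ⟨rfl, h⟩
    exact ⟨t, h, rfl⟩

theorem inner_mem_terminalPart {e e' : E(G)} {t : Set.Ioo (0 : ℝ) 1} :
    Freudenthal.inner e' t ∈ terminalPart o e ↔ e' = e ∧ 1 / 3 < (t : ℝ) := by
  constructor
  · rintro ⟨s, hs, h⟩
    cases h
    exact ⟨rfl, hs⟩
  · rintro ⟨rfl, h⟩
    exact ⟨t, h, rfl⟩

theorem vertex_mem_outerPart (e : E(G)) (x : V(G)) : Freudenthal.vertex x ∈ outerPart o e := by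
  rintro ⟨s, hs, h⟩
  cases h

theorem inner_notMem_outerPart {e : E(G)} {t : Set.Ioo (0 : ℝ) 1} (h₁ : 1 / 3 ≤ (t : ℝ))
    (h₂ : (t : ℝ) ≤ 2 / 3) : Freudenthal.inner e t ∉ outerPart o e :=
  fun h => h ⟨t, ⟨h₁, h₂⟩, rfl⟩

theorem initialMem_ne_terminalMem (e : E(G)) : initialMem o e ≠ terminalMem o e := by
  intro h
  have h' : initialPart o e = terminalPart o e := congrArg Subtype.val h
  have : Freudenthal.inner e ⟨1 / 6, by norm_num, by norm_num⟩ ∈ initialPart o e :=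
    inner_mem_initialPart.2 ⟨rfl, by norm_num⟩
  rw [h', inner_mem_terminalPart] at this
  norm_num at this

theorem outerMem_ne_initialMem (e : E(G)) : outerMem o e ≠ initialMem o e := by
  intro h
  have h' : outerPart o e = initialPart o e := congrArg Subtype.val h
  have := vertex_mem_outerPart (o := o) e (o.src e)
  rw [h'] at this
  obtain ⟨s, -, hs⟩ := this
  cases hs

theorem outerMem_ne_terminalMem (e : E(G)) : outerMem o e ≠ terminalMem o e := by
  intro h
  have h' : outerPart o e = terminalPart o e := congrArg Subtype.val h
  have := vertex_mem_outerPart (o := o) e (o.src e)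
  rw [h'] at this
  obtain ⟨s, -, hs⟩ := this
  cases hs

/-- The initial and terminal parts overlap only within the middle third, which the outer part
misses. -/
theorem isCocycle_edgePassage (e : E(G)) :
    Cech.IsCocycle (Cech.passage (initialMem o e) (terminalMem o e)) := by
  refine Cech.isCocycle_passage ?_
  rintro ⟨C, rfl | rfl | rfl⟩ ⟨p, ⟨⟨t, ht, rfl⟩, hT⟩, hC⟩
  · exact absurd hC (inner_notMem_outerPart (inner_mem_terminalPart.1 hT).2.le (le_of_lt ht))
  · exact Or.inl rfl
  · exact Or.inr rfl

/-- The coefficient of a Čech class at an edge, as a homomorphism on the homology of the nerve of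
the cover belonging to the edge. -/
noncomputable def edgeCoeff (e : E(G)) : Cech.NerveH1 (edgeCover o e) →ₗ[ℤ] ℤ :=
  (isCocycle_edgePassage e).onH1

theorem edgeCoeff_mk (e : E(G)) (z : Cech.cycles (edgeCover o e)) :
    edgeCoeff e (Submodule.Quotient.mk z) =
      (z : Cech.Chain (edgeCover o e) 1) (forwardSimplex o e) -
        (z : Cech.Chain (edgeCover o e) 1) (backwardSimplex o e) := by
  have h := Cech.pairing_passage (s := forwardSimplex o e) (z : Cech.Chain (edgeCover o e) 1)
  rw [show (forwardSimplex o e).swap = backwardSimplex o e from Cech.Simplex.ext_one rfl rfl] at h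
  exact h

variable (o) in
/-- The coefficients of a Čech class at the edges. -/
noncomputable def coeff : Cech.H1 (Freudenthal o) →+ (E(G) → ℤ) where
  toFun c e := edgeCoeff e (c.1 (edgeCover o e))
  map_zero' := by
    funext e
    exact map_zero (edgeCoeff e)
  map_add' c d := by
    funext e
    exact map_add (edgeCoeff e) _ _

/-- The passage count is a cocycle, so it takes the same value on all representing cycles, and there
is at least one such cycle. Hence the coefficient exists and is unique. -/
theorem isCoeff_iff {c : Cech.H1 (Freudenthal o)} {e : E(G)} {k : ℤ} :
    IsCoeff o c e k ↔ k = coeff o c e := by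
  constructor
  · intro h
    obtain ⟨z, hz⟩ := Submodule.Quotient.mk_surjective _ (c.1 (edgeCover o e))
    rw [h z hz]
    exact (edgeCoeff_mk e z).symm.trans (congrArg (edgeCoeff e) hz)
  · rintro rfl z hz
    exact (congrArg (edgeCoeff e) hz.symm).trans (edgeCoeff_mk e z)

variable {ι : Type w} {P : V(G) → ι} {hP : {e | P (o.src e) ≠ P (o.tgt e)}.Finite} {m : ℕ}
  {hm : 0 < 3 * m}

/-- Send the nodes `1, …, m` of the edge to its initial part, the nodes `m + 1, …, 3 * m - 1` to its
terminal part, and everything else to the outer part. With `3 * m` segments the intervals fit into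
the thirds, and only the segment from node `m` to node `m + 1` runs from the initial to the terminal
part. -/
theorem exists_refinement_edgeCover (e : {e // P (o.src e) ≠ P (o.tgt e)}) :
    ∃ r : Cech.Refinement (partitionCover hP hm) (edgeCover o e),
      Cech.pairing (fun A B => Cech.passage (initialMem o e.1) (terminalMem o e.1)
        (r.proj A) (r.proj B)) = Cech.pairing (nodePassage hP hm e m) := by
  classical
  have hm' : 0 < m := by omega
  have hm1 : (1 : ℝ) ≤ m := by exact_mod_cast hm'
  have hcast : ((3 * m : ℕ) : ℝ) = 3 * m := by push_cast; ring
  let f : (partitionCover hP hm).sets → (edgeCover o e).sets := fun A =>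
    if ∃ i, 0 < i ∧ i ≤ m ∧ A = node hP hm e i then initialMem o e.1 else
      if ∃ i, m < i ∧ i < 3 * m ∧ A = node hP hm e i then terminalMem o e.1 else outerMem o e.1
  have hf : ∀ e' j, f (node hP hm e' j) = if e' = e ∧ 0 < j ∧ j ≤ m then initialMem o e.1 else
      if e' = e ∧ m < j ∧ j < 3 * m then terminalMem o e.1 else outerMem o e.1 := by
    intro e' j
    have h₁ : (∃ i, 0 < i ∧ i ≤ m ∧ node hP hm e' j = node hP hm e i) ↔
        e' = e ∧ 0 < j ∧ j ≤ m := by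
      constructor
      · rintro ⟨i, h₁, h₂, h⟩
        obtain ⟨rfl, rfl⟩ := node_eq_node h₁ (by omega) h
        exact ⟨rfl, h₁, h₂⟩
      · rintro ⟨rfl, h₁, h₂⟩
        exact ⟨j, h₁, h₂, rfl⟩
    have h₂ : (∃ i, m < i ∧ i < 3 * m ∧ node hP hm e' j = node hP hm e i) ↔
        e' = e ∧ m < j ∧ j < 3 * m := by
      constructor
      · rintro ⟨i, h₁, h₂, h⟩
        obtain ⟨rfl, rfl⟩ := node_eq_node (by omega) h₂ h
        exact ⟨rfl, h₁, h₂⟩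
      · rintro ⟨rfl, h₁, h₂⟩
        exact ⟨j, h₁, h₂, rfl⟩
    simp only [f, h₁, h₂]
  refine ⟨⟨f, fun A => ?_⟩, ?_⟩
  · simp only [f]
    split_ifs with h₁ h₂
    · obtain ⟨i, hi0, him, rfl⟩ := h₁
      change nodeSet o P (3 * m) e.1 i ⊆ initialPart o e.1
      rw [nodeSet_mid _ hi0 (by omega)]
      rintro _ ⟨t, ht, rfl⟩
      refine inner_mem_initialPart.2 ⟨rfl, ?_⟩
      have h₁ : (i : ℝ) ≤ m := by exact_mod_cast him
      have h₂ := ht.2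
      rw [hcast] at h₂
      by_contra! h
      nlinarith
    · obtain ⟨i, hi0, him, rfl⟩ := h₂
      change nodeSet o P (3 * m) e.1 i ⊆ terminalPart o e.1
      rw [nodeSet_mid _ (by omega) him]
      rintro _ ⟨t, ht, rfl⟩
      refine inner_mem_terminalPart.2 ⟨rfl, ?_⟩
      have h₁ : (m : ℝ) + 1 ≤ i := by exact_mod_cast hi0
      have h₂ := ht.1
      rw [hcast] at h₂
      by_contra! h
      nlinarith
    · rintro p hp ⟨t, ⟨ht₁, ht₂⟩, rfl⟩
      obtain ⟨A, hA⟩ := A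
      rcases hA with ⟨x, rfl⟩ | ⟨e', i, he', hi0, hi, rfl⟩
      · rcases inner_mem_block.1 hp with ⟨-, h⟩ | ⟨-, h⟩ | ⟨h, h'⟩
        · rw [hcast] at h
          nlinarith
        · rw [hcast] at h
          nlinarith
        · exact e.2 (h.trans h'.symm)
      · obtain ⟨h, -⟩ := inner_mem_piece.1 hp
        subst h
        have hA : (⟨piece o (3 * m) e i, Or.inr ⟨e, i, he', hi0, hi, rfl⟩⟩ :
            (partitionCover hP hm).sets) = node hP hm e i :=
          Subtype.ext (nodeSet_mid _ hi0 hi).symm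
        rcases le_or_gt i m with him | him
        · exact h₁ ⟨i, hi0, him, hA⟩
        · exact h₂ ⟨i, him, hi, hA⟩
  · have hIT := initialMem_ne_terminalMem (o := o) e.1
    have hOI := outerMem_ne_initialMem (o := o) e.1
    have hOT := outerMem_ne_terminalMem (o := o) e.1
    refine pairing_eq_of_node (fun A B => passage_swap _ _ _ _) (nodePassage_swap e m)
      fun e' j hj => ?_
    rw [nodePassage_node (by omega) _ _ (by omega) hj]
    change Cech.passage _ _ (f _) (f _) = _
    rw [hf, hf]
    by_cases he : e' = e
    · simp only [he, true_and, Nat.succ_pos]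
      by_cases hjm : j = m
      · subst hjm
        have h₁ : ¬ (j + 1 ≤ j) := by omega
        have h₂ : j < j + 1 ∧ j + 1 < 3 * j := by omega
        simp [Cech.passage, hm', h₁, h₂, hIT]
      · rw [if_neg hjm]
        rcases lt_or_gt_of_ne hjm with h | h
        · have h₁ : j + 1 ≤ m := h
          have h₂ : ¬ m < j := by omega
          rcases Nat.eq_zero_or_pos j with rfl | h0
          · simp [Cech.passage, h₁, hIT, hOI, hOT]
          · simp [Cech.passage, h₁, h0, h.le, hIT]
        · have h₁ : ¬ j ≤ m := by omega
          have h₂ : ¬ j + 1 ≤ m := by omega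
          have h₃ : m < j + 1 := by omega
          by_cases h₄ : j + 1 < 3 * m
          · simp [Cech.passage, h₁, h₂, h₃, h, hj, h₄, hIT.symm]
          · simp [Cech.passage, h₁, h₂, h, hj, h₄, hOI, hOT, hIT.symm]
    · simp [he, Cech.passage, hOI]

/-- The coefficient of a class at a cross-edge can be read off from the nerve of any cover given by
a partition. -/
theorem edgeCoeff_mapH1_mk (e : {e // P (o.src e) ≠ P (o.tgt e)})
    (r : Cech.Refinement (partitionCover hP hm) (edgeCover o e))
    (z : Cech.cycles (partitionCover hP hm)) :
    edgeCoeff e.1 (r.mapH1 (Submodule.Quotient.mk z)) =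
      Cech.pairing (nodePassage hP hm e 0) z := by
  obtain ⟨s, hs⟩ := exists_refinement_edgeCover (hP := hP) (hm := hm) e
  -- The given projection may be replaced by the explicit one. It counts passages through segment
  -- `m`, which on cycles agrees with segment 0.
  rw [r.mapH1_eq s, edgeCoeff, Cech.IsCocycle.onH1_mapH1, hs]
  exact pairing_nodePassage (by omega) e z.2 (by omega)

/-- The passages of a representing cycle through the cross-edges are its edge coefficients, and a
cycle without net passages bounds. -/
theorem eq_zero_of_edgeCoeff {x : Cech.NerveH1 (partitionCover hP hm)}
    (h : ∀ (e : {e // P (o.src e) ≠ P (o.tgt e)})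
      (r : Cech.Refinement (partitionCover hP hm) (edgeCover o e)),
      edgeCoeff e.1 (r.mapH1 x) = 0) : x = 0 := by
  obtain ⟨z, rfl⟩ := Submodule.Quotient.mk_surjective _ x
  refine (Submodule.Quotient.mk_eq_zero _).2 ?_
  refine mem_range_boundary_of_pairing (by omega) z.2 fun e => ?_
  obtain ⟨r, -⟩ := exists_refinement_edgeCover (hP := hP) (hm := hm) e
  exact (edgeCoeff_mapH1_mk e r z).symm.trans (h e r)

/-- An edge whose cover is refined by the cover belonging to a partition is a cross-edge. -/
theorem ne_of_refinement {e : E(G)} (r : Cech.Refinement (partitionCover hP hm) (edgeCover o e)) :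
    P (o.src e) ≠ P (o.tgt e) := by
  intro h
  have hsub := r.subset_proj ⟨block o P (3 * m) (P (o.src e)), block_mem _⟩
  have h₁ := hsub (vertex_mem_block.2 rfl : Freudenthal.vertex (o.src e) ∈ _)
  have h₂ := hsub (inner_mem_block.2 (Or.inr (Or.inr ⟨rfl, h.symm⟩)) :
    Freudenthal.inner e ⟨1 / 2, by norm_num, by norm_num⟩ ∈ _)
  -- No member of `edgeCover o e` contains both a vertex and the midpoint of `e`, but a block
  -- containing both endvertices of `e` does.
  have key : ∀ B : (edgeCover o e).sets, Freudenthal.vertex (o.src e) ∈ (B : Set (Freudenthal o)) →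
      Freudenthal.inner e ⟨1 / 2, by norm_num, by norm_num⟩ ∈ (B : Set (Freudenthal o)) →
      False := by
    rintro ⟨B, rfl | rfl | rfl⟩ h₁ h₂
    · exact inner_notMem_outerPart (by norm_num) (by norm_num) h₂
    · obtain ⟨s, -, hs⟩ := h₁
      cases hs
    · obtain ⟨s, -, hs⟩ := h₁
      cases hs
  exact key _ h₁ h₂

/-- The coefficients of a Čech class form a flow. -/
theorem isFlow_coeff (c : Cech.H1 (Freudenthal o)) : IsFlow o (coeff o c) := by
  classical
  intro X F hF
  rcases X.eq_empty_or_nonempty with rfl | ⟨x, hx⟩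
  · simp
  -- For the partition into `X` and its complement the cross-edges form the given cut. Since `X` is
  -- non-empty it is one of the classes, and the balance at its block is the cut condition.
  let P : V(G) → Prop := (· ∈ X)
  have hP : {e | P (o.src e) ≠ P (o.tgt e)}.Finite := F.finite_toSet.subset fun e he => hF e he
  let _ : Fintype {e // P (o.src e) ≠ P (o.tgt e)} := hP.fintype
  obtain ⟨z, hz⟩ := Submodule.Quotient.mk_surjective _
    (c.1 (partitionCover hP (by norm_num : 0 < 3 * 1)))
  have hX : X = P ⁻¹' {P x} := by
    ext y
    have : P x = True := eq_true hx
    simp [this, P]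
  have h := sum_pairing_nodePassage (by norm_num) z.2 X ⟨x, hX⟩
  have hcoeff : ∀ e : {e // P (o.src e) ≠ P (o.tgt e)},
      coeff o c e = Cech.pairing (nodePassage hP (by norm_num : 0 < 3 * 1) e 0) z := fun e => by
    obtain ⟨r, -⟩ := exists_refinement_edgeCover (hP := hP) (hm := (by norm_num : 0 < 3 * 1)) e
    rw [← edgeCoeff_mapH1_mk e r, hz, c.2 _ _ r]
    rfl
  have hsub : Finset.univ.map (Function.Embedding.subtype fun e => P (o.src e) ≠ P (o.tgt e)) ⊆ F := by
    intro e he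
    obtain ⟨e, -, rfl⟩ := Finset.mem_map.1 he
    exact hF _ e.2
  rw [← Finset.sum_subset hsub, Finset.sum_map, ← h]
  · exact Finset.sum_congr rfl fun e _ => by rw [← hcoeff e]; rfl
  · intro e _ he
    have he' : (o.src e ∈ X) = (o.tgt e ∈ X) := by
      by_contra hne
      exact he (Finset.mem_map.2 ⟨⟨e, hne⟩, Finset.mem_univ _, rfl⟩)
    simp [Set.indicator, he']

end

end EndGraph

/-! ### Geodesics and König's lemma -/

section

variable {V : Type*} {H : SimpleGraph V}

theorem SimpleGraph.Connected.exists_adj_dist_succ (hH : H.Connected) {v w : V} (h : v ≠ w) :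
    ∃ v', H.Adj v v' ∧ H.dist v w = H.dist v' w + 1 := by
  obtain ⟨p, hp⟩ := hH.exists_walk_length_eq_dist v w
  cases p with
  | nil => exact absurd rfl h
  | @cons _ x _ hadj q =>
    refine ⟨x, hadj, ?_⟩
    have h₁ := SimpleGraph.dist_le q
    have h₂ := hH.dist_triangle (u := v) (v := x) (w := w)
    have h₃ := SimpleGraph.dist_eq_one_iff_adj.2 hadj
    rw [SimpleGraph.Walk.length_cons] at hp
    omega

/-- One step along a geodesic from `v` to `w`, when `v` is on a geodesic from `r` to `w`. -/
theorem SimpleGraph.Connected.exists_adj_of_dist_eq_add (hH : H.Connected) {r v w : V}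
    (h : v ≠ w) (hd : H.dist r w = H.dist r v + H.dist v w) :
    ∃ v', H.Adj v v' ∧ H.dist r v' = H.dist r v + 1 ∧ H.dist v w = H.dist v' w + 1 := by
  obtain ⟨v', hadj, hv'⟩ := hH.exists_adj_dist_succ h
  have h₁ := hH.dist_triangle (u := r) (v := v') (w := w)
  have h₂ := hH.dist_triangle (u := r) (v := v) (w := v')
  have h₃ := SimpleGraph.dist_eq_one_iff_adj.2 hadj
  exact ⟨v', hadj, by omega, hv'⟩

/-- A form of König's infinity lemma: if in a locally finite connected graph there are bad vertices
at arbitrarily large distance from `r`, some geodesic ray from `r` is, at every vertex, an initial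
part of geodesics to bad vertices of all levels. -/
theorem SimpleGraph.Connected.exists_geodesic_ray (hH : H.Connected)
    (hfin : ∀ v, (H.neighborSet v).Finite) (r : V) {Bad : ℕ → V → Prop} (hanti : Antitone Bad)
    (hex : ∀ m, ∃ w, Bad m w) (hbad : ∀ m w, Bad m w → m < H.dist r w) :
    ∃ v : ℕ → V, ∀ n, H.Adj (v n) (v (n + 1)) ∧ H.dist r (v n) = n ∧
      ∀ m, ∃ w, Bad m w ∧ H.dist r w = H.dist r (v n) + H.dist (v n) w := by
  let Good : V → Prop := fun v => ∀ m, ∃ w, Bad m w ∧ H.dist r w = H.dist r v + H.dist v w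
  have hstep : ∀ v, Good v → ∃ v', H.Adj v v' ∧ H.dist r v' = H.dist r v + 1 ∧ Good v' := by
    intro v hv
    have h₁ : ∀ m, ∃ v' ∈ H.neighborSet v, H.dist r v' = H.dist r v + 1 ∧
        ∃ w, Bad m w ∧ H.dist r w = H.dist r v' + H.dist v' w := by
      intro m
      -- The level is taken at least the distance of `v`, so that `w` lies strictly beyond `v` and a
      -- next vertex exists.
      obtain ⟨w, hw, hd⟩ := hv (max m (H.dist r v))
      have hne : v ≠ w := by
        rintro rfl
        exact absurd (hbad _ _ hw) (not_lt.2 (le_max_right _ _))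
      obtain ⟨v', hadj, h₂, h₃⟩ := hH.exists_adj_of_dist_eq_add hne hd
      exact ⟨v', hadj, h₂, w, hanti (le_max_left _ _) _ hw, by omega⟩
    by_contra! hcon
    have h₂ : ∀ v' ∈ H.neighborSet v, H.dist r v' = H.dist r v + 1 →
        ∃ m, ¬∃ w, Bad m w ∧ H.dist r w = H.dist r v' + H.dist v' w := fun v' hv' hd =>
      not_forall.1 (hcon v' hv' hd)
    choose! f hf using h₂
    -- If each of the finitely many candidates failed at some level, then by monotonicity all of
    -- them would fail at the common bound `M`.
    obtain ⟨M, hM⟩ := ((hfin v).image f).bddAbove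
    obtain ⟨v', hv', hd, w, hw, hdw⟩ := h₁ M
    exact hf v' hv' hd ⟨w, hanti (hM ⟨v', hv', rfl⟩) _ hw, hdw⟩
  choose! f hf using hstep
  have hr : Good r := fun m => (hex m).imp fun w hw => ⟨hw, by simp⟩
  have hgood : ∀ n, Good (f^[n] r) := by
    intro n
    induction n with
    | zero => exact hr
    | succ n ih =>
      rw [Function.iterate_succ_apply']
      exact (hf _ ih).2.2
  refine ⟨fun n => f^[n] r, fun n => ⟨?_, ?_, hgood n⟩⟩
  · simp only [Function.iterate_succ_apply']
    exact (hf _ (hgood n)).1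
  · induction n with
    | zero => simp
    | succ n ih =>
      simp only [Function.iterate_succ_apply']
      rw [(hf _ (hgood n)).2.1, ih]

end

/-! ### Compactness: open covers control all components outside a finite set -/

namespace EndGraph

open scoped Graph

universe u v

variable {α : Type u} {β : Type v} {G : Graph α β}

section

variable {o : Direction G}

theorem LocallyFinite.finite_neighborSet [G.Loopless] (hfin : LocallyFinite G) (o : Direction G)
    (v : V(G)) : (G.toSimpleGraph.neighborSet v).Finite := by
  refine (finite_walk_length hfin o 1 v).subset fun w hw => ?_
  exact ⟨SimpleGraph.Walk.cons hw .nil, rfl⟩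

theorem LocallyFinite.exists_distBall [G.Loopless] (hconn : G.toSimpleGraph.Connected)
    (hfin : LocallyFinite G) (o : Direction G) (r : V(G)) :
    ∃ B : ℕ → Finset V(G), ∀ m x, x ∈ B m ↔ G.toSimpleGraph.dist r x ≤ m := by
  have h : ∀ m : ℕ, {x | G.toSimpleGraph.dist r x ≤ m}.Finite := by
    intro m
    refine ((Set.finite_Iic m).biUnion fun n _ => finite_walk_length hfin o n r).subset
      fun x hx => ?_
    obtain ⟨p, hp⟩ := hconn.exists_walk_length_eq_dist r x
    exact Set.mem_biUnion (x := G.toSimpleGraph.dist r x) hx ⟨p, hp⟩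
  exact ⟨fun m => (h m).toFinset, fun m x => by simp⟩

/-- For every open cover of `|G|` some finite set of vertices leaves only components `C` for which
`Ĉ` is contained in a member of the cover. -/
theorem exists_finset_hat_subset [G.Loopless] (hconn : G.toSimpleGraph.Connected)
    (hfin : LocallyFinite G) (U : Cech.OpenCover (Freudenthal o)) :
    ∃ S : Finset V(G), ∀ C : G.toSimpleGraph.ComponentCompl (S : Set V(G)),
      ∃ A ∈ U.sets, hat o C ⊆ A := by
  classical
  by_contra! hcon
  obtain ⟨r⟩ := hconn.nonempty
  obtain ⟨B, hB⟩ := hfin.exists_distBall hconn o r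
  -- If the claim fails for every ball around `r`, then outside each ball there is a vertex whose
  -- component has `Ĉ` in no member of the cover. Larger balls leave smaller components, so badness
  -- at one level implies it at all lower levels.
  let Bad : ℕ → V(G) → Prop := fun m w => ∃ h : w ∉ (B m : Set V(G)),
    ∀ A ∈ U.sets, ¬ hat o (G.toSimpleGraph.componentComplMk h) ⊆ A
  have hBmono : ∀ {m n}, m ≤ n → B m ⊆ B n := fun hmn x hx =>
    (hB _ x).2 (((hB _ x).1 hx).trans hmn)
  have hanti : Antitone Bad := by
    rintro m n hmn w ⟨h, hw⟩
    have h' : w ∉ (B m : Set V(G)) := fun hm => h (hBmono hmn hm)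
    refine ⟨h', fun A hA hsub => hw A hA (Set.Subset.trans (hat_mono ?_) hsub)⟩
    have hle := SimpleGraph.ComponentCompl.subset_hom (G.toSimpleGraph.componentComplMk h)
      (Finset.coe_subset.2 (hBmono hmn))
    exact fun x hx => hle hx
  have hex : ∀ m, ∃ w, Bad m w := fun m => by
    obtain ⟨C, hC⟩ := hcon (B m)
    obtain ⟨w, hw, rfl⟩ := C.exists_eq_mk
    exact ⟨w, hw, hC⟩
  have hbad : ∀ m w, Bad m w → m < G.toSimpleGraph.dist r w := fun m w hw =>
    not_le.1 fun h => hw.1 ((hB m w).2 h)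
  obtain ⟨v, hv⟩ := hconn.exists_geodesic_ray (hfin.finite_neighborSet o) r hanti hex hbad
  have hinj : Function.Injective v := fun a b h => by
    rw [← (hv a).2.1, ← (hv b).2.1, h]
  let R : Ray G := ⟨v, hinj, fun n => (hv n).1.2⟩
  obtain ⟨A, hA, hωA⟩ := Set.mem_sUnion.1
    (U.sUnion_eq.symm ▸ Set.mem_univ (Freudenthal.ofEnd (o := o) (Quotient.mk (raySetoid G) R)))
  obtain ⟨S, C, hC, hCA⟩ := exists_hat_subset (U.isOpen_of_mem A hA) hωA
  obtain ⟨m, hm⟩ : ∃ m, S ⊆ B m := by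
    obtain ⟨m, hm⟩ := (S.image (G.toSimpleGraph.dist r)).finite_toSet.bddAbove
    exact ⟨m, fun x hx => (hB m x).2 (hm (Finset.mem_coe.2 (Finset.mem_image_of_mem _ hx)))⟩
  obtain ⟨w, ⟨hw, hwA⟩, hdw⟩ := (hv (m + 1)).2.2 m
  -- Starting outside the ball and moving towards `w` away from `r`, a geodesic never re-enters the
  -- ball; so its vertices lie in the component of `w`.
  have hgeo : ∀ k x, G.toSimpleGraph.dist x w = k → m < G.toSimpleGraph.dist r x →
      G.toSimpleGraph.dist r w = G.toSimpleGraph.dist r x + k →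
      x ∈ G.toSimpleGraph.componentComplMk hw := by
    intro k
    induction k with
    | zero =>
      intro x hx _ _
      rw [(hconn.dist_eq_zero_iff).1 hx]
      exact SimpleGraph.componentComplMk_mem _ _
    | succ k ih =>
      intro x hx hmx hd
      have hne : x ≠ w := by
        rintro rfl
        simp at hx
      obtain ⟨x', hadj, h₁, h₂⟩ := hconn.exists_adj_of_dist_eq_add hne (hx.symm ▸ hd)
      exact SimpleGraph.ComponentCompl.mem_of_adj x' x (ih x' (by omega) (by omega) (by omega))
        (fun h => absurd ((hB m x).1 h) (by omega)) hadj.symm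
  have htail : R.TailIn (G.toSimpleGraph.componentComplMk hw) := by
    refine ⟨m + 1, fun n hn => ?_⟩
    induction n, hn using Nat.le_induction with
    | base => exact hgeo _ _ rfl (by rw [(hv (m + 1)).2.1]; omega) hdw
    | succ n hn ih =>
      refine SimpleGraph.ComponentCompl.mem_of_adj _ _ ih (fun h => ?_) (hv n).1
      have h' := (hB m _).1 h
      rw [show R.vert (n + 1) = v (n + 1) from rfl, (hv (n + 1)).2.1] at h'
      omega
  -- The component of `w` is therefore the one in which the end of the ray lives. It lies inside
  -- `C`, so its `Ĉ` is contained in `A`, although `w` is bad.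
  obtain ⟨D, hD⟩ := Ends.exists_livesIn (Quotient.mk (raySetoid G) R) (B m)
  have hDw := (hD R rfl).unique htail
  subst hDw
  exact hwA A hA ((hat_mono (hD.subset hm hC)).trans hCA)

end

end EndGraph

/-! ### Cofinality of the partition covers; Čech classes are flows -/

namespace EndGraph

open scoped Graph

universe u v

variable {α : Type u} {β : Type v} {G : Graph α β}

section

variable {o : Direction G}

open Filter in
/-- All sufficiently fine regular subdivisions of an edge are compatible with an open cover. -/
theorem eventually_subdivision (U : Cech.OpenCover (Freudenthal o)) {A : V(G) → Set (Freudenthal o)}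
    (hAU : ∀ x, A x ∈ U.sets) (hA : ∀ x, Freudenthal.vertex x ∈ A x) (e : E(G)) :
    ∀ᶠ n : ℕ in atTop, (∀ t : unitInterval, (n : ℝ) * t < 1 → edgeMap o e t ∈ A (o.src e)) ∧
      (∀ t : unitInterval, (n : ℝ) - n * t < 1 → edgeMap o e t ∈ A (o.tgt e)) ∧
      ∀ j : ℕ, ∃ B ∈ U.sets, ∀ t : unitInterval, (j : ℝ) - 1 < n * t → (n : ℝ) * t < j + 1 →
        edgeMap o e t ∈ B := by
  have hopen : ∀ B ∈ U.sets, IsOpen (edgeMap o e ⁻¹' B) := fun B hB =>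
    (U.isOpen_of_mem B hB).preimage (continuous_edgeMap e)
  obtain ⟨δ₀, hδ₀, h₀⟩ := Metric.isOpen_iff.1 (hopen _ (hAU (o.src e))) 0
    (by rw [Set.mem_preimage, edgeMap_zero]; exact hA _)
  obtain ⟨δ₁, hδ₁, h₁⟩ := Metric.isOpen_iff.1 (hopen _ (hAU (o.tgt e))) 1
    (by rw [Set.mem_preimage, edgeMap_one]; exact hA _)
  obtain ⟨δ, hδ, h⟩ := lebesgue_number_lemma_of_metric_sUnion (s := Set.univ)
    (c := (edgeMap o e ⁻¹' ·) '' U.sets) isCompact_univ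
    (by rintro _ ⟨B, hB, rfl⟩; exact hopen B hB) (by
      intro t _
      obtain ⟨B, hB, htB⟩ := Set.mem_sUnion.1
        (U.sUnion_eq.symm ▸ Set.mem_univ (edgeMap o e t))
      exact ⟨_, ⟨B, hB, rfl⟩, htB⟩)
  have hlarge : ∀ ε : ℝ, 0 < ε → ∀ᶠ n : ℕ in atTop, 2 < n * ε := fun ε hε =>
    (tendsto_natCast_atTop_atTop.atTop_mul_const hε).eventually_gt_atTop 2
  filter_upwards [hlarge _ hδ₀, hlarge _ hδ₁, hlarge _ hδ] with n hn₀ hn₁ hn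
  have hn' : (0 : ℝ) ≤ n := Nat.cast_nonneg n
  -- Two points of a piece satisfy `|n * s - n * t| < 2`, so their distance is below `ε` once `2 < n
  -- * ε`.
  have hdist : ∀ {ε : ℝ} {s t : unitInterval}, 2 < n * ε → |(n : ℝ) * s - n * t| < 2 →
      s ∈ Metric.ball t ε := by
    intro ε s t hε hst
    rw [Metric.mem_ball, Subtype.dist_eq, Real.dist_eq]
    rw [← mul_sub, abs_mul, abs_of_nonneg hn'] at hst
    by_contra! hcon
    nlinarith
  refine ⟨fun t ht => h₀ (hdist hn₀ ?_), fun t ht => h₁ (hdist hn₁ ?_), fun j => ?_⟩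
  · have := t.2.1
    rw [abs_lt, Set.Icc.coe_zero]
    constructor <;> nlinarith
  · have := t.2.2
    rw [abs_lt, Set.Icc.coe_one]
    constructor <;> nlinarith
  · by_cases hex : ∃ t : unitInterval, (j : ℝ) - 1 < n * t ∧ (n : ℝ) * t < j + 1
    · obtain ⟨s, hs₁, hs₂⟩ := hex
      obtain ⟨_, ⟨B, hB, rfl⟩, hsB⟩ := h s (Set.mem_univ _)
      refine ⟨B, hB, fun t ht₁ ht₂ => hsB (hdist hn ?_)⟩
      rw [abs_lt]
      constructor <;> linarith
    · push Not at hex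
      exact ⟨_, hAU (o.src e), fun t ht₁ ht₂ => absurd ht₂ (not_lt.2 (hex t ht₁))⟩

theorem Ends.EventuallyIn.infinite {ω : Ends G} {X : Set V(G)} (h : ω.EventuallyIn X) :
    X.Infinite := by
  induction ω using Quotient.inductionOn with
  | h R =>
    obtain ⟨N, hN⟩ := h R rfl
    exact Set.infinite_of_injective_forall_mem
      (f := fun n => R.vert (N + n)) (fun a b hab => by
        have := R.injective hab
        omega) fun n => hN _ (by omega)

open Filter in
/-- Every open cover of `|G|` is refined by the cover belonging to some partition. -/
theorem exists_partitionCover_refinement [G.Loopless] (hconn : G.toSimpleGraph.Connected)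
    (hfin : LocallyFinite G) (U : Cech.OpenCover (Freudenthal o)) :
    ∃ (ι : Type u) (P : V(G) → ι) (hP : {e | P (o.src e) ≠ P (o.tgt e)}.Finite) (m : ℕ)
      (hm : 0 < 3 * m), Nonempty (Cech.Refinement (partitionCover hP hm) U) := by
  classical
  obtain ⟨S, hS⟩ := exists_finset_hat_subset hconn hfin U
  -- The classes are the single vertices of `S` and the components of `G - S`. Every cross-edge
  -- meets `S`, so there are only finitely many.
  let P : V(G) → V(G) ⊕ G.toSimpleGraph.ComponentCompl (S : Set V(G)) := fun x =>
    if h : x ∈ (S : Set V(G)) then Sum.inl x else Sum.inr (G.toSimpleGraph.componentComplMk h)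
  have hPl : ∀ {x y}, P y = Sum.inl x → y = x := by
    intro x y h
    simp only [P] at h
    split_ifs at h
    exact Sum.inl_injective h
  have hPr : ∀ {C x}, P x = Sum.inr C → x ∈ C := by
    intro C x h
    simp only [P] at h
    split_ifs at h with hx
    rw [← Sum.inr_injective h]
    exact SimpleGraph.componentComplMk_mem _ _
  have hcut : ∀ e, P (o.src e) ≠ P (o.tgt e) → o.src e ∈ S ∨ o.tgt e ∈ S := by
    intro e he
    by_contra! hcon
    refine he ?_
    have h₁ : o.src e ∉ (S : Set V(G)) := hcon.1
    have h₂ : o.tgt e ∉ (S : Set V(G)) := hcon.2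
    simp only [P, dif_neg h₁, dif_neg h₂]
    exact congrArg _ (SimpleGraph.componentComplMk_eq_of_adj _ _ _ (o.adj e))
  have hP : {e | P (o.src e) ≠ P (o.tgt e)}.Finite := by
    refine (S.finite_toSet.biUnion fun x _ => hfin.finite_incident (o := o) x).subset fun e he => ?_
    rcases hcut e he with h | h
    · exact Set.mem_biUnion h (Or.inl rfl)
    · exact Set.mem_biUnion h (Or.inr rfl)
  have hex : ∀ x : V(G), ∃ A ∈ U.sets, Freudenthal.vertex (o := o) x ∈ A := fun x =>
    Set.mem_sUnion.1 (U.sUnion_eq.symm ▸ Set.mem_univ _)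
  choose A hAU hA using hex
  have hinc : {e : E(G) | o.src e ∈ S ∨ o.tgt e ∈ S}.Finite := by
    refine (S.finite_toSet.biUnion fun x _ => hfin.finite_incident (o := o) x).subset ?_
    rintro e (h | h)
    · exact Set.mem_biUnion h (Or.inl rfl)
    · exact Set.mem_biUnion h (Or.inr rfl)
  have hev := (eventually_all_finite hinc).2 fun e _ => eventually_subdivision U hAU hA e
  obtain ⟨N, hN⟩ := eventually_atTop.1 hev
  -- A subdivision beyond the threshold, with a number of parts divisible by 3 as the edge covers
  -- need it.
  have hm := hN (3 * (N + 1)) (by omega)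
  refine ⟨_, P, hP, N + 1, by omega, ⟨Cech.Refinement.ofSubset ?_⟩⟩
  rintro _ (⟨x, rfl⟩ | ⟨e, j, he, hj0, hj, rfl⟩)
  · rcases hx : P x with y | C
    · refine ⟨A y, hAU y, ?_⟩
      have hyS : y ∈ S := by
        simp only [P] at hx
        split_ifs at hx with h
        exact Sum.inl_injective hx ▸ h
      rintro (z | ⟨e, t⟩ | ω) hp
      · rw [hPl hp]
        exact hA y
      · rw [← edgeMap_of_mem e t ⟨t.2.1.le, t.2.2.le⟩]
        rcases inner_mem_block.1 hp with ⟨h₁, h₂⟩ | ⟨h₁, h₂⟩ | ⟨h₁, h₂⟩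
        · have h₃ := hPl h₁
          rw [← h₃]
          exact (hm e (Or.inl (h₃ ▸ hyS))).1 _ h₂
        · have h₃ := hPl h₁
          rw [← h₃]
          exact (hm e (Or.inr (h₃ ▸ hyS))).2.1 _ h₂
        · exact absurd ((hPl h₁).trans (hPl h₂).symm) (o.src_ne_tgt e)
      -- A class that is a single vertex contains no tail of a ray, so no end belongs to its block.
      · refine absurd ((Set.finite_singleton y).subset fun z hz => ?_)
          (ofEnd_mem_block.1 hp).infinite
        exact hPl hz
    · obtain ⟨B, hB, hCB⟩ := hS C
      refine ⟨B, hB, Set.Subset.trans ?_ hCB⟩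
      rintro (z | ⟨e, t⟩ | ω) hp
      · exact hPr hp
      · rcases inner_mem_block.1 hp with ⟨h₁, -⟩ | ⟨h₁, -⟩ | ⟨h₁, -⟩
        · exact Or.inl (hPr h₁)
        · exact Or.inr (hPr h₁)
        · exact Or.inl (hPr h₁)
      · intro R hR
        obtain ⟨N, hN⟩ := ofEnd_mem_block.1 hp R hR
        exact ⟨N, fun n hn => hPr (hN n hn)⟩
  · obtain ⟨B, hB, hsub⟩ := (hm e (hcut e he)).2.2 j
    refine ⟨B, hB, ?_⟩
    rintro _ ⟨t, ht, rfl⟩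
    rw [← edgeMap_of_mem e t ⟨t.2.1.le, t.2.2.le⟩]
    exact hsub _ ht.1 ht.2

/-- A Čech class is determined by its coefficients. -/
theorem coeff_injective [G.Loopless] (hconn : G.toSimpleGraph.Connected)
    (hfin : LocallyFinite G) : Function.Injective (coeff o) := by
  refine (injective_iff_map_eq_zero _).2 fun c hc => Subtype.ext (funext fun U => ?_)
  obtain ⟨ι, P, hP, m, hm, ⟨r⟩⟩ := exists_partitionCover_refinement hconn hfin U
  rw [← c.2 U _ r, eq_zero_of_edgeCoeff (x := c.1 (partitionCover hP hm)) fun e s => ?_, map_zero]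
  · rfl
  · rw [c.2 _ _ s]
    exact congrFun hc e

section

variable {ι : Type*} {P : V(G) → ι} (hP : {e | P (o.src e) ≠ P (o.tgt e)}.Finite) {m : ℕ}
  (hm : 0 < 3 * m) {φ : E(G) → ℤ} (hφ : IsFlow o φ)

/-- The homology class of a flow in the nerve of the cover belonging to a partition. -/
noncomputable def flowClass : Cech.NerveH1 (partitionCover hP hm) :=
  let _ : Fintype {e // P (o.src e) ≠ P (o.tgt e)} := hP.fintype
  Submodule.Quotient.mk ⟨flowChain hP hm φ, flowChain_mem_cycles hφ⟩

variable {hP hm}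

theorem edgeCoeff_mapH1_flowClass {e : E(G)}
    (r : Cech.Refinement (partitionCover hP hm) (edgeCover o e)) :
    edgeCoeff e (r.mapH1 (flowClass hP hm hφ)) = φ e := by
  let _ : Fintype {e // P (o.src e) ≠ P (o.tgt e)} := hP.fintype
  exact (edgeCoeff_mapH1_mk ⟨e, ne_of_refinement r⟩ r _).trans
    (pairing_flowChain (by omega) φ ⟨e, ne_of_refinement r⟩)

/-- No comparison of chains is needed: both classes have coefficient `φ e` at every cross-edge, and
these coefficients determine the class. -/
theorem mapH1_flowClass {ι' : Type*} {P' : V(G) → ι'}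
    {hP' : {e | P' (o.src e) ≠ P' (o.tgt e)}.Finite} {m' : ℕ} {hm' : 0 < 3 * m'}
    (r : Cech.Refinement (partitionCover hP' hm') (partitionCover hP hm)) :
    r.mapH1 (flowClass hP' hm' hφ) = flowClass hP hm hφ := by
  rw [← sub_eq_zero]
  refine eq_zero_of_edgeCoeff fun e s => ?_
  rw [map_sub, map_sub, edgeCoeff_mapH1_flowClass, ← Cech.Refinement.mapH1_comp, edgeCoeff_mapH1_flowClass,
    sub_self]

end

/-- Every flow is the coefficient function of a Čech class. -/
theorem IsFlow.exists_coeff_eq [G.Loopless] (hconn : G.toSimpleGraph.Connected)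
    (hfin : LocallyFinite G) {φ : E(G) → ℤ} (hφ : IsFlow o φ) : ∃ c, coeff o c = φ := by
  choose ι P hP m hm r using fun U => exists_partitionCover_refinement (o := o) hconn hfin U
  let r' := fun U => (r U).some
  -- The projections to `U` and `W` were chosen independently. Both classes are pulled up to a
  -- partition cover refining the two chosen ones, where independence of the projection settles the
  -- equality.
  have key : ∀ U W (s : Cech.Refinement W U), s.mapH1 ((r' W).mapH1 (flowClass (hP W) (hm W) hφ)) =
      (r' U).mapH1 (flowClass (hP U) (hm U) hφ) := by
    intro U W s
    obtain ⟨⟨a⟩, ⟨b⟩⟩ := Cech.OpenCover.exists_refinement_inter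
      (partitionCover (hP U) (hm U)) (partitionCover (hP W) (hm W))
    obtain ⟨ι₂, P₂, hP₂, m₂, hm₂, ⟨t⟩⟩ := exists_partitionCover_refinement hconn hfin
      ((partitionCover (hP U) (hm U)).inter (partitionCover (hP W) (hm W)))
    rw [← mapH1_flowClass hφ (a.comp t), ← mapH1_flowClass hφ (b.comp t), ← Cech.Refinement.mapH1_comp,
      ← Cech.Refinement.mapH1_comp, ← Cech.Refinement.mapH1_comp]
    exact congrFun (congrArg _ (Cech.Refinement.mapH1_eq _ _)) _
  refine ⟨⟨fun U => (r' U).mapH1 (flowClass (hP U) (hm U) hφ), key⟩, funext fun e => ?_⟩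
  exact edgeCoeff_mapH1_flowClass hφ _

end

end EndGraph

/-! ### Ancestors in a rooted tree -/

namespace SimpleGraph

variable {V : Type*} {H : SimpleGraph V} {r : V}

variable (H r) in
/-- The ancestors of a vertex `v` in a tree with root `r`: the vertices of the path from `v`
to `r`. -/
def ancestors (v : V) : Set V := {x | ∃ q : H.Walk v r, q.IsPath ∧ x ∈ q.support}

theorem IsTree.mem_ancestors_iff (hH : H.IsTree) {v x : V} {q : H.Walk v r} (hq : q.IsPath) :
    x ∈ H.ancestors r v ↔ x ∈ q.support := by
  refine ⟨?_, fun h => ⟨q, hq, h⟩⟩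
  rintro ⟨p, hp, hx⟩
  rwa [(hH.existsUnique_path v r).unique hq hp]

theorem IsTree.finite_ancestors (hH : H.IsTree) (v : V) : (H.ancestors r v).Finite := by
  obtain ⟨q, hq, -⟩ := hH.existsUnique_path v r
  refine q.support.finite_toSet.subset fun x hx => ?_
  exact (hH.mem_ancestors_iff hq).1 hx

theorem IsTree.ancestors_root (hH : H.IsTree) : H.ancestors r r = {r} := by
  ext x
  rw [hH.mem_ancestors_iff Walk.IsPath.nil]
  simp

theorem IsTree.self_mem_ancestors (hH : H.IsTree) (v : V) : v ∈ H.ancestors r v := by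
  obtain ⟨q, hq, -⟩ := hH.existsUnique_path v r
  exact ⟨q, hq, q.start_mem_support⟩

theorem IsTree.ancestors_eq_insert (hH : H.IsTree) {a v : V} (h : H.Adj v a)
    (hv : v ∉ H.ancestors r a) : H.ancestors r v = insert v (H.ancestors r a) := by
  obtain ⟨q, hq, -⟩ := hH.existsUnique_path a r
  have hq' : (Walk.cons h q).IsPath :=
    (Walk.cons_isPath_iff _ _).2 ⟨hq, fun hx => hv ((hH.mem_ancestors_iff hq).2 hx)⟩
  ext x
  rw [hH.mem_ancestors_iff hq', Set.mem_insert_iff, hH.mem_ancestors_iff hq, Walk.support_cons,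
    List.mem_cons]

/-- Each of `a` and `b` is the second vertex on the unique path from `v` to the root. -/
theorem IsTree.eq_of_adj_of_notMem_ancestors (hH : H.IsTree) {a b v : V} (ha : H.Adj v a)
    (hb : H.Adj v b) (hva : v ∉ H.ancestors r a) (hvb : v ∉ H.ancestors r b) : a = b := by
  obtain ⟨q, hq, -⟩ := hH.existsUnique_path a r
  obtain ⟨q', hq', -⟩ := hH.existsUnique_path b r
  have h₁ : (Walk.cons ha q).IsPath :=
    (Walk.cons_isPath_iff _ _).2 ⟨hq, fun hx => hva ((hH.mem_ancestors_iff hq).2 hx)⟩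
  have h₂ : (Walk.cons hb q').IsPath :=
    (Walk.cons_isPath_iff _ _).2 ⟨hq', fun hx => hvb ((hH.mem_ancestors_iff hq').2 hx)⟩
  have h := congrArg Walk.snd ((hH.existsUnique_path v r).unique h₁ h₂)
  simpa using h

theorem IsTree.notMem_ancestors_or (hH : H.IsTree) {a b : V} (h : H.Adj a b) :
    b ∉ H.ancestors r a ∨ a ∉ H.ancestors r b := by
  by_contra! hcon
  obtain ⟨q, hq, -⟩ := hH.existsUnique_path a r
  obtain ⟨q', hq', -⟩ := hH.existsUnique_path b r
  refine hH.isAcyclic.ne_mem_support_of_support_of_adj_of_isPath hq.reverse hq'.reverse h ?_ ?_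
  · simpa using (hH.mem_ancestors_iff hq).1 hcon.1
  · simpa using (hH.mem_ancestors_iff hq').1 hcon.2

/-- Induction along a tree, away from the root. -/
theorem IsTree.induction_ancestors (hH : H.IsTree) {Q : V → Prop} (h₀ : Q r)
    (h : ∀ a v, H.Adj v a → v ∉ H.ancestors r a → Q a → Q v) (v : V) : Q v := by
  obtain ⟨q, hq, -⟩ := hH.existsUnique_path v r
  induction q with
  | nil => exact h₀
  | cons hadj q ih =>
    obtain ⟨hq₁, hq₂⟩ := (Walk.cons_isPath_iff _ _).1 hq
    exact h _ _ hadj (fun hx => hq₂ ((hH.mem_ancestors_iff hq₁).1 hx)) (ih h₀ h hq₁)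

theorem IsTree.ancestors_subset (hH : H.IsTree) {x y : V} (hx : x ∈ H.ancestors r y) :
    H.ancestors r x ⊆ H.ancestors r y := by
  induction y using hH.induction_ancestors (r := r) with
  | h₀ =>
    rw [hH.ancestors_root] at hx
    rw [Set.mem_singleton_iff.1 hx]
  | h a v hadj hv ih =>
    rw [hH.ancestors_eq_insert hadj hv] at hx
    rcases hx with rfl | hx
    · exact subset_rfl
    · rw [hH.ancestors_eq_insert hadj hv]
      exact (ih hx).trans (Set.subset_insert _ _)

theorem IsTree.ancestors_comparable (hH : H.IsTree) {x y z : V} (hy : y ∈ H.ancestors r x)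
    (hz : z ∈ H.ancestors r x) : y ∈ H.ancestors r z ∨ z ∈ H.ancestors r y := by
  induction x using hH.induction_ancestors (r := r) with
  | h₀ =>
    rw [hH.ancestors_root] at hy hz
    rw [Set.mem_singleton_iff.1 hy, Set.mem_singleton_iff.1 hz]
    exact Or.inl (hH.self_mem_ancestors _)
  | h a v hadj hv ih =>
    by_cases h₁ : y = v
    · exact Or.inr (h₁ ▸ hz)
    by_cases h₂ : z = v
    · exact Or.inl (h₂ ▸ hy)
    rw [hH.ancestors_eq_insert hadj hv] at hy hz
    exact ih (hy.resolve_left h₁) (hz.resolve_left h₂)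

end SimpleGraph

/-! ### Fundamental cuts and fundamental cycles -/

namespace EndGraph

open scoped Graph

universe u v

variable {α : Type u} {β : Type v} {G : Graph α β}

section

variable {o : Direction G}

/-- The fundamental cuts of a normal spanning tree (with edge set `D`) are finite. -/
theorem exists_fundamental_cut (hfin : LocallyFinite G) {H : SimpleGraph V(G)} (hH : H.IsTree)
    (r : V(G)) {D : Set E(G)} (hD : ∀ e ∈ D, H.Adj (o.src e) (o.tgt e))
    (hinj : ∀ e ∈ D, ∀ e' ∈ D, s(o.src e, o.tgt e) = s(o.src e', o.tgt e') → e = e')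
    (hcomp : ∀ e : E(G), o.src e ∈ H.ancestors r (o.tgt e) ∨ o.tgt e ∈ H.ancestors r (o.src e))
    {e : E(G)} (he : e ∈ D) :
    ∃ X : Set V(G), {e' | (o.src e' ∈ X) ≠ (o.tgt e' ∈ X)}.Finite ∧
      ∀ e' ∈ D, (o.src e' ∈ X) ≠ (o.tgt e' ∈ X) ↔ e' = e := by
  have hfinite : ∀ z, {e' | (o.src e' ∈ {x | z ∈ H.ancestors r x}) ≠
      (o.tgt e' ∈ {x | z ∈ H.ancestors r x})}.Finite := by
    intro z
    -- If an edge leaves the set of descendants of `z`, then by comparability its outer endvertex is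
    -- an ancestor of `z`. There are finitely many of these, each with finitely many edges.
    have key : ∀ x y, z ∈ H.ancestors r x → z ∉ H.ancestors r y →
        x ∈ H.ancestors r y ∨ y ∈ H.ancestors r x → y ∈ H.ancestors r z := by
      intro x y hx hy hxy
      have h := hxy.resolve_left fun h => hy (hH.ancestors_subset h hx)
      exact (hH.ancestors_comparable h hx).resolve_right hy
    refine ((hH.finite_ancestors (r := r) z).biUnion fun x _ =>
      hfin.finite_incident (o := o) x).subset fun e' he' => ?_
    by_cases h₁ : z ∈ H.ancestors r (o.src e') <;> by_cases h₂ : z ∈ H.ancestors r (o.tgt e')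
    · exact absurd (propext (iff_of_true h₁ h₂)) he'
    · exact Set.mem_biUnion (key _ _ h₁ h₂ (hcomp e')) (Or.inr rfl)
    · exact Set.mem_biUnion (key _ _ h₂ h₁ (hcomp e').symm) (Or.inl rfl)
    · exact absurd (propext (iff_of_false h₁ h₂)) he'
  -- Passing from a parent `c` to its child `d` adds only `d` to the ancestors. So the tree edge
  -- crosses the descendant set of `b` only if `d = b`, and the parent of `b` is unique.
  have hcross : ∀ a b c d, H.Adj b a → b ∉ H.ancestors r a → H.Adj d c → d ∉ H.ancestors r c →
      ((b ∈ H.ancestors r d) ≠ (b ∈ H.ancestors r c) ↔ s(c, d) = s(a, b)) := by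
    intro a b c d hba hb hdc hd
    rw [hH.ancestors_eq_insert hdc hd]
    constructor
    · intro h
      by_cases hbd : b = d
      · subst hbd
        rw [hH.eq_of_adj_of_notMem_ancestors hdc hba hd hb]
      · exact absurd (by simp [hbd]) h
    · intro h
      rcases Sym2.eq_iff.1 h with ⟨rfl, rfl⟩ | ⟨rfl, rfl⟩
      · simp [hd]
      · refine absurd ?_ hb
        rw [hH.ancestors_eq_insert hdc hd]
        exact Set.mem_insert_of_mem _ (hH.self_mem_ancestors _)
  obtain ⟨a, b, hba, hb, hab⟩ : ∃ a b, H.Adj b a ∧ b ∉ H.ancestors r a ∧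
      s(o.src e, o.tgt e) = s(a, b) := by
    rcases hH.notMem_ancestors_or (r := r) (hD e he) with h | h
    · exact ⟨_, _, (hD e he).symm, h, rfl⟩
    · exact ⟨_, _, hD e he, h, Sym2.eq_swap⟩
  refine ⟨{x | b ∈ H.ancestors r x}, hfinite b, fun e' he' => ?_⟩
  have hiff : e' = e ↔ s(o.src e', o.tgt e') = s(a, b) := by
    rw [← hab]
    exact ⟨fun h => h ▸ rfl, hinj _ he' _ he⟩
  rw [hiff]
  rcases hH.notMem_ancestors_or (r := r) (hD e' he') with h | h
  · rw [ne_comm]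
    exact hcross a b _ _ hba hb (hD e' he').symm h
  · rw [Sym2.eq_swap]
    exact hcross a b _ _ hba hb (hD e' he') h

/-- A flow that vanishes on the chords of a spanning tree with finite fundamental cuts is zero. -/
theorem IsFlow.eq_zero_of_chords {D : Set E(G)}
    (hcut : ∀ e ∈ D, ∃ X : Set V(G), {e' | (o.src e' ∈ X) ≠ (o.tgt e' ∈ X)}.Finite ∧
      ∀ e' ∈ D, (o.src e' ∈ X) ≠ (o.tgt e' ∈ X) ↔ e' = e) {φ : E(G) → ℤ} (hφ : IsFlow o φ)
    (h : ∀ e ∉ D, φ e = 0) : φ = 0 := by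
  classical
  funext e
  by_cases he : e ∈ D
  · obtain ⟨X, hX, hXD⟩ := hcut e he
    -- Within the cut, `e` is the only tree edge and the chords carry no flow, so the cut sum is
    -- plus or minus `φ e`.
    have hsum := hφ X hX.toFinset fun e' he' => hX.mem_toFinset.2 he'
    have hne := (hXD e he).2 rfl
    rw [Finset.sum_eq_single_of_mem e (hX.mem_toFinset.2 hne)] at hsum
    · by_cases h₁ : o.src e ∈ X <;> by_cases h₂ : o.tgt e ∈ X <;> simp_all
    · intro e' he' hne'
      rw [h e' fun hD => hne' ((hXD e' hD).1 (hX.mem_toFinset.1 he')), zero_mul]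
  · exact h e he

theorem sum_single_mul [DecidableEq E(G)] {X : Set V(G)} {F : Finset E(G)}
    (hF : ∀ e, (o.src e ∈ X) ≠ (o.tgt e ∈ X) → e ∈ F) (e : E(G)) (k : ℤ) :
    ∑ e' ∈ F, (Pi.single e k : E(G) → ℤ) e' * (X.indicator 1 (o.tgt e') - X.indicator 1 (o.src e'))
      = k * (X.indicator 1 (o.tgt e) - X.indicator 1 (o.src e)) := by
  classical
  rw [Finset.sum_eq_single e]
  · rw [Pi.single_eq_same]
  · intro e' _ hne
    rw [Pi.single_eq_of_ne hne, zero_mul]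
  · intro he
    have h : (o.src e ∈ X) = (o.tgt e ∈ X) := by
      by_contra hne
      exact he (hF e hne)
    simp [Set.indicator, h]

/-- A unit flow along a walk. -/
theorem exists_walk_flow {H : SimpleGraph V(G)} {D : Set E(G)}
    (hD : ∀ x y, H.Adj x y → ∃ e ∈ D, (o.src e = x ∧ o.tgt e = y) ∨ (o.src e = y ∧ o.tgt e = x))
    {x y : V(G)} (p : H.Walk x y) :
    ∃ ψ : E(G) → ℤ, (∀ e ∉ D, ψ e = 0) ∧
      ∀ (X : Set V(G)) (F : Finset E(G)), (∀ e, (o.src e ∈ X) ≠ (o.tgt e ∈ X) → e ∈ F) →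
        ∑ e ∈ F, ψ e * (X.indicator 1 (o.tgt e) - X.indicator 1 (o.src e)) =
          X.indicator 1 y - X.indicator 1 x := by
  classical
  induction p with
  | nil => exact ⟨0, fun _ _ => rfl, fun X F _ => by simp⟩
  | @cons x z y hadj p ih =>
    obtain ⟨ψ, hψ, hsum⟩ := ih
    obtain ⟨e, he, hxz⟩ := hD x z hadj
    obtain ⟨k, hk⟩ : ∃ k : ℤ, ∀ X : Set V(G),
        k * (X.indicator 1 (o.tgt e) - X.indicator 1 (o.src e)) =
          X.indicator 1 z - X.indicator 1 x := by
      rcases hxz with ⟨rfl, rfl⟩ | ⟨rfl, rfl⟩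
      · exact ⟨1, fun X => one_mul _⟩
      · exact ⟨-1, fun X => by ring⟩
    refine ⟨ψ + Pi.single e k, fun e' he' => ?_, fun X F hF => ?_⟩
    · have hne : e' ≠ e := fun h => he' (h ▸ he)
      simp [hψ e' he', hne]
    · simp only [Pi.add_apply, add_mul, Finset.sum_add_distrib, hsum X F hF,
        sum_single_mul hF e k, hk]
      ring

/-- Every integer-valued function on the chords of a spanning tree with finite fundamental cuts
extends to a flow. -/
theorem exists_isFlow_eq_on_chords {H : SimpleGraph V(G)} (hH : H.Connected) {D : Set E(G)}
    (hD : ∀ x y, H.Adj x y → ∃ e ∈ D, (o.src e = x ∧ o.tgt e = y) ∨ (o.src e = y ∧ o.tgt e = x))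
    (hcut : ∀ e ∈ D, ∃ X : Set V(G), {e' | (o.src e' ∈ X) ≠ (o.tgt e' ∈ X)}.Finite ∧
      ∀ e' ∈ D, (o.src e' ∈ X) ≠ (o.tgt e' ∈ X) ↔ e' = e) (f : E(G) → ℤ) :
    ∃ φ, IsFlow o φ ∧ ∀ e ∉ D, φ e = f e := by
  classical
  choose ψ hψ hsum using fun e : E(G) =>
    exists_walk_flow hD (hH.preconnected (o.tgt e) (o.src e)).some
  -- The fundamental cycle of the chord `e`, closed up through the tree from its target to its
  -- source, taken `f e` times.
  let z : {e // e ∉ D} → E(G) → ℤ := fun e => f e • (Pi.single e.1 1 + ψ e)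
  have hz : ∀ e, IsFlow o (z e) := by
    intro e
    refine (flows o).zsmul_mem (mem_flows.2 fun X F hF => ?_) _
    simp only [Pi.add_apply, add_mul, Finset.sum_add_distrib, hsum e X F hF,
      sum_single_mul hF e.1 1]
    ring
  have hchord : ∀ (e : {e // e ∉ D}) (e' : E(G)), e' ∉ D → z e e' = if e' = e then f e else 0 := by
    intro e e' he'
    simp [z, hψ e e' he', Pi.single_apply]
  -- If a chord is not in the fundamental cut of the tree edge `e'`, then in that cut its cycle
  -- could be non-zero only at `e'`, and the cut condition forces the value 0. So only the finitely
  -- many chords of the cut use `e'`.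
  have hthin : ∀ e', (Function.support fun e => z e e').Finite := by
    intro e'
    by_cases he' : e' ∈ D
    · obtain ⟨X, hX, hXD⟩ := hcut e' he'
      refine (hX.preimage Subtype.val_injective.injOn).subset fun e he => ?_
      by_contra hne
      have h := hz e X hX.toFinset fun e' he' => hX.mem_toFinset.2 he'
      have hcross := (hXD e' he').2 rfl
      rw [Finset.sum_eq_single_of_mem e' (hX.mem_toFinset.2 hcross)] at h
      · rcases mul_eq_zero.1 h with h | h
        · exact he h
        · by_cases h₁ : o.src e' ∈ X <;> by_cases h₂ : o.tgt e' ∈ X <;> simp_all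
      · intro e'' he'' hne''
        have hD'' : e'' ∉ D := fun hD => hne'' ((hXD e'' hD).1 (hX.mem_toFinset.1 he''))
        have hee : e'' ≠ e := by
          rintro rfl
          exact hne (hX.mem_toFinset.1 he'')
        rw [hchord e e'' hD'', if_neg hee, zero_mul]
    · refine (Set.finite_singleton (⟨e', he'⟩ : {e // e ∉ D})).subset fun e he => ?_
      rw [Function.mem_support, hchord e e' he'] at he
      exact Subtype.ext (by by_contra h; exact he (if_neg fun h' => h h'.symm))
  refine ⟨_, isFlow_finsum hz hthin, fun e he => ?_⟩
  rw [finsum_eq_single _ (⟨e, he⟩ : {e // e ∉ D}) fun e' hne => ?_]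
  · rw [hchord _ _ he, if_pos rfl]
  · rw [hchord _ _ he, if_neg fun h => hne (Subtype.ext h.symm)]

end

end EndGraph

/-! ### Assembling the isomorphisms -/

namespace EndGraph

open scoped Graph

universe u v

variable {α : Type u} {β : Type v} {G : Graph α β}

section

variable {o : Direction G}

/-- The first Čech homology group of `|G|` is isomorphic to the group of flows. -/
noncomputable def coeffEquiv [G.Loopless] (hconn : G.toSimpleGraph.Connected)
    (hfin : LocallyFinite G) (o : Direction G) : Cech.H1 (Freudenthal o) ≃+ flows o :=
  AddEquiv.ofBijective ((coeff o).codRestrict (flows o) isFlow_coeff)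
    ⟨fun _ _ h => coeff_injective hconn hfin (congrArg Subtype.val h), fun φ =>
      (IsFlow.exists_coeff_eq hconn hfin φ.2).imp fun _ h => Subtype.ext h⟩

/-- The oriented topological cycle space is isomorphic to the group of flows. -/
noncomputable def valueEquiv [G.Loopless] (hconn : G.toSimpleGraph.Connected)
    (hfin : LocallyFinite G) (o : Direction G) : cycleSpace o ≃+ flows o :=
  AddEquiv.ofBijective (⟨⟨fun φ => ⟨value φ, isFlow_value hfin φ⟩, rfl⟩, fun _ _ => rfl⟩ :
    cycleSpace o →+ flows o)
    ⟨fun _ _ h => value_injective (congrArg Subtype.val h), fun φ =>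
      (IsFlow.exists_value_eq hconn hfin φ.2).imp fun _ h => Subtype.ext h⟩

theorem value_valueEquiv_symm [G.Loopless] (hconn : G.toSimpleGraph.Connected)
    (hfin : LocallyFinite G) (φ : flows o) : value ((valueEquiv hconn hfin o).symm φ) = φ :=
  congrArg Subtype.val ((valueEquiv hconn hfin o).apply_symm_apply φ)

/-- A normal spanning tree as a simple graph on the vertex set of `G`. -/
theorem IsNormalSpanningTree.exists_simpleGraph {T : Graph α β} {r : V(T)}
    (h : IsNormalSpanningTree G T r) :
    ∃ (H : SimpleGraph V(G)) (s : V(G)), H.IsTree ∧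
      (∀ x y, H.Adj x y ↔ x ≠ y ∧ T.Adj x y) ∧
      ∀ x y : V(G), G.Adj x y → x ∈ H.ancestors s y ∨ y ∈ H.ancestors s x := by
  have hV := h.vertexSet_eq
  let i : V(G) ≃ V(T) := Equiv.setCongr hV.symm
  let f : T.toSimpleGraph.comap i ≃g T.toSimpleGraph := SimpleGraph.Iso.comap i _
  have hH : (T.toSimpleGraph.comap i).IsTree := f.isTree_iff.2 h.isTree
  obtain ⟨s, rfl⟩ := i.surjective r
  refine ⟨T.toSimpleGraph.comap i, s, hH, fun x y => ?_, fun x y hxy => ?_⟩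
  · rw [SimpleGraph.comap_adj]
    exact and_congr_left' i.injective.ne_iff
  · have key : ∀ x y : V(G), (∀ p : T.toSimpleGraph.Walk (i s) (i y), p.IsPath → i x ∈ p.support) →
        x ∈ (T.toSimpleGraph.comap i).ancestors s y := by
      intro x y hp
      obtain ⟨q, hq, -⟩ := hH.existsUnique_path y s
      have hmem : i x ∈ (q.reverse.map f.toHom).support :=
        hp (q.reverse.map f.toHom) (hq.reverse.map i.injective)
      rw [SimpleGraph.Walk.support_map] at hmem
      refine ⟨q, hq, ?_⟩
      simpa using (List.mem_map_of_injective i.injective).1 hmem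
    exact (h.comparable (i x) (i y) hxy).imp (key x y) (key y x)

/-- A function in the cycle space is determined by its values on the chords of a normal spanning
tree, and these can be prescribed arbitrarily. -/
theorem IsNormalSpanningTree.bijective_value [G.Loopless] (hconn : G.toSimpleGraph.Connected)
    (hfin : LocallyFinite G) {T : Graph α β} {r : V(T)} (h : IsNormalSpanningTree G T r) :
    Function.Bijective (fun (φ : cycleSpace o) (e : {e : E(G) // (e : β) ∉ E(T)}) => value φ e) := by
  classical
  obtain ⟨H, s, hH, hadj, hcomp⟩ := h.exists_simpleGraph
  have := h.simple
  let D : Set E(G) := {e | (e : β) ∈ E(T)}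
  have hlink : ∀ e ∈ D, T.IsLink e (o.src e) (o.tgt e) := fun e he =>
    (h.le.isLink_iff he).2 (o.isLink e)
  have hD : ∀ e ∈ D, H.Adj (o.src e) (o.tgt e) := fun e he =>
    (hadj _ _).2 ⟨o.src_ne_tgt e, _, hlink e he⟩
  have hex : ∀ x y, H.Adj x y →
      ∃ e ∈ D, (o.src e = x ∧ o.tgt e = y) ∨ (o.src e = y ∧ o.tgt e = x) := by
    intro x y hxy
    obtain ⟨e, he⟩ := ((hadj _ _).1 hxy).2
    have he' := he.mono h.le
    exact ⟨⟨e, he'.edge_mem⟩, he.edge_mem, o.eq_or_eq_of_isLink he'⟩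
  have hinj : ∀ e ∈ D, ∀ e' ∈ D, s(o.src e, o.tgt e) = s(o.src e', o.tgt e') → e = e' := by
    intro e he e' he' heq
    have h₁ := hlink e he
    refine Subtype.ext (Graph.IsLink.eq h₁ ?_)
    rcases Sym2.eq_iff.1 heq with ⟨h₂, h₃⟩ | ⟨h₂, h₃⟩
    · rw [h₂, h₃]
      exact hlink e' he'
    · rw [h₂, h₃]
      exact (hlink e' he').symm
  have hcut := fun e he => exists_fundamental_cut (o := o) hfin hH s hD hinj
    (fun e => hcomp _ _ ⟨e, o.isLink e⟩) (e := e) he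
  constructor
  · intro φ ψ hφψ
    refine value_injective (sub_eq_zero.1 (IsFlow.eq_zero_of_chords hcut
      ((flows o).sub_mem (isFlow_value hfin φ) (isFlow_value hfin ψ)) fun e he => ?_))
    exact sub_eq_zero.2 (congrFun hφψ ⟨e, he⟩)
  · intro f
    obtain ⟨φ, hφ, hφf⟩ := exists_isFlow_eq_on_chords hH.connected hex hcut
      fun e => if he : (e : β) ∈ E(T) then 0 else f ⟨e, he⟩
    obtain ⟨x, hx⟩ := hφ.exists_value_eq hconn hfin
    refine ⟨x, funext fun e => ?_⟩
    change value x e = f e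
    rw [hx, hφf e e.2, dif_neg e.2]

end

end EndGraph

theorem theorem3p1 {α : Type*} {β : Type*} (G : Graph α β) [G.Loopless]
    (hconn : G.toSimpleGraph.Connected) (hfin : EndGraph.LocallyFinite G)
    (o : EndGraph.Direction G) :
    (∃! Φ : Cech.H1 (EndGraph.Freudenthal o) ≃+ EndGraph.cycleSpace o,
      ∀ (c : Cech.H1 (EndGraph.Freudenthal o)) (e : G.edgeSet),
        EndGraph.IsCoeff o c e (EndGraph.value (Φ c) e)) ∧
    ∀ (T : Graph α β) (r : T.vertexSet), EndGraph.IsNormalSpanningTree G T r →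
      Function.Bijective
        (fun (φ : EndGraph.cycleSpace o) (e : {e : G.edgeSet // (e : β) ∉ T.edgeSet}) =>
          EndGraph.value φ e) := by
  refine ⟨⟨(EndGraph.coeffEquiv hconn hfin o).trans (EndGraph.valueEquiv hconn hfin o).symm,
    fun c e => ?_, fun Ψ hΨ => ?_⟩, fun T r hT => hT.bijective_value hconn hfin⟩
  · exact EndGraph.isCoeff_iff.2 (congrFun (EndGraph.value_valueEquiv_symm hconn hfin _) e)
  -- The coefficient condition fixes all values of `Ψ c` on natural orientations, and hence `Ψ c`.
  · refine AddEquiv.ext fun c => EndGraph.value_injective (funext fun e => ?_)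
    exact (EndGraph.isCoeff_iff.1 (hΨ c e)).trans
      (congrFun (EndGraph.value_valueEquiv_symm hconn hfin
        (EndGraph.coeffEquiv hconn hfin o c)) e).symm
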